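/- \textbf{Notation.} A signature of length $N$ is a tuple $\lambda=(\lambda_1\ge\dots\ge\lambda_N)\in\mathbb Z^N$; $\hat U(N)$ is the set of all of them. The rational Schur function $\chi^\lambda$ is $$\chi^\lambda(u_1,\dots,u_N)=\frac{\det\big(u_i^{\lambda_j+N-j}\big)_{1\le i,j\le N}}{\prod_{i<j}(u_i-u_j)},$$ extended by continuity to coinciding arguments. For a probability measure $\varrho$ on $\hat U(N)$ the Schur generating function is $S_\varrho(u_1,\dots,u_N)=\sum_{\lambda}\varrho[\lambda]\,\chi^\lambda(u_1,\dots,u_N)/\chi^\lambda(1,\dots,1)$. For $q\in[-1,1]$ the $q$-deformed Perelomov--Popov measure of $\lambda\in\hat U(N)$ is the probability measure $$m_{N,PP(q)}[\lambda]=\frac1N\sum_{i=1}^N\Big(\prod_{j\ne i}\frac{(\lambda_i-i)-(\lambda_j-j)-q}{(\lambda_i-i)-(\lambda_j-j)}\Big)\,\delta\Big(\frac{\lambda_i+N-i}{N}\Big),$$ and $\mathbb E[m_{N,PP(q)}[\varrho]]=\sum_\lambda\varrho[\lambda]\,m_{N,PP(q)}[\lambda]$. Let $e_q(u)=(1-qu)^{-1/q}$,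 with $e_0(u)=e^u$. Let $\beta(1-q,1+q)$ be the beta distribution, understood as $\delta(0)$ for $q=1$ and as $\delta(1)$ for $q=-1$. With $NC(k)$ the set of non-crossing partitions of $\{1,\dots,k\}$, the free cumulants $(\kappa_n)_{n\ge1}$ of a moment sequence $(m_k)_{k\ge 1}$ (or of a measure with these moments) and the infinitesimal free cumulants $(\kappa_n,\kappa_n')_{n\ge1}$ of a pair $(m_k),(m'_k)$ are determined by $$m_k=\sum_{\pi\in NC(k)}\prod_{V\in\pi}\kappa_{|V|},\qquad m'_k=\sum_{\pi\in NC(k)}\sum_{V\in\pi}\kappa'_{|V|}\prod_{W\in\pi,\,W\ne V}\kappa_{|W|}\qquad(k\ge1).$$ \textbf{Theorem.} Let $q\in[-1,1]$ and let $\varrho(N)$, $N\in\mathbb N$, be probability measures on $\hat U(N)$ such that, for every $N$, the series defining $S_{\varrho(N)}$ converges uniformly in a neighbourhood of $1^N=(1,\dots,1)$ in $\mathbb C^N$. Assume that there are functions $\Psi,\Phi$, analytic in a neighbourhood of $1\in\mathbb C$, such that for every fixed $k\in\mathbb N$ $$\lim_{N\to\infty}N\Big(\frac1N\log S_{\varrho(N)}(u_1,\dots,u_k,1^{N-k})-\sum_{i=1}^k\Psi(u_i)\Big)=\sum_{i=1}^k\Phi(u_i)$$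 uniformly in a neighbourhood of $1^k$ in $\mathbb C^k$ (which may depend on $k$ but not on $N$; for large $N$ the logarithm is the analytic branch on this neighbourhood that vanishes at $1^k$). Then all moments of $\mathbb E[m_{N,PP(q)}[\varrho(N)]]$ are finite; there is a compactly supported probability measure $\boldsymbol\mu^{(q)}$ on $\mathbb R$ such that $$\lim_{N\to\infty}\int P\,d\,\mathbb E[m_{N,PP(q)}[\varrho(N)]]=\int P\,d\boldsymbol\mu^{(q)}\quad\text{for every polynomial }P;$$ and the limits $$\varphi_q'(P)=\lim_{N\to\infty}N\Big(\int P\,d\,\mathbb E[m_{N,PP(q)}[\varrho(N)]]-\int P\,d\boldsymbol\mu^{(q)}\Big)$$ exist for every polynomial $P$ and define a linear functional with $\varphi'_q(1)=0$. The infinitesimal free cumulants of the pair $(\boldsymbol\mu^{(q)},\varphi'_q)$, that is, of the moment sequences $m_k=\int t^k\,d\boldsymbol\mu^{(q)}$ and $m'_k=\varphi'_q(t^k)$, are, for every $n\ge1$, $$\kappa_{n}=\frac1{(n-1)!}\,\frac{d^{n-1}}{du^{n-1}}\big(e_q(u)\Psi'(e_q(u))\big)\Big|_{u=0}+\kappa_n\big(\beta(1-q,1+q)\big),$$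 $$\kappa_{n}'=\frac1{(n-1)!}\,\frac{d^{n-1}}{du^{n-1}}\big(e_q(u)\Phi'(e_q(u))\big)\Big|_{u=0}+\kappa_n\Big(\delta\Big(\frac{q-1}2\Big)\Big).$$ -/

import Mathlib

open Filter Topology MeasureTheory

noncomputable section

/-! ### Signatures, rational Schur functions, Schur generating functions -/

/-- Signatures of length `N`: non-increasing `N`-tuples of integers. -/
def Signature (N : ℕ) : Type := {l : Fin N → ℤ // Antitone l}

/-- The strictly decreasing integers `λ_i + N - i` (`i = 1, …, N`); the index of `Fin N` starts
at `0`, so this reads `λ_i + N - 1 - i`. -/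
def Signature.pos {N : ℕ} (l : Signature N) (i : Fin N) : ℤ :=
  l.1 i + (N : ℤ) - 1 - (i : ℤ)

/-- The points of `(ℂ \ {0})^N` with pairwise distinct coordinates. -/
def regularPoints (N : ℕ) : Set (Fin N → ℂ) :=
  {u | Function.Injective u ∧ ∀ i, u i ≠ 0}

/-- The ratio `det (u_i ^ (λ_j + N - j)) / ∏_{i < j} (u_i - u_j)`. -/
def schurRatio {N : ℕ} (l : Signature N) (u : Fin N → ℂ) : ℂ :=
  (Matrix.of fun i j : Fin N => u i ^ l.pos j).det /
    ∏ i : Fin N, ∏ j ∈ Finset.Ioi i, (u i - u j)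

/-- The rational Schur function (irreducible character of `U(N)`) `χ^λ(u_1, …, u_N)`: the ratio of
determinants, extended by continuity to points with coinciding coordinates, such as `1^N`. -/
def schurChar {N : ℕ} (l : Signature N) : (Fin N → ℂ) → ℂ :=
  extendFrom (regularPoints N) (schurRatio l)

/-- The term of the Schur generating function that belongs to the signature `l`. -/
def schurGenTerm {N : ℕ} (ρ : PMF (Signature N)) (l : Signature N) (u : Fin N → ℂ) : ℂ :=
  ((ρ l).toReal : ℂ) * (schurChar l u / schurChar l 1)

/-- The Schur generating function `S_ρ(u) = ∑_λ ρ[λ] χ^λ(u) / χ^λ(1^N)`. -/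
def schurGen {N : ℕ} (ρ : PMF (Signature N)) (u : Fin N → ℂ) : ℂ :=
  ∑' l : Signature N, schurGenTerm ρ l u

/-- The series defining the Schur generating function converges uniformly in a neighbourhood
of `1^N`. -/
def SchurGenConverges {N : ℕ} (ρ : PMF (Signature N)) : Prop :=
  ∃ V ∈ 𝓝 (1 : Fin N → ℂ), SummableUniformlyOn (schurGenTerm ρ) V

/-- The point `(u_1, …, u_k, 1^{N - k})` (only used for `k ≤ N`). -/
def padOnes {k : ℕ} (N : ℕ) (u : Fin k → ℂ) : Fin N → ℂ :=
  fun i => if h : (i : ℕ) < k then u ⟨i, h⟩ else 1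

/-- The `1/N`-correction regime: for every fixed `k`,
`N (N⁻¹ log S_{ρ(N)}(u_1, …, u_k, 1^{N-k}) - ∑ Ψ(u_i)) → ∑ Φ(u_i)` uniformly in a neighbourhood
(a polydisc) of `1^k`. Here `L N` is the analytic branch of `log S_{ρ(N)}(·, 1^{N-k})` on the
polydisc which vanishes at `1^k`. -/
def CorrectionRegime (ρ : ∀ N, PMF (Signature N)) (Ψ Φ : ℂ → ℂ) : Prop :=
  ∀ k : ℕ, ∃ ε > 0, ∃ L : ℕ → (Fin k → ℂ) → ℂ,
    (∀ᶠ N in atTop, AnalyticOnNhd ℂ (L N) (Metric.ball 1 ε) ∧ L N 1 = 0 ∧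
      ∀ u ∈ Metric.ball (1 : Fin k → ℂ) ε, Complex.exp (L N u) = schurGen (ρ N) (padOnes N u)) ∧
    TendstoUniformlyOn (fun (N : ℕ) u => (N : ℂ) * (1 / (N : ℂ) * L N u - ∑ i, Ψ (u i)))
      (fun u => ∑ i, Φ (u i)) atTop (Metric.ball 1 ε)

/-! ### The `q`-deformed Perelomov-Popov measures -/

/-- The weight `∏_{j ≠ i} ((λ_i - i) - (λ_j - j) - q) / ((λ_i - i) - (λ_j - j))`. -/
def ppWeight (q : ℝ) {N : ℕ} (l : Signature N) (i : Fin N) : ℝ :=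
  ∏ j ∈ Finset.univ.erase i, ((l.pos i : ℝ) - l.pos j - q) / ((l.pos i : ℝ) - l.pos j)

theorem Signature.pos_injective {N : ℕ} (l : Signature N) : Function.Injective l.pos := by
  have h : StrictAnti l.pos := by
    intro i j hij
    have h1 := l.2 hij.le
    have h2 : ((i : ℕ) : ℤ) < ((j : ℕ) : ℤ) := by exact_mod_cast hij
    unfold Signature.pos
    linarith
  exact h.injective

/-- The weights are non-negative for `q ∈ [-1, 1]`, so that `ENNReal.ofReal` does not truncate
anything in `ppMeasure`. -/
theorem ppWeight_nonneg {q : ℝ} (hq : q ∈ Set.Icc (-1 : ℝ) 1) {N : ℕ} (l : Signature N)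
    (i : Fin N) : 0 ≤ ppWeight q l i := by
  refine Finset.prod_nonneg fun j hj => ?_
  have hne : l.pos i ≠ l.pos j := fun h => (Finset.ne_of_mem_erase hj) (l.pos_injective h).symm
  rcases lt_or_gt_of_ne hne with h | h
  · have h' : (l.pos i : ℝ) + 1 ≤ l.pos j := by exact_mod_cast h
    exact div_nonneg_of_nonpos (by linarith [hq.1]) (by linarith)
  · have h' : (l.pos j : ℝ) + 1 ≤ l.pos i := by exact_mod_cast h
    exact div_nonneg (by linarith [hq.2]) (by linarith)

/-- The `q`-deformed Perelomov-Popov measure of a signature, for `q ∈ [-1, 1]`: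
`m_{N,PP(q)}[λ] = N⁻¹ ∑_i w_i δ((λ_i + N - i) / N)`, with the weights `w_i` above. -/
def ppMeasure (q : ℝ) {N : ℕ} (l : Signature N) : Measure ℝ :=
  ∑ i : Fin N, ENNReal.ofReal (1 / (N : ℝ) * ppWeight q l i) •
    Measure.dirac ((l.pos i : ℝ) / (N : ℝ))

/-- The averaged measure `𝔼[m_{N,PP(q)}[ρ]]`, where the random signature has distribution `ρ`. -/
def meanPP (q : ℝ) {N : ℕ} (ρ : PMF (Signature N)) : Measure ℝ :=
  Measure.sum fun l : Signature N => ρ l • ppMeasure q l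

/-! ### Free cumulants and infinitesimal free cumulants -/

/-- A partition of `{1, …, n}` is non-crossing if there are no `a < b < c < d` with `a, c` in
one block and `b, d` in a different block. -/
def IsNoncrossing {n : ℕ} (π : Finpartition (Finset.univ : Finset (Fin n))) : Prop :=
  ∀ V ∈ π.parts, ∀ W ∈ π.parts, ∀ a ∈ V, ∀ b ∈ W, ∀ c ∈ V, ∀ d ∈ W,
    a < b → b < c → c < d → V = W

open scoped Classical in
/-- The set `NC(n)` of non-crossing partitions of `{1, …, n}`. -/
def NC (n : ℕ) : Finset (Finpartition (Finset.univ : Finset (Fin n))) :=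
  Finset.univ.filter IsNoncrossing

/-- The non-crossing partitions other than the one with a single block. -/
def properNC (n : ℕ) : Finset (Finpartition (Finset.univ : Finset (Fin n))) :=
  (NC n).filter fun π => Finset.univ ∉ π.parts

theorem card_lt_of_mem_properNC {n : ℕ} {π : Finpartition (Finset.univ : Finset (Fin n))}
    (hπ : π ∈ properNC n) {V : Finset (Fin n)} (hV : V ∈ π.parts) : V.card < n := by
  have h1 : V ≠ Finset.univ := by
    rintro rfl
    exact (Finset.mem_filter.1 hπ).2 hV
  have h2 := Finset.card_lt_card (Finset.ssubset_univ_iff.2 h1)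
  simpa using h2

/-- The free cumulants of a moment sequence `m`, computed recursively from the moment-cumulant
relation `m n = ∑_{π ∈ NC(n)} ∏_{V ∈ π} κ_{|V|}` by separating the partition with one block;
see `moment_eq_sum_freeCumulant` and `freeCumulant_unique`. -/
def freeCumulant (m : ℕ → ℝ) (n : ℕ) : ℝ :=
  m n - ∑ π ∈ (properNC n).attach, ∏ V ∈ π.1.parts.attach, freeCumulant m V.1.card
termination_by n
decreasing_by exact card_lt_of_mem_properNC π.2 V.2

/-- The infinitesimal free cumulants `κ'_n` of a pair of moment sequences `(m, m')`, computed
recursively from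
`m' n = ∑_{π ∈ NC(n)} ∑_{V ∈ π} κ'_{|V|} ∏_{W ∈ π, W ≠ V} κ_{|W|}`
by separating the partition with one block; see `infMoment_eq_sum_infFreeCumulant` and
`infFreeCumulant_unique`. -/
def infFreeCumulant (m m' : ℕ → ℝ) (n : ℕ) : ℝ :=
  m' n - ∑ π ∈ (properNC n).attach, ∑ V ∈ π.1.parts.attach,
    infFreeCumulant m m' V.1.card * ∏ W ∈ π.1.parts.erase V.1, freeCumulant m W.card
termination_by n
decreasing_by exact card_lt_of_mem_properNC π.2 V.2

/-- Summing over `NC(n)`: the one-block partition contributes separately. -/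
theorem sum_NC_eq {n : ℕ} (hn : 1 ≤ n)
    (F : Finset (Finset (Fin n)) → ℝ) :
    ∑ π ∈ NC n, F π.parts = F {Finset.univ} + ∑ π ∈ properNC n, F π.parts := by
  classical
  have hne : (Finset.univ : Finset (Fin n)) ≠ ⊥ := by
    have : Nonempty (Fin n) := ⟨⟨0, hn⟩⟩
    exact Finset.univ_nonempty.ne_empty
  have key : (NC n).filter (fun π => ¬ Finset.univ ∉ π.parts) =
      {Finpartition.indiscrete hne} := by
    ext π
    simp only [Finset.mem_filter, Finset.mem_singleton, not_not]
    constructor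
    · rintro ⟨-, h⟩
      have hall : ∀ V ∈ π.parts, V = Finset.univ := by
        intro V hV
        obtain ⟨a, ha⟩ := π.nonempty_of_mem_parts hV
        exact π.eq_of_mem_parts hV h ha (Finset.mem_univ a)
      ext V
      simp only [Finpartition.indiscrete_parts, Finset.mem_singleton]
      exact ⟨hall V, fun hV => hV ▸ h⟩
    · rintro rfl
      refine ⟨?_, by simp⟩
      simp only [NC, Finset.mem_filter, Finset.mem_univ, true_and]
      intro V hV W hW
      simp only [Finpartition.indiscrete_parts, Finset.mem_singleton] at hV hW
      intros
      rw [hV, hW]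
  rw [← Finset.sum_filter_add_sum_filter_not (NC n) (fun π => Finset.univ ∉ π.parts), key,
    add_comm]
  simp [properNC]

/-- The moment-cumulant relation. -/
theorem moment_eq_sum_freeCumulant (m : ℕ → ℝ) {n : ℕ} (hn : 1 ≤ n) :
    m n = ∑ π ∈ NC n, ∏ V ∈ π.parts, freeCumulant m V.card := by
  rw [sum_NC_eq hn (fun P => ∏ V ∈ P, freeCumulant m V.card), Finset.prod_singleton,
    Finset.card_univ, Fintype.card_fin, freeCumulant]
  have h : ∑ π ∈ (properNC n).attach, ∏ V ∈ π.1.parts.attach, freeCumulant m V.1.card =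
      ∑ π ∈ properNC n, ∏ V ∈ π.parts, freeCumulant m V.card := by
    rw [← Finset.sum_attach (properNC n)]
    refine Finset.sum_congr rfl fun π _ => ?_
    exact Finset.prod_attach π.1.parts (fun V => freeCumulant m V.card)
  rw [h]
  ring

/-- The moment-cumulant relation determines the free cumulants. -/
theorem freeCumulant_unique (m κ : ℕ → ℝ)
    (h : ∀ n, 1 ≤ n → m n = ∑ π ∈ NC n, ∏ V ∈ π.parts, κ V.card) :
    ∀ n, 1 ≤ n → κ n = freeCumulant m n := by
  intro n
  induction n using Nat.strong_induction_on with
  | _ n ih =>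
    intro hn
    have h1 := h n hn
    have h2 := moment_eq_sum_freeCumulant m hn
    rw [sum_NC_eq hn (fun P => ∏ V ∈ P, κ V.card), Finset.prod_singleton,
      Finset.card_univ, Fintype.card_fin] at h1
    rw [sum_NC_eq hn (fun P => ∏ V ∈ P, freeCumulant m V.card), Finset.prod_singleton,
      Finset.card_univ, Fintype.card_fin] at h2
    have h3 : ∑ π ∈ properNC n, ∏ V ∈ π.parts, κ V.card =
        ∑ π ∈ properNC n, ∏ V ∈ π.parts, freeCumulant m V.card := by
      refine Finset.sum_congr rfl fun π hπ => Finset.prod_congr rfl fun V hV => ?_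
      exact ih _ (card_lt_of_mem_properNC hπ hV)
        (Finset.card_pos.2 (π.nonempty_of_mem_parts hV))
    linarith

/-- The infinitesimal moment-cumulant relation. -/
theorem infMoment_eq_sum_infFreeCumulant (m m' : ℕ → ℝ) {n : ℕ} (hn : 1 ≤ n) :
    m' n = ∑ π ∈ NC n, ∑ V ∈ π.parts, infFreeCumulant m m' V.card *
      ∏ W ∈ π.parts.erase V, freeCumulant m W.card := by
  rw [sum_NC_eq hn (fun P => ∑ V ∈ P, infFreeCumulant m m' V.card *
      ∏ W ∈ P.erase V, freeCumulant m W.card), Finset.sum_singleton, Finset.erase_singleton,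
    Finset.prod_empty, mul_one, Finset.card_univ, Fintype.card_fin, infFreeCumulant]
  have h : ∑ π ∈ (properNC n).attach, ∑ V ∈ π.1.parts.attach,
      infFreeCumulant m m' V.1.card * ∏ W ∈ π.1.parts.erase V.1, freeCumulant m W.card =
      ∑ π ∈ properNC n, ∑ V ∈ π.parts, infFreeCumulant m m' V.card *
        ∏ W ∈ π.parts.erase V, freeCumulant m W.card := by
    rw [← Finset.sum_attach (properNC n)]
    refine Finset.sum_congr rfl fun π _ => ?_
    exact Finset.sum_attach π.1.parts (fun V => infFreeCumulant m m' V.card *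
      ∏ W ∈ π.1.parts.erase V, freeCumulant m W.card)
  rw [h]
  ring

/-- The infinitesimal moment-cumulant relation determines the infinitesimal free cumulants. -/
theorem infFreeCumulant_unique (m m' κ' : ℕ → ℝ)
    (h : ∀ n, 1 ≤ n → m' n = ∑ π ∈ NC n, ∑ V ∈ π.parts, κ' V.card *
      ∏ W ∈ π.parts.erase V, freeCumulant m W.card) :
    ∀ n, 1 ≤ n → κ' n = infFreeCumulant m m' n := by
  intro n
  induction n using Nat.strong_induction_on with
  | _ n ih =>
    intro hn
    have h1 := h n hn
    have h2 := infMoment_eq_sum_infFreeCumulant m m' hn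
    rw [sum_NC_eq hn (fun P => ∑ V ∈ P, κ' V.card *
      ∏ W ∈ P.erase V, freeCumulant m W.card), Finset.sum_singleton, Finset.erase_singleton,
      Finset.prod_empty, mul_one, Finset.card_univ, Fintype.card_fin] at h1
    rw [sum_NC_eq hn (fun P => ∑ V ∈ P, infFreeCumulant m m' V.card *
      ∏ W ∈ P.erase V, freeCumulant m W.card), Finset.sum_singleton, Finset.erase_singleton,
      Finset.prod_empty, mul_one, Finset.card_univ, Fintype.card_fin] at h2
    have h3 : ∑ π ∈ properNC n, ∑ V ∈ π.parts, κ' V.card *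
          ∏ W ∈ π.parts.erase V, freeCumulant m W.card =
        ∑ π ∈ properNC n, ∑ V ∈ π.parts, infFreeCumulant m m' V.card *
          ∏ W ∈ π.parts.erase V, freeCumulant m W.card := by
      refine Finset.sum_congr rfl fun π hπ => Finset.sum_congr rfl fun V hV => ?_
      rw [ih _ (card_lt_of_mem_properNC hπ hV)
        (Finset.card_pos.2 (π.nonempty_of_mem_parts hV))]
    linarith

/-- The moment sequence of a measure on `ℝ`. -/
def momentSeq (μ : Measure ℝ) (k : ℕ) : ℝ := ∫ t, t ^ k ∂μ

/-! ### The deformed exponential and the beta distribution -/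

/-- `e_q(u) = (1 - q u)^{-1/q}`, with `e_0(u) = exp u`. -/
def expQ (q : ℝ) (u : ℂ) : ℂ :=
  if q = 0 then Complex.exp u else (1 - (q : ℂ) * u) ^ (-1 / (q : ℂ))

/-- The beta distribution `β(1 - q, 1 + q)` for `q ∈ [-1, 1]`; in the degenerate cases `q = 1` and
`q = -1` it is the point mass at `0` and at `1`, respectively. -/
def betaPP (q : ℝ) : Measure ℝ :=
  if q = 1 then Measure.dirac 0
  else if q = -1 then Measure.dirac 1
  else ProbabilityTheory.betaMeasure (1 - q) (1 + q)

end

/-! The operator x^(p-q) (d/dx)^p sends x^l to l(l-1)…(l-p+1) x^(l-q): it produces a falling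
factorial of the exponent and shifts the exponent by -q. Letting it act on one row of the alternant
det(x_i^(l_j)) at a time and summing over the rows is the same as altering one column, hence one
exponent l_j, at a time and summing over the columns
(`Matrix.sum_det_updateRow_eq_sum_det_updateCol`). At x = 1^N an alternant divided by the
Vandermonde determinant is a constant times the Vandermonde determinant of the exponents, and
shifting l_j by -q multiplies the latter by the Perelomov-Popov weight.

The confluence to 1^N is taken along 1 + ω^i z with ω a primitive N-th root of unity and z → 0. The
sum over the rows is then an average over roots of unity, which extracts one Taylor coefficient in
z. This gives an exact formula (`sum_fallingFactorial_mul_ppWeight`) for the falling factorial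
moments in terms of binomials (N choose m+1) and the Taylor coefficients of the derivatives in Y of
the Schur function at (1+Y, 1+ωz, …), restricted to Y = z. Modulo z^(K+1) only the characteristic
polynomial of the alphabet matters, and K+1 roots of unity padded with ones have the same one as N
roots of unity (`diagCoeff_schurSlice_eq`). So a number of variables independent of N suffices,
which is what the hypothesis on log S controls. Uniform convergence allows summation over the
signatures.

Write S = exp L with L/N = ΣΨ + N⁻¹ΣΦ + o(1/N). Derivatives in Y see the first variable only, and
the Leibniz recursion for exp L (`hasSeriesExpansion_exp`), the expansion of (N choose m+1) and the
Stirling numbers give each moment up to o(1/N). The coefficients are resummed in `limMoment_eq` and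
`corrMoment_succ`, with U = 1 + zΨ'(1+z): (k+1) m_k = [z^k] (1+z)^(k-q) U^(k+1), and m'_k =
[z^(k-1)] (1+z)^(k-1-q) U^k ((1+z)Φ'(1+z) + (q-1)/2).

The substitution 1+z = e_q(u) in these residues (`coeff_binomSeries_mul_pow`) turns them into (k+1)
m_k = [u^k] C^(k+1) and m'_k = [u^k] C^k C', with C = u e_q/(e_q - 1) + u e_q Ψ'(e_q) and C' = u
(e_q Φ'(e_q) + (q-1)/2). By Lagrange inversion these are the moment-cumulant relations and their
linearization (`sum_NC_eq_coeff_pow`, `sum_NC_inf_eq_coeff`), so the cumulants are the coefficients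
of C and C'. The case Ψ = 0 identifies u e_q/(e_q - 1) with the beta distribution. The limiting
moments grow at most geometrically, which yields a compactly supported measure. -/

/-! ### Formal residues and Lagrange inversion. -/

/-- With w = X M, the coefficient is the residue of w^(-p-1) w', an exact derivative for p ≥ 1. To
stay within power series, (M⁻¹)^p is differentiated instead. -/
theorem PowerSeries.coeff_inv_pow_mul_derivative_X_mul (M : PowerSeries ℂ)
    (hM : PowerSeries.constantCoeff M ≠ 0) (p : ℕ) (hp : 1 ≤ p) :
    PowerSeries.coeff p (M⁻¹ ^ (p + 1) * PowerSeries.derivative ℂ (PowerSeries.X * M)) = 0 := by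
  have hMM : M⁻¹ * M = 1 := PowerSeries.inv_mul_cancel M hM
  obtain ⟨r, rfl⟩ : ∃ r, p = r + 1 := ⟨p - 1, by omega⟩
  have h1 : PowerSeries.derivative ℂ (PowerSeries.X * M) =
      M + PowerSeries.X * PowerSeries.derivative ℂ M := by
    rw [Derivation.leibniz]
    simp only [PowerSeries.derivative_X, smul_eq_mul, mul_one]
    ring
  have h2 : PowerSeries.derivative ℂ (M⁻¹ ^ (r + 1)) =
      -((r + 1 : ℕ) : PowerSeries ℂ) * (M⁻¹ ^ (r + 1 + 1) * PowerSeries.derivative ℂ M) := by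
    rw [PowerSeries.derivative_pow, PowerSeries.derivative_inv']
    simp only [Nat.add_sub_cancel]
    ring
  have h3 : M⁻¹ ^ (r + 1 + 1) * PowerSeries.derivative ℂ (PowerSeries.X * M) =
      M⁻¹ ^ (r + 1) + PowerSeries.X * (M⁻¹ ^ (r + 1 + 1) * PowerSeries.derivative ℂ M) := by
    rw [h1]
    linear_combination M⁻¹ ^ (r + 1) * hMM
  have h4 := congrArg (PowerSeries.coeff r) h2
  rw [PowerSeries.coeff_derivative, neg_mul, map_neg, ← nsmul_eq_mul, map_nsmul, nsmul_eq_mul] at h4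
  rw [h3, map_add, PowerSeries.coeff_succ_X_mul]
  have h5 : ((r : ℂ) + 1) ≠ 0 := by exact_mod_cast Nat.succ_ne_zero r
  push_cast at h4
  apply mul_left_cancel₀ h5
  linear_combination h4

/-- Invariance of the residue under the substitution `z = X * M`, for the monomial `z ^ (i - n - 1)`. -/
theorem PowerSeries.coeff_residue_monomial (M : PowerSeries ℂ)
    (hM : PowerSeries.constantCoeff M ≠ 0) (i n : ℕ) :
    PowerSeries.coeff n ((PowerSeries.X * M) ^ i *
      (M⁻¹ ^ (n + 1) * PowerSeries.derivative ℂ (PowerSeries.X * M))) = if i = n then 1 else 0 := by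
  have hMM : M * M⁻¹ = 1 := PowerSeries.mul_inv_cancel M hM
  rw [mul_pow, mul_assoc, mul_comm (PowerSeries.X ^ i), PowerSeries.coeff_mul_X_pow']
  rcases lt_trichotomy i n with h | rfl | h
  · rw [if_pos h.le, if_neg h.ne]
    obtain ⟨p, rfl⟩ : ∃ p, n = i + p := ⟨n - i, by omega⟩
    have : M ^ i * (M⁻¹ ^ (i + p + 1) * PowerSeries.derivative ℂ (PowerSeries.X * M)) =
        M⁻¹ ^ (p + 1) * PowerSeries.derivative ℂ (PowerSeries.X * M) := by
      rw [show i + p + 1 = i + (p + 1) by ring, pow_add, ← mul_assoc, ← mul_assoc, ← mul_pow, hMM,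
        one_pow, one_mul]
    rw [this, Nat.add_sub_cancel_left]
    exact PowerSeries.coeff_inv_pow_mul_derivative_X_mul M hM p (by omega)
  · rw [if_pos le_rfl, if_pos rfl, Nat.sub_self, pow_succ, ← mul_assoc, ← mul_assoc, ← mul_pow, hMM,
      one_pow, one_mul, PowerSeries.coeff_zero_eq_constantCoeff, map_mul,
      PowerSeries.constantCoeff_inv, Derivation.leibniz]
    simp [hM]
  · rw [if_neg (by omega), if_neg (by omega)]

/-- Lagrange inversion for `M = C (X * M)`. -/
theorem PowerSeries.coeff_of_eq_aeval_X_mul (M : PowerSeries ℂ) (C : Polynomial ℂ)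
    (hM : PowerSeries.constantCoeff M ≠ 0) (h : M = Polynomial.aeval (PowerSeries.X * M) C) (n : ℕ) :
    ((n : ℂ) + 1) * PowerSeries.coeff n M = (C ^ (n + 1)).coeff n := by
  have hMM : M * M⁻¹ = 1 := PowerSeries.mul_inv_cancel M hM
  have h1 : M ^ (n + 1) = ∑ i ∈ Finset.range ((C ^ (n + 1)).natDegree + 1),
      PowerSeries.C ((C ^ (n + 1)).coeff i) * (PowerSeries.X * M) ^ i := by
    conv_lhs => rw [h, ← map_pow, Polynomial.aeval_eq_sum_range]
    simp only [PowerSeries.smul_eq_C_mul]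
  -- The coefficient of (X M)' is (n+1) times that of M; on the right M^(n+1) = C^(n+1)(X M) is
  -- expanded in monomials, and the residue keeps only the one of degree n.
  have h2 : PowerSeries.derivative ℂ (PowerSeries.X * M) =
      M ^ (n + 1) * (M⁻¹ ^ (n + 1) * PowerSeries.derivative ℂ (PowerSeries.X * M)) := by
    rw [← mul_assoc, ← mul_pow, hMM, one_pow, one_mul]
  have h3 := congrArg (PowerSeries.coeff n) h2
  rw [PowerSeries.coeff_derivative, PowerSeries.coeff_succ_X_mul, h1, Finset.sum_mul, map_sum] at h3
  simp only [mul_assoc, PowerSeries.coeff_C_mul, PowerSeries.coeff_residue_monomial M hM] at h3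
  rw [mul_comm, h3]
  simp only [mul_ite, mul_one, mul_zero, Finset.sum_ite_eq', Finset.mem_range]
  split_ifs with hn
  · rfl
  · rw [Polynomial.coeff_eq_zero_of_natDegree_lt (by omega)]

/-! ### Non-crossing partitions of intervals and their generating function. -/

/-- Non-crossing partitions of the interval `[a, b)`, encoded by the map which sends every point
to the minimum of its block. -/
structure IsNCMap (a b : ℕ) (f : ℕ → ℕ) : Prop where
  le : ∀ i, f i ≤ i
  idem : ∀ i, f (f i) = f i
  out : ∀ i, i < a ∨ b ≤ i → f i = i
  ge : ∀ i, a ≤ i → a ≤ f i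
  nc : ∀ w x y z, w < x → x < y → y < z → f w = f y → f x = f z → f w = f x

theorem finite_setOf_isNCMap (a b : ℕ) : {f | IsNCMap a b f}.Finite := by
  let g : {f | IsNCMap a b f} → (Fin b → Fin b) :=
    fun f i => ⟨f.1 i, lt_of_le_of_lt (IsNCMap.le f.2 i) i.2⟩
  refine Set.finite_coe_iff.1 (Finite.of_injective g ?_)
  intro f f' h
  ext i
  by_cases hi : i < b
  · have := congrFun h ⟨i, hi⟩
    simpa [g] using this
  · rw [IsNCMap.out f.2 i (Or.inr (not_lt.1 hi)), IsNCMap.out f'.2 i (Or.inr (not_lt.1 hi))]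

noncomputable def ncMaps (a b : ℕ) : Finset (ℕ → ℕ) := (finite_setOf_isNCMap a b).toFinset

theorem mem_ncMaps {a b : ℕ} {f : ℕ → ℕ} : f ∈ ncMaps a b ↔ IsNCMap a b f := by
  simp [ncMaps]

/-- The size of the block with minimum i, and 0 if i is not a block minimum. -/
def fiberCard (f : ℕ → ℕ) (a b i : ℕ) : ℕ := ((Finset.Ico a b).filter fun x => f x = i).card

/-- With κ 0 = 1 the points that are not block minima contribute trivially, so the product runs over
the blocks. -/
noncomputable def ncSum (κ : ℕ → ℂ) (a b : ℕ) : ℂ :=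
  ∑ f ∈ ncMaps a b, ∏ i ∈ Finset.Ico a b, κ (fiberCard f a b i)

/-- The sum over non-crossing partitions of `[a, t]`, where the block of `t` counts `j` additional
elements. -/
noncomputable def ncSumTop (κ : ℕ → ℂ) (a t j : ℕ) : ℂ :=
  ∑ f ∈ ncMaps a (t + 1), ∏ i ∈ Finset.Ico a (t + 1),
    κ (fiberCard f a (t + 1) i + if i = f t then j else 0)

theorem ncSumTop_zero (κ : ℕ → ℂ) (a t : ℕ) : ncSumTop κ a t 0 = ncSum κ a (t + 1) := by
  simp [ncSumTop, ncSum]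

theorem ncSum_self (κ : ℕ → ℂ) (a : ℕ) : ncSum κ a a = 1 := by
  have : ncMaps a a = {id} := by
    ext f
    rw [mem_ncMaps, Finset.mem_singleton]
    constructor
    · intro h
      ext i
      exact h.out i (lt_or_ge i a)
    · rintro rfl
      exact ⟨fun i => le_rfl, fun i => rfl, fun i _ => rfl, fun i h => h, by
        intro w x y z h1 h2 h3 h4; simp at h4; omega⟩
  simp [ncSum, this]

theorem IsNCMap.of_fixed {a t : ℕ} {f : ℕ → ℕ} (hat : a ≤ t) :
    (IsNCMap a (t + 1) f ∧ f t = t) ↔ IsNCMap a t f := by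
  constructor
  · rintro ⟨h, ht⟩
    refine ⟨h.le, h.idem, fun i hi => ?_, h.ge, h.nc⟩
    rcases eq_or_ne i t with rfl | hne
    · exact ht
    · exact h.out i (by omega)
  · intro h
    exact ⟨⟨h.le, h.idem, fun i hi => h.out i (by omega), h.ge, h.nc⟩, h.out t (Or.inr le_rfl)⟩

/-- Here b is the predecessor of t in its block: f partitions the points up to b, g the points
strictly between b and t, and t joins the block of b. -/
def ncGlue (b t : ℕ) (f g : ℕ → ℕ) : ℕ → ℕ :=
  fun i => if i ≤ b then f i else if i < t then g i else if i = t then f b else i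

theorem IsNCMap.glue_le {b t : ℕ} {f g : ℕ → ℕ} (hbt : b < t) (hf : ∀ i, f i ≤ i)
    (hg : ∀ i, g i ≤ i) (i : ℕ) : ncGlue b t f g i ≤ i := by
  have := hf i; have := hg i; have := hf b
  unfold ncGlue; split_ifs <;> omega

theorem IsNCMap.glue {a b t : ℕ} {f g : ℕ → ℕ} (hab : a ≤ b) (hbt : b < t)
    (hf : IsNCMap a (b + 1) f) (hg : IsNCMap (b + 1) t g) : IsNCMap a (t + 1) (ncGlue b t f g) := by
  obtain ⟨f1, f2, f3, f4, f5⟩ := hf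
  obtain ⟨g1, g2, g3, g4, g5⟩ := hg
  refine ⟨IsNCMap.glue_le hbt f1 g1, fun i => ?_, fun i hi => ?_, fun i hi => ?_, ?_⟩
  · have := f1 i; have := g1 i; have := f1 b; have := f2 b; have := f2 i; have := g2 i
    have := g4 i
    unfold ncGlue; split_ifs <;> omega
  · have := f3 i
    unfold ncGlue; split_ifs <;> omega
  · have := f4 i; have := g4 i; have := f4 b
    unfold ncGlue; split_ifs <;> omega
  · intro w x y z h1 h2 h3
    -- Blocks met by the points strictly between b and t have their minimum above b, those of the
    -- points up to b and of t have it at most b; so a crossing would have to lie within one of the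
    -- two pieces.
    have cl : ∀ i, (i ≤ b ∧ ncGlue b t f g i = f i ∧ f i ≤ b) ∨
        (b < i ∧ i < t ∧ ncGlue b t f g i = g i ∧ b < g i) ∨
        (i = t ∧ ncGlue b t f g i = f b ∧ f b ≤ b) ∨ (t < i ∧ ncGlue b t f g i = i) := by
      intro i
      have := f1 i; have := f1 b; have := g4 i
      unfold ncGlue; split_ifs <;> omega
    have hx := (IsNCMap.glue_le hbt f1 g1) x
    rcases cl y with hy | hy | hy | hy
    · rcases cl w with hw | hw | hw | hw
      · rcases cl x with hx' | hx' | hx' | hx'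
        · rcases cl z with hz | hz | hz | hz
          · have := f5 w x y z h1 h2 h3
            omega
          · omega
          -- For z = t the point t is replaced by b, which lies in the same block; if y = b the
          -- conclusion is immediate.
          · rcases Nat.lt_or_ge y b with e | e
            · have := f5 w x y b h1 h2 e
              omega
            · obtain rfl : y = b := by omega
              omega
          · omega
        all_goals omega
      all_goals omega
    · rcases cl w with hw | hw | hw | hw
      · omega
      · rcases cl x with hx' | hx' | hx' | hx'
        · omega
        · rcases cl z with hz | hz | hz | hz
          · omega
          · have := g5 w x y z h1 h2 h3
            omega
          all_goals omega
        all_goals omega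
      all_goals omega
    · rcases cl z with hz | hz | hz | hz <;> omega
    · rcases cl z with hz | hz | hz | hz <;> omega

theorem exists_ncGlue {a t : ℕ} {h : ℕ → ℕ} (hat : a ≤ t) (hh : IsNCMap a (t + 1) h)
    (ht : h t ≠ t) :
    ∃ b f g, a ≤ b ∧ b < t ∧ IsNCMap a (b + 1) f ∧ IsNCMap (b + 1) t g ∧ ncGlue b t f g = h := by
  obtain ⟨h1, h2, h3, h4, h5⟩ := hh
  have hlt : h t < t := lt_of_le_of_ne (h1 t) ht
  have hne : ((Finset.range t).filter fun x => h x = h t).Nonempty :=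
    ⟨h t, by simp [hlt, h2]⟩
  -- The largest element below t in the block of t.
  obtain ⟨b, hb⟩ : ∃ b, b = ((Finset.range t).filter fun x => h x = h t).max' hne := ⟨_, rfl⟩
  have hb1 : b < t ∧ h b = h t := by
    have := Finset.max'_mem _ hne
    rw [← hb] at this
    simpa using this
  have hb2 : ∀ x, b < x → x < t → h x ≠ h t := by
    intro x hx hxt he
    have := Finset.le_max' ((Finset.range t).filter fun x => h x = h t) x (by simp [he, hxt])
    omega
  have hrb : h t ≤ b := hb1.2 ▸ h1 b
  have hat' : a ≤ h t := h4 t hat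
  -- A block joining a point between b and t to a point at most b would cross the block containing b
  -- and t.
  have key : ∀ i, b < i → i < t → b < h i := by
    intro i hi hit
    by_contra hc
    have e1 := hb2 i hi hit
    have e2 := h1 i
    rcases lt_trichotomy (h i) (h t) with e | e | e
    · have := h5 (h i) (h t) i t e (by omega) hit (h2 i) (h2 t)
      rw [h2, h2] at this
      omega
    · exact e1 e
    · have e3 : h i ≠ b := by
        intro e4
        have := h2 i
        rw [e4, hb1.2] at this
        omega
      have := h5 (h t) (h i) b i e (by omega) hi (by rw [h2, hb1.2]) (h2 i)
      rw [h2, h2] at this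
      omega
  refine ⟨b, fun i => if i ≤ b then h i else i, fun i => if b < i ∧ i < t then h i else i,
    by omega, hb1.1, ?_, ?_, ?_⟩
  · refine ⟨fun i => ?_, fun i => ?_, fun i hi => ?_, fun i hi => ?_, ?_⟩
    · have := h1 i
      split_ifs <;> omega
    · have := h1 i; have := h2 i
      split_ifs <;> omega
    · have := h3 i
      split_ifs <;> omega
    · have := h4 i
      split_ifs <;> omega
    · intro w x y z e1 e2 e3
      have := h5 w x y z e1 e2 e3
      have := h1 w; have := h1 x; have := h1 y
      split_ifs <;> omega
  · refine ⟨fun i => ?_, fun i => ?_, fun i hi => ?_, fun i hi => ?_, ?_⟩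
    · have := h1 i
      split_ifs <;> omega
    · have := h1 i; have := h2 i; have := key i
      split_ifs <;> omega
    · split_ifs <;> omega
    · have := key i
      split_ifs <;> omega
    · intro w x y z e1 e2 e3
      have := h5 w x y z e1 e2 e3
      have := h1 w; have := h1 x; have := h1 y
      have := key y; have := key z
      split_ifs <;> omega
  · ext i
    have := h3 i
    unfold ncGlue
    rcases lt_trichotomy i t with e | rfl | e
    · by_cases e' : i ≤ b <;> simp [e, e']
    · simp [hb1.1, hb1.2]
    · have e1 : ¬ i ≤ b := by omega
      have e2 : ¬ i < t := by omega
      have e3 : i ≠ t := by omega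
      simp [e1, e2, e3]
      omega

/-- The cut b is recovered as the largest point below t with the same value as t: the points between
b and t have values above b. After that f and g are restrictions. -/
theorem ncGlue_injective {a b b' t : ℕ} {f f' g g' : ℕ → ℕ} (hbt : b < t)
    (hbt' : b' < t) (hf : IsNCMap a (b + 1) f) (hg : IsNCMap (b + 1) t g)
    (hf' : IsNCMap a (b' + 1) f') (hg' : IsNCMap (b' + 1) t g')
    (h : ncGlue b t f g = ncGlue b' t f' g') : b = b' ∧ f = f' ∧ g = g' := by
  have hv := congrFun h
  have hbb : b = b' := by
    have e1 := hv b
    have e2 := hv b'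
    have e3 := hv t
    have := hf.le b; have := hf'.le b'
    have := hg.ge b'; have := hg'.ge b
    unfold ncGlue at e1 e2 e3
    simp only [le_refl, if_true, hbt, hbt', not_le.2 hbt, not_le.2 hbt', lt_irrefl, if_false] at e1 e2 e3
    rcases lt_trichotomy b b' with hlt | heq | hlt
    · rw [if_neg (by omega)] at e2
      omega
    · exact heq
    · rw [if_neg (by omega)] at e1
      omega
  subst hbb
  refine ⟨rfl, ?_, ?_⟩ <;> ext i <;> have e := hv i <;> unfold ncGlue at e
  · have := hf.out i; have := hf'.out i
    split_ifs at e <;> omega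
  · have := hg.out i; have := hg'.out i
    split_ifs at e <;> omega

theorem fiberCard_glue_low {a b t : ℕ} {f g : ℕ → ℕ} (hab : a ≤ b) (hbt : b < t)
    (hg : IsNCMap (b + 1) t g) {i : ℕ} (hi : i ≤ b) :
    fiberCard (ncGlue b t f g) a (t + 1) i =
      fiberCard f a (b + 1) i + if i = f b then 1 else 0 := by
  unfold fiberCard
  have h1 : (Finset.Ico a (t + 1)).filter (fun x => ncGlue b t f g x = i) =
      (Finset.Ico a (b + 1)).filter (fun x => f x = i) ∪
        if i = f b then {t} else ∅ := by
    ext x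
    have := hg.ge x
    have e : x ∈ (if i = f b then ({t} : Finset ℕ) else ∅) ↔ x = t ∧ i = f b := by
      split_ifs with h <;> simp [h]
    simp only [Finset.mem_union, Finset.mem_filter, Finset.mem_Ico, e]
    unfold ncGlue
    split_ifs <;> omega
  rw [h1, Finset.card_union_of_disjoint]
  · split_ifs <;> simp
  · split_ifs <;> simp
    omega

theorem fiberCard_glue_mid {a b t : ℕ} {f g : ℕ → ℕ} (hab : a ≤ b)
    (hf : IsNCMap a (b + 1) f) {i : ℕ} (hi : b < i) (hit : i < t) :
    fiberCard (ncGlue b t f g) a (t + 1) i = fiberCard g (b + 1) t i := by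
  unfold fiberCard
  congr 1
  ext x
  have := hf.le x
  have := hf.le b
  simp only [Finset.mem_filter, Finset.mem_Ico]
  unfold ncGlue
  split_ifs <;> omega

theorem fiberCard_glue_top {a b t : ℕ} {f g : ℕ → ℕ} (hbt : b < t)
    (hf : IsNCMap a (b + 1) f) (hg : IsNCMap (b + 1) t g) :
    fiberCard (ncGlue b t f g) a (t + 1) t = 0 := by
  unfold fiberCard
  rw [Finset.card_eq_zero, Finset.filter_eq_empty_iff]
  intro x
  have := hf.le x; have := hf.le b; have := hg.le x
  simp only [Finset.mem_Ico]
  unfold ncGlue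
  split_ifs <;> omega

/-- Either t is alone among the points of its block, or its block has a preceding element b. In the
second case t is removed and counted as one more extra element of the block of b, while the points
between b and t carry an independent non-crossing partition. The now empty fibre over t gives the
factor κ 0. -/
theorem ncSumTop_rec (κ : ℕ → ℂ) (h0 : κ 0 = 1) {a t : ℕ} (hat : a ≤ t) (j : ℕ) :
    ncSumTop κ a t j = κ (1 + j) * ncSum κ a t +
      ∑ b ∈ Finset.Ico a t, ncSumTop κ a b (j + 1) * ncSum κ (b + 1) t := by
  rw [ncSumTop, ← Finset.sum_filter_add_sum_filter_not _ (fun f => f t = t)]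
  congr 1
  · have : (ncMaps a (t + 1)).filter (fun f => f t = t) = ncMaps a t := by
      ext f
      rw [Finset.mem_filter, mem_ncMaps, mem_ncMaps, IsNCMap.of_fixed hat]
    rw [this, ncSum, Finset.mul_sum]
    refine Finset.sum_congr rfl fun f hf => ?_
    have hf := mem_ncMaps.1 hf
    have ht : f t = t := hf.out t (Or.inr le_rfl)
    rw [Finset.prod_Ico_succ_top hat, mul_comm, ht, if_pos rfl]
    congr 1
    · congr 2
      unfold fiberCard
      rw [Finset.card_eq_one]
      refine ⟨t, ?_⟩
      ext x
      have := hf.le x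
      simp only [Finset.mem_filter, Finset.mem_Ico, Finset.mem_singleton]
      constructor
      · omega
      · rintro rfl; omega
    · refine Finset.prod_congr rfl fun i hi => ?_
      rw [Finset.mem_Ico] at hi
      rw [if_neg (by omega), add_zero]
      congr 1
      unfold fiberCard
      congr 1
      ext x
      simp only [Finset.mem_filter, Finset.mem_Ico]
      constructor
      · rintro ⟨h1, h2⟩
        have : x ≠ t := by rintro rfl; omega
        omega
      · omega
  · simp only [ncSumTop, ncSum, Finset.sum_mul_sum]
    have : ∀ b ∈ Finset.Ico a t, (∑ f ∈ ncMaps a (b + 1), ∑ g ∈ ncMaps (b + 1) t,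
        (∏ i ∈ Finset.Ico a (b + 1), κ (fiberCard f a (b + 1) i + if i = f b then j + 1 else 0)) *
          ∏ i ∈ Finset.Ico (b + 1) t, κ (fiberCard g (b + 1) t i)) =
        ∑ p ∈ ncMaps a (b + 1) ×ˢ ncMaps (b + 1) t,
        (∏ i ∈ Finset.Ico a (b + 1),
          κ (fiberCard p.1 a (b + 1) i + if i = p.1 b then j + 1 else 0)) *
          ∏ i ∈ Finset.Ico (b + 1) t, κ (fiberCard p.2 (b + 1) t i) := fun b _ => by
      rw [Finset.sum_product]
    rw [Finset.sum_congr rfl this, Finset.sum_sigma']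
    symm
    refine Finset.sum_bij (fun p _ => ncGlue p.1 t p.2.1 p.2.2) ?_ ?_ ?_ ?_
    · rintro ⟨b, f, g⟩ hp
      simp only [Finset.mem_sigma, Finset.mem_product, mem_ncMaps, Finset.mem_Ico] at hp
      obtain ⟨⟨hab, hbt⟩, hf, hg⟩ := hp
      rw [Finset.mem_filter, mem_ncMaps]
      refine ⟨IsNCMap.glue hab hbt hf hg, ?_⟩
      have := hf.le b
      dsimp only
      unfold ncGlue
      split_ifs <;> omega
    · rintro ⟨b, f, g⟩ hp ⟨b', f', g'⟩ hp' h
      simp only [Finset.mem_sigma, Finset.mem_product, mem_ncMaps, Finset.mem_Ico] at hp hp'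
      obtain ⟨rfl, rfl, rfl⟩ := ncGlue_injective hp.1.2 hp'.1.2 hp.2.1 hp.2.2 hp'.2.1 hp'.2.2 h
      rfl
    · intro h hh
      rw [Finset.mem_filter, mem_ncMaps] at hh
      obtain ⟨b, f, g, h1, h2, h3, h4, h5⟩ := exists_ncGlue hat hh.1 hh.2
      refine ⟨⟨b, f, g⟩, ?_, h5⟩
      simp only [Finset.mem_sigma, Finset.mem_product, mem_ncMaps, Finset.mem_Ico]
      exact ⟨⟨h1, h2⟩, h3, h4⟩
    · rintro ⟨b, f, g⟩ hp
      simp only [Finset.mem_sigma, Finset.mem_product, mem_ncMaps, Finset.mem_Ico] at hp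
      obtain ⟨⟨hab, hbt⟩, hf, hg⟩ := hp
      have hfb := hf.le b
      have ht : ncGlue b t f g t = f b := by
        unfold ncGlue; split_ifs <;> omega
      dsimp only
      rw [Finset.prod_Ico_succ_top hat, ← Finset.prod_Ico_consecutive _ (show a ≤ b + 1 by omega)
        (show b + 1 ≤ t by omega), fiberCard_glue_top hbt hf hg, ht, if_neg (by omega), add_zero, h0,
        mul_one]
      congr 1
      · refine Finset.prod_congr rfl fun i hi => ?_
        rw [Finset.mem_Ico] at hi
        rw [fiberCard_glue_low hab hbt hg (by omega)]
        congr 1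
        split_ifs <;> omega
      · refine Finset.prod_congr rfl fun i hi => ?_
        rw [Finset.mem_Ico] at hi
        rw [fiberCard_glue_mid hab hf (by omega) hi.2, if_neg (by omega), add_zero]

/-- The recursion `ncSumTop_rec` only involves the lengths of the intervals, so translation
invariance follows by induction without transporting partitions. -/
theorem ncSum_shift (κ : ℕ → ℂ) (h0 : κ 0 = 1) (n : ℕ) : ∀ a,
    ncSum κ a (a + n) = ncSum κ 0 n ∧ ∀ j, ncSumTop κ a (a + n) j = ncSumTop κ 0 n j := by
  induction n using Nat.strong_induction_on with
  | _ n ih =>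
    intro a
    have hM : ncSum κ a (a + n) = ncSum κ 0 n := by
      rcases n with _ | n
      · rw [add_zero, ncSum_self, ncSum_self]
      · rw [← add_assoc, ← ncSumTop_zero, ← ncSumTop_zero]
        exact (ih n (Nat.lt_succ_self n) a).2 0
    refine ⟨hM, fun j => ?_⟩
    rw [ncSumTop_rec κ h0 (Nat.le_add_right a n), ncSumTop_rec κ h0 (Nat.zero_le n), hM]
    congr 1
    rw [Finset.sum_Ico_eq_sum_range, Nat.add_sub_cancel_left, Finset.range_eq_Ico]
    refine Finset.sum_congr rfl fun b hb => ?_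
    rw [Finset.mem_Ico] at hb
    rw [(ih b hb.2 a).2]
    have e1 := (ih (n - 1 - b) (by omega) (a + b + 1)).1
    have e2 := (ih (n - 1 - b) (by omega) (b + 1)).1
    rw [show a + b + 1 + (n - 1 - b) = a + n by omega] at e1
    rw [show b + 1 + (n - 1 - b) = n by omega] at e2
    rw [e1, e2]

theorem ncSumTop_rec_antidiagonal (κ : ℕ → ℂ) (h0 : κ 0 = 1) (n j : ℕ) :
    ncSumTop κ 0 (n + 1) j = κ (1 + j) * ncSum κ 0 (n + 1) +
      ∑ p ∈ Finset.HasAntidiagonal.antidiagonal n, ncSumTop κ 0 p.1 (j + 1) * ncSum κ 0 p.2 := by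
  rw [ncSumTop_rec κ h0 (Nat.zero_le _), Finset.Nat.sum_antidiagonal_eq_sum_range_succ_mk,
    ← Finset.range_eq_Ico]
  congr 1
  refine Finset.sum_congr rfl fun b hb => ?_
  rw [Finset.mem_range] at hb
  have e2 := (ncSum_shift κ h0 (n - b) (b + 1)).1
  rw [show b + 1 + (n - b) = n + 1 by omega] at e2
  rw [e2]

/-- For the generating functions M of `ncSum` and S_j of `ncSumTop` the recursion reads M = 1 + X
S_0 and S_j = κ_(j+1) M + X S_(j+1) M. Iterating gives M = C(X M), to which Lagrange inversion
applies. -/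
theorem ncSum_eq_coeff_pow (C : Polynomial ℂ) (h0 : C.coeff 0 = 1) (n : ℕ) :
    ((n : ℂ) + 1) * ncSum C.coeff 0 n = (C ^ (n + 1)).coeff n := by
  set κ := C.coeff with hκ
  let M : PowerSeries ℂ := PowerSeries.mk fun n => ncSum κ 0 n
  let S : ℕ → PowerSeries ℂ := fun j => PowerSeries.mk fun n => ncSumTop κ 0 n j
  have hM : M = 1 + PowerSeries.X * S 0 := by
    ext n
    rcases n with _ | n
    · simp [M, ncSum_self]
    · simp [M, S, PowerSeries.coeff_succ_X_mul, PowerSeries.coeff_one, ncSumTop_zero]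
  have hS : ∀ j, S j = PowerSeries.C (κ (1 + j)) * M + PowerSeries.X * (S (j + 1) * M) := by
    intro j
    ext n
    rcases n with _ | n
    · simp only [S, M, PowerSeries.coeff_mk, map_add, PowerSeries.coeff_C_mul,
        PowerSeries.coeff_zero_X_mul]
      rw [ncSumTop_rec κ h0 le_rfl]
      simp
    · simp only [map_add, PowerSeries.coeff_C_mul, PowerSeries.coeff_succ_X_mul]
      simp only [S, M, PowerSeries.coeff_mk, PowerSeries.coeff_mul]
      rw [ncSumTop_rec_antidiagonal κ h0]
  have hr : ∀ r, M = ∑ s ∈ Finset.range (r + 1), PowerSeries.C (κ s) * (PowerSeries.X * M) ^ s +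
      PowerSeries.X ^ (r + 1) * (M ^ r * S r) := by
    intro r
    induction r with
    | zero => conv_lhs => rw [hM]
              simp [h0]
    | succ r ih =>
      rw [Finset.sum_range_succ, add_assoc]
      conv_lhs => rw [ih, hS r]
      rw [show 1 + r = r + 1 by ring]
      ring
  -- The number of iterations is at least the degree of C, so that all of C appears, and at least m,
  -- so that the remainder does not reach the coefficient of degree m.
  have hMM : M = Polynomial.aeval (PowerSeries.X * M) C := by
    ext m
    rw [Polynomial.aeval_eq_sum_range' (n := max C.natDegree m + 1) (by omega)]
    conv_lhs => rw [hr (max C.natDegree m)]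
    rw [map_add, PowerSeries.coeff_X_pow_mul', if_neg (by omega), add_zero]
    simp only [PowerSeries.smul_eq_C_mul, hκ]
  have := PowerSeries.coeff_of_eq_aeval_X_mul M C (by simp [M, ncSum_self]) hMM n
  simpa [M] using this

/-! ### Non-crossing set partitions as block-minimum maps. -/

def blockMin {n : ℕ} (π : Finpartition (Finset.univ : Finset (Fin n))) (i : Fin n) : Fin n :=
  (π.part i).min' (π.part_nonempty.2 (Finset.mem_univ i))

section blockMin
variable {n : ℕ} (π : Finpartition (Finset.univ : Finset (Fin n)))

theorem blockMin_mem (i : Fin n) : blockMin π i ∈ π.part i := Finset.min'_mem _ _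

theorem part_blockMin (i : Fin n) : π.part (blockMin π i) = π.part i :=
  π.part_eq_of_mem (π.part_mem.2 (Finset.mem_univ i)) (blockMin_mem π i)

theorem blockMin_le (i : Fin n) : blockMin π i ≤ i :=
  Finset.min'_le _ _ (π.mem_part (Finset.mem_univ i))

theorem blockMin_eq_iff (i j : Fin n) : blockMin π i = blockMin π j ↔ π.part i = π.part j := by
  constructor
  · intro h
    rw [← part_blockMin, h, part_blockMin]
  · intro h
    unfold blockMin
    congr 1

theorem blockMin_idem (i : Fin n) : blockMin π (blockMin π i) = blockMin π i := by
  rw [blockMin_eq_iff, part_blockMin]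

end blockMin

def ncMapOf {n : ℕ} (π : Finpartition (Finset.univ : Finset (Fin n))) (i : ℕ) : ℕ :=
  if h : i < n then blockMin π ⟨i, h⟩ else i

theorem ncMapOf_lt {n : ℕ} (π : Finpartition (Finset.univ : Finset (Fin n))) (i : Fin n) :
    ncMapOf π i = blockMin π i := by
  simp [ncMapOf]

theorem isNCMap_ncMapOf {n : ℕ} {π : Finpartition (Finset.univ : Finset (Fin n))}
    (hπ : IsNoncrossing π) : IsNCMap 0 n (ncMapOf π) := by
  have hle : ∀ i, ncMapOf π i ≤ i := by
    intro i
    unfold ncMapOf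
    split_ifs with h
    · exact blockMin_le π ⟨i, h⟩
    · exact le_rfl
  refine ⟨hle, fun i => ?_, fun i hi => ?_, fun i _ => Nat.zero_le _, ?_⟩
  · by_cases h : i < n
    · have := ncMapOf_lt π ⟨i, h⟩
      simp only at this
      rw [this, ncMapOf_lt, blockMin_idem]
    · simp [ncMapOf, h]
  · have : ¬ i < n := by omega
    simp [ncMapOf, this]
  · intro w x y z h1 h2 h3 h4 h5
    by_cases hz : z < n
    · lift w to Fin n using (by omega)
      lift x to Fin n using (by omega)
      lift y to Fin n using (by omega)
      lift z to Fin n using hz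
      simp only [ncMapOf_lt, Fin.val_inj, blockMin_eq_iff] at h4 h5 ⊢
      exact hπ _ (π.part_mem.2 (Finset.mem_univ w)) _ (π.part_mem.2 (Finset.mem_univ x))
        w (π.mem_part (Finset.mem_univ w)) x (π.mem_part (Finset.mem_univ x))
        y (h4 ▸ π.mem_part (Finset.mem_univ y)) z (h5 ▸ π.mem_part (Finset.mem_univ z)) h1 h2 h3
    · have e1 := hle x
      have e2 : ncMapOf π z = z := by simp [ncMapOf, hz]
      omega

/-- Two points lie in one block exactly when their block minima agree, so the map determines the
equivalence relation and hence the blocks. -/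
theorem ncMapOf_injective {n : ℕ} : Function.Injective (ncMapOf (n := n)) := by
  intro π π' h
  have h1 : ∀ i j : Fin n, π.part i = π.part j ↔ π'.part i = π'.part j := by
    intro i j
    rw [← blockMin_eq_iff, ← blockMin_eq_iff, ← Fin.val_inj, ← ncMapOf_lt, ← ncMapOf_lt, h,
      ncMapOf_lt, ncMapOf_lt, Fin.val_inj]
  have h2 : ∀ i, π.part i = π'.part i := by
    intro i
    ext j
    rw [π.mem_part_iff_part_eq_part (Finset.mem_univ _) (Finset.mem_univ _),
      π'.mem_part_iff_part_eq_part (Finset.mem_univ _) (Finset.mem_univ _), h1]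
  have h3 : ∀ (π : Finpartition (Finset.univ : Finset (Fin n))) V,
      V ∈ π.parts ↔ ∃ i, π.part i = V := by
    intro π V
    constructor
    · intro hV
      obtain ⟨i, hi⟩ := π.nonempty_of_mem_parts hV
      exact ⟨i, π.part_eq_of_mem hV hi⟩
    · rintro ⟨i, rfl⟩
      exact π.part_mem.2 (Finset.mem_univ i)
  ext V
  rw [h3, h3]
  simp only [h2]

theorem exists_ncMapOf {n : ℕ} {f : ℕ → ℕ} (hf : IsNCMap 0 n f) :
    ∃ π : Finpartition (Finset.univ : Finset (Fin n)), IsNoncrossing π ∧ ncMapOf π = f := by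
  classical
  let s : Setoid (Fin n) := Setoid.ker fun i : Fin n => f i
  let π := Finpartition.ofSetoid s
  have hpart : ∀ i j : Fin n, j ∈ π.part i ↔ f i = f j := fun i j =>
    Finpartition.mem_part_ofSetoid_iff_rel
  refine ⟨π, ?_, ?_⟩
  · intro V hV W hW a ha b hb c hc d hd h1 h2 h3
    rw [← π.part_eq_of_mem hV ha] at hc ⊢
    rw [← π.part_eq_of_mem hW hb] at hd ⊢
    rw [hpart] at hc hd
    have := hf.nc a b c d h1 h2 h3 hc hd
    exact π.part_eq_of_mem (π.part_mem.2 (Finset.mem_univ _)) ((hpart _ _).2 this.symm)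
  · ext i
    by_cases h : i < n
    · have hfi : f i < n := lt_of_le_of_lt (hf.le i) h
      have h1 : ncMapOf π i = blockMin π ⟨i, h⟩ := ncMapOf_lt π ⟨i, h⟩
      rw [h1]
      have h2 : blockMin π ⟨i, h⟩ ≤ ⟨f i, hfi⟩ :=
        Finset.min'_le _ _ ((hpart _ _).2 (hf.idem i).symm)
      have h3 := (hpart _ _).1 (blockMin_mem π ⟨i, h⟩)
      have h4 := hf.le (blockMin π ⟨i, h⟩)
      have h5 : (blockMin π ⟨i, h⟩ : ℕ) ≤ f i := h2
      simp only at h3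
      omega
    · rw [hf.out i (Or.inr (not_lt.1 h))]
      simp [ncMapOf, h]

/-- Block minima correspond bijectively to blocks, and the fibre over a minimum is its block; the
other fibres are empty and give κ 0 = 1. -/
theorem prod_fiberCard_ncMapOf (κ : ℕ → ℂ) (h0 : κ 0 = 1) {n : ℕ}
    (π : Finpartition (Finset.univ : Finset (Fin n))) :
    ∏ i ∈ Finset.Ico 0 n, κ (fiberCard (ncMapOf π) 0 n i) = ∏ V ∈ π.parts, κ V.card := by
  classical
  have h1 : ∀ i : Fin n, fiberCard (ncMapOf π) 0 n i =
      (Finset.univ.filter fun x : Fin n => blockMin π x = i).card := by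
    intro i
    unfold fiberCard
    symm
    refine Finset.card_bij (fun x _ => (x : ℕ)) ?_ ?_ ?_
    · intro x hx
      simp only [Finset.mem_filter, Finset.mem_univ, true_and] at hx
      simp [ncMapOf_lt, hx]
    · intro x _ y _ h
      exact Fin.ext h
    · intro x hx
      simp only [Finset.mem_filter, Finset.mem_Ico] at hx
      refine ⟨⟨x, hx.1.2⟩, ?_, rfl⟩
      have := ncMapOf_lt π ⟨x, hx.1.2⟩
      simp only at this
      simp [← Fin.val_inj, ← this, hx.2]
  rw [← Finset.range_eq_Ico, Finset.prod_range]
  simp only [h1]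
  rw [← Finset.prod_subset (Finset.subset_univ (Finset.univ.filter fun i => blockMin π i = i))]
  · refine Finset.prod_bij (fun i _ => π.part i) ?_ ?_ ?_ ?_
    · intro i _
      exact π.part_mem.2 (Finset.mem_univ i)
    · intro i hi j hj h
      simp only [Finset.mem_filter, Finset.mem_univ, true_and] at hi hj
      rw [← hi, ← hj, blockMin_eq_iff, h]
    · intro V hV
      obtain ⟨i, hi⟩ := π.nonempty_of_mem_parts hV
      refine ⟨blockMin π i, by simp [blockMin_idem], ?_⟩
      rw [part_blockMin, π.part_eq_of_mem hV hi]
    · intro i hi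
      simp only [Finset.mem_filter, Finset.mem_univ, true_and] at hi
      congr 2
      ext x
      rw [π.mem_part_iff_part_eq_part (Finset.mem_univ _) (Finset.mem_univ _), ← blockMin_eq_iff, hi]
      simp
  · intro i _ hi
    rw [Finset.card_eq_zero.2, h0]
    rw [Finset.filter_eq_empty_iff]
    rintro x _ rfl
    apply hi
    simp [blockMin_idem]

theorem sum_NC_eq_ncSum (κ : ℕ → ℂ) (h0 : κ 0 = 1) (n : ℕ) :
    ∑ π ∈ NC n, ∏ V ∈ π.parts, κ V.card = ncSum κ 0 n := by
  classical
  refine Finset.sum_bij (fun π _ => ncMapOf π) ?_ ?_ ?_ ?_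
  · intro π hπ
    exact mem_ncMaps.2 (isNCMap_ncMapOf (Finset.mem_filter.1 hπ).2)
  · intro π _ π' _ h
    exact ncMapOf_injective h
  · intro f hf
    obtain ⟨π, h1, h2⟩ := exists_ncMapOf (mem_ncMaps.1 hf)
    exact ⟨π, Finset.mem_filter.2 ⟨Finset.mem_univ _, h1⟩, h2⟩
  · intro π _
    exact (prod_fiberCard_ncMapOf κ h0 π).symm

/-! ### Moment-cumulant relations as coefficient formulas. -/

/-- The moment-cumulant relation in terms of generating functions. -/
theorem sum_NC_eq_coeff_pow (C : PowerSeries ℂ) (h0 : PowerSeries.constantCoeff C = 1) (n : ℕ) :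
    ((n : ℂ) + 1) * ∑ π ∈ NC n, ∏ V ∈ π.parts, PowerSeries.coeff V.card C =
      PowerSeries.coeff n (C ^ (n + 1)) := by
  -- Both sides involve only the coefficients of degree at most n, so C may be truncated to a
  -- polynomial.
  have h1 : (PowerSeries.trunc (n + 1) C).coeff 0 = 1 := by
    rw [PowerSeries.coeff_trunc, if_pos (Nat.succ_pos n)]
    simpa using h0
  have h2 := ncSum_eq_coeff_pow (PowerSeries.trunc (n + 1) C) h1 n
  rw [← sum_NC_eq_ncSum _ h1] at h2
  have h3 : PowerSeries.coeff n (C ^ (n + 1)) =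
      PowerSeries.coeff n ((PowerSeries.trunc (n + 1) C : PowerSeries ℂ) ^ (n + 1)) := by
    have := PowerSeries.trunc_trunc_pow C (n + 1) (n + 1)
    have := congrArg (fun p => p.coeff n) this
    simp only [PowerSeries.coeff_trunc, if_pos (Nat.lt_succ_self n)] at this
    exact this.symm
  rw [h3, ← Polynomial.coe_pow, Polynomial.coeff_coe, ← h2]
  congr 1
  refine Finset.sum_congr rfl fun π _ => Finset.prod_congr rfl fun V _ => ?_
  rw [PowerSeries.coeff_trunc, if_pos]
  have := Finset.card_le_univ V
  simp at this
  omega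

/-- The infinitesimal moment-cumulant relation in terms of generating functions. -/
theorem sum_NC_inf_eq_coeff (C C' : PowerSeries ℂ) (h0 : PowerSeries.constantCoeff C = 1)
    (h0' : PowerSeries.constantCoeff C' = 0) (n : ℕ) :
    ∑ π ∈ NC n, ∑ V ∈ π.parts, PowerSeries.coeff V.card C' *
      ∏ W ∈ π.parts.erase V, PowerSeries.coeff W.card C = PowerSeries.coeff n (C ^ n * C') := by
  -- The infinitesimal relation is the derivative at t = 0 of the ordinary one for C + t C'; here
  -- the right-hand side is written as a polynomial in t.
  have h1 : ∀ t : ℂ, ((n : ℂ) + 1) * ∑ π ∈ NC n, ∏ V ∈ π.parts,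
      (PowerSeries.coeff V.card C + t * PowerSeries.coeff V.card C') =
      ∑ m ∈ Finset.range (n + 1 + 1), t ^ m * (((n + 1).choose m : ℂ) *
        PowerSeries.coeff n (C ^ (n + 1 - m) * C' ^ m)) := by
    intro t
    have := sum_NC_eq_coeff_pow (C + PowerSeries.C t * C') (by simp [h0, h0']) n
    simp only [map_add, PowerSeries.coeff_C_mul] at this
    rw [this, add_comm C, add_pow, map_sum]
    refine Finset.sum_congr rfl fun m _ => ?_
    rw [mul_pow, ← map_pow, show PowerSeries.C (t ^ m) * C' ^ m * C ^ (n + 1 - m) *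
      ((n + 1).choose m : PowerSeries ℂ) = PowerSeries.C (t ^ m) * (((n + 1).choose m) •
        (C ^ (n + 1 - m) * C' ^ m)) by rw [nsmul_eq_mul]; ring, PowerSeries.coeff_C_mul, map_nsmul,
        nsmul_eq_mul]
  have h2 : HasDerivAt (fun t : ℂ => ((n : ℂ) + 1) * ∑ π ∈ NC n, ∏ V ∈ π.parts,
      (PowerSeries.coeff V.card C + t * PowerSeries.coeff V.card C'))
      (((n : ℂ) + 1) * ∑ π ∈ NC n, ∑ V ∈ π.parts, (∏ W ∈ π.parts.erase V,
        PowerSeries.coeff W.card C) * PowerSeries.coeff V.card C') 0 := by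
    refine HasDerivAt.const_mul _ (HasDerivAt.fun_sum fun π _ => ?_)
    have := HasDerivAt.fun_finsetProd (u := π.parts) (x := (0 : ℂ))
      (f := fun V (t : ℂ) => PowerSeries.coeff V.card C + t * PowerSeries.coeff V.card C')
      (f' := fun V => PowerSeries.coeff V.card C') (fun V _ => by
        simpa using ((hasDerivAt_id (0 : ℂ)).mul_const (PowerSeries.coeff V.card C')).const_add
          (PowerSeries.coeff V.card C))
    simpa using this
  have h3 : HasDerivAt (fun t : ℂ => ∑ m ∈ Finset.range (n + 1 + 1), t ^ m *
      (((n + 1).choose m : ℂ) * PowerSeries.coeff n (C ^ (n + 1 - m) * C' ^ m)))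
      (∑ m ∈ Finset.range (n + 1 + 1), (m * (0 : ℂ) ^ (m - 1)) *
      (((n + 1).choose m : ℂ) * PowerSeries.coeff n (C ^ (n + 1 - m) * C' ^ m))) 0 :=
    HasDerivAt.fun_sum fun m _ => (hasDerivAt_pow m 0).mul_const _
  rw [show (fun t : ℂ => ((n : ℂ) + 1) * ∑ π ∈ NC n, ∏ V ∈ π.parts,
      (PowerSeries.coeff V.card C + t * PowerSeries.coeff V.card C')) = _ from funext h1] at h2
  -- Only the term linear in t survives at t = 0, and its binomial coefficient n+1 cancels the
  -- factor on the left.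
  rw [Finset.sum_eq_single_of_mem 1 (by simp)] at h3
  · have h4 := h2.unique h3
    have h5 : ((n : ℂ) + 1) ≠ 0 := by exact_mod_cast Nat.succ_ne_zero n
    apply mul_left_cancel₀ h5
    simp only [Nat.cast_one, Nat.sub_self, pow_zero, mul_one, one_mul, Nat.choose_one_right,
      Nat.add_sub_cancel, pow_one, Nat.cast_add] at h4
    rw [← h4]
    simp only [mul_comm]
  · intro m _ hm
    rcases m with _ | m
    · simp
    · have : m ≠ 0 := by omega
      simp [this]

theorem sum_NC_eq_complex {n : ℕ} (hn : 1 ≤ n) (F : Finset (Finset (Fin n)) → ℂ) :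
    ∑ π ∈ NC n, F π.parts = F {Finset.univ} + ∑ π ∈ properNC n, F π.parts := by
  apply Complex.ext
  · rw [Complex.add_re, Complex.re_sum, Complex.re_sum]
    exact sum_NC_eq hn fun P => (F P).re
  · rw [Complex.add_im, Complex.im_sum, Complex.im_sum]
    exact sum_NC_eq hn fun P => (F P).im

/-- The coefficients of C satisfy the moment-cumulant relations, and these are triangular: induction
on n removes the partitions with more than one block. This is how all cumulants below are
identified. -/
theorem freeCumulant_eq_coeff (m : ℕ → ℝ) (C : PowerSeries ℂ)
    (h0 : PowerSeries.constantCoeff C = 1)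
    (h : ∀ k : ℕ, 1 ≤ k → ((k : ℂ) + 1) * (m k : ℂ) = PowerSeries.coeff k (C ^ (k + 1))) :
    ∀ n, 1 ≤ n → (freeCumulant m n : ℂ) = PowerSeries.coeff n C := by
  intro n
  induction n using Nat.strong_induction_on with
  | _ n ih =>
    intro hn
    have h1 := h n hn
    rw [← sum_NC_eq_coeff_pow C h0, sum_NC_eq_complex hn
      (fun P => ∏ V ∈ P, PowerSeries.coeff V.card C)] at h1
    replace h1 := mul_left_cancel₀ (Nat.cast_add_one_ne_zero n) h1
    have h2 := congrArg (fun x : ℝ => (x : ℂ)) (moment_eq_sum_freeCumulant m hn)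
    rw [sum_NC_eq hn (fun P => ∏ V ∈ P, freeCumulant m V.card)] at h2
    push_cast at h2
    rw [Finset.prod_singleton, Finset.card_univ, Fintype.card_fin] at h1 h2
    have h3 : ∑ π ∈ properNC n, ∏ V ∈ π.parts, (freeCumulant m V.card : ℂ) =
        ∑ π ∈ properNC n, ∏ V ∈ π.parts, PowerSeries.coeff V.card C := by
      refine Finset.sum_congr rfl fun π hπ => Finset.prod_congr rfl fun V hV => ?_
      exact ih _ (card_lt_of_mem_properNC hπ hV)
        (Finset.card_pos.2 (π.nonempty_of_mem_parts hV))
    rw [h3] at h2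
    linear_combination h1 - h2

/-- The same triangular induction for the linearized relations, with the free cumulants already
known to be the coefficients of C. -/
theorem infFreeCumulant_eq_coeff (m m' : ℕ → ℝ) (C C' : PowerSeries ℂ)
    (h0 : PowerSeries.constantCoeff C = 1) (h0' : PowerSeries.constantCoeff C' = 0)
    (h : ∀ k : ℕ, 1 ≤ k → ((k : ℂ) + 1) * (m k : ℂ) = PowerSeries.coeff k (C ^ (k + 1)))
    (h' : ∀ k : ℕ, 1 ≤ k → (m' k : ℂ) = PowerSeries.coeff k (C ^ k * C')) :
    ∀ n, 1 ≤ n → (infFreeCumulant m m' n : ℂ) = PowerSeries.coeff n C' := by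
  intro n
  induction n using Nat.strong_induction_on with
  | _ n ih =>
    intro hn
    have h1 := h' n hn
    rw [← sum_NC_inf_eq_coeff C C' h0 h0', sum_NC_eq_complex hn
      (fun P => ∑ V ∈ P, PowerSeries.coeff V.card C' *
        ∏ W ∈ P.erase V, PowerSeries.coeff W.card C)] at h1
    have h2 := congrArg (fun x : ℝ => (x : ℂ)) (infMoment_eq_sum_infFreeCumulant m m' hn)
    rw [sum_NC_eq hn (fun P => ∑ V ∈ P, infFreeCumulant m m' V.card *
      ∏ W ∈ P.erase V, freeCumulant m W.card)] at h2
    push_cast at h2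
    rw [Finset.sum_singleton, Finset.erase_singleton, Finset.prod_empty, mul_one,
      Finset.card_univ, Fintype.card_fin] at h1 h2
    have h3 : ∑ π ∈ properNC n, ∑ V ∈ π.parts, (infFreeCumulant m m' V.card : ℂ) *
          ∏ W ∈ π.parts.erase V, (freeCumulant m W.card : ℂ) =
        ∑ π ∈ properNC n, ∑ V ∈ π.parts, PowerSeries.coeff V.card C' *
          ∏ W ∈ π.parts.erase V, PowerSeries.coeff W.card C := by
      refine Finset.sum_congr rfl fun π hπ => Finset.sum_congr rfl fun V hV => ?_
      rw [ih _ (card_lt_of_mem_properNC hπ hV)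
        (Finset.card_pos.2 (π.nonempty_of_mem_parts hV))]
      congr 1
      refine Finset.prod_congr rfl fun W hW => ?_
      exact freeCumulant_eq_coeff m C h0 h _
        (Finset.card_pos.2 (π.nonempty_of_mem_parts (Finset.mem_of_mem_erase hW)))
    rw [h3] at h2
    linear_combination h1 - h2

/-! ### Point masses and the beta distribution. -/

theorem momentSeq_dirac (c : ℝ) (k : ℕ) : momentSeq (Measure.dirac c) k = c ^ k := by
  simp [momentSeq]

/-- The generating series is 1 + c X, since [X^k] (1 + c X)^(k+1) = (k+1) c^k. -/
theorem freeCumulant_dirac (c : ℝ) (n : ℕ) (hn : 1 ≤ n) :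
    freeCumulant (momentSeq (Measure.dirac c)) n = if n = 1 then c else 0 := by
  have h := freeCumulant_eq_coeff (momentSeq (Measure.dirac c))
    (1 + PowerSeries.C (c : ℂ) * PowerSeries.X) (by simp) (fun k _ => by
      rw [momentSeq_dirac, add_comm (1 : PowerSeries ℂ), add_pow, map_sum,
        Finset.sum_eq_single_of_mem k (by simp)]
      · simp only [one_pow, mul_one, mul_pow, ← map_pow, mul_assoc]
        rw [PowerSeries.coeff_C_mul, mul_comm (PowerSeries.X ^ k), ← nsmul_eq_mul, map_nsmul]
        simp [mul_comm]
      · intro b _ hb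
        simp only [one_pow, mul_one, mul_pow, ← map_pow, mul_assoc]
        rw [PowerSeries.coeff_C_mul, mul_comm (PowerSeries.X ^ b), ← nsmul_eq_mul, map_nsmul]
        simp [PowerSeries.coeff_X_pow, hb.symm]) n hn
  have h2 : PowerSeries.coeff n (1 + PowerSeries.C (c : ℂ) * PowerSeries.X) =
      ((if n = 1 then c else 0 : ℝ) : ℂ) := by
    rw [map_add, PowerSeries.coeff_C_mul, PowerSeries.coeff_X, PowerSeries.coeff_one,
      if_neg (by omega)]
    split_ifs <;> simp
  rw [h2] at h
  exact_mod_cast h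

open ProbabilityTheory in
theorem integral_betaPDFReal {α β : ℝ} (hα : 0 < α) (hβ : 0 < β) :
    ∫ x, betaPDFReal α β x = 1 := by
  have h0 : ∀ x, 0 ≤ betaPDFReal α β x := fun x => by
    by_cases h : 0 < x ∧ x < 1
    · exact (betaPDFReal_pos h.1 h.2 hα hβ).le
    · rw [betaPDFReal, if_neg h]
  rw [integral_eq_lintegral_of_nonneg_ae (Eventually.of_forall h0)
    (measurable_betaPDFReal α β).aestronglyMeasurable]
  have := lintegral_betaPDF_eq_one hα hβ
  unfold betaPDF at this
  rw [this, ENNReal.toReal_one]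

-- Multiplying the density by x^k gives, up to the normalizing constants, the density with α
-- replaced by α + k.
open ProbabilityTheory in
theorem momentSeq_betaMeasure {α β : ℝ} (hα : 0 < α) (hβ : 0 < β) (k : ℕ) :
    momentSeq (betaMeasure α β) k = beta (α + k) β / beta α β := by
  have h0 : ∀ x, 0 ≤ betaPDFReal α β x := fun x => by
    by_cases h : 0 < x ∧ x < 1
    · exact (betaPDFReal_pos h.1 h.2 hα hβ).le
    · rw [betaPDFReal, if_neg h]
  have hk : 0 < α + k := by positivity
  have hb := beta_pos hα hβ
  have hb' := beta_pos hk hβ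
  have h1 : ∀ x, (betaPDF α β x).toReal • x ^ k =
      beta (α + k) β / beta α β * betaPDFReal (α + k) β x := by
    intro x
    rw [betaPDF, ENNReal.toReal_ofReal (h0 x), smul_eq_mul]
    unfold betaPDFReal
    split_ifs with h
    · rw [show α + k - 1 = α - 1 + k by ring, Real.rpow_add h.1, Real.rpow_natCast]
      field_simp
    · simp
  have h2 : Measurable (betaPDF α β) := (measurable_betaPDFReal α β).ennreal_ofReal
  rw [momentSeq, betaMeasure, integral_withDensity_eq_integral_toReal_smul h2
    (Eventually.of_forall fun x => by simp [betaPDF])]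
  simp only [h1]
  rw [integral_const_mul, integral_betaPDFReal hk hβ, mul_one]

/-- As the parameters sum to 2, the k-th moment is a quotient of rising factorials (1-q)_k / (2)_k
with (2)_k = (k+1)!. In this form the formula covers the two point masses as well. -/
theorem momentSeq_betaPP {q : ℝ} (hq : q ∈ Set.Icc (-1 : ℝ) 1) (k : ℕ) :
    ((k + 1).factorial : ℝ) * momentSeq (betaPP q) k = ∏ i ∈ Finset.range k, ((i : ℝ) + 1 - q) := by
  unfold betaPP
  split_ifs with h1 h2
  · subst h1
    rw [momentSeq_dirac]
    rcases k with _ | k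
    · simp
    · rw [Finset.prod_range_succ']
      simp
  · subst h2
    rw [momentSeq_dirac, one_pow, mul_one, Nat.factorial_succ, mul_comm]
    induction k with
    | zero => simp
    | succ k ih =>
      rw [Finset.prod_range_succ, ← ih, Nat.factorial_succ]
      push_cast
      ring
  · have hq1 : 0 < 1 - q := by
      have := lt_of_le_of_ne hq.2 h1
      linarith
    have hq2 : 0 < 1 + q := by
      have := lt_of_le_of_ne hq.1 (Ne.symm h2)
      linarith
    rw [momentSeq_betaMeasure hq1 hq2]
    have hb := (ProbabilityTheory.beta_pos hq1 hq2).ne'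
    induction k with
    | zero => simp [hb]
    | succ k ih =>
      have hk : 0 < 1 - q + k := by positivity
      rw [Finset.prod_range_succ, ← ih, Nat.factorial_succ]
      have e : ProbabilityTheory.beta (1 - q + (k + 1 : ℕ)) (1 + q) =
          ProbabilityTheory.beta (1 - q + k) (1 + q) * ((1 - q + k) / (k + 2)) := by
        unfold ProbabilityTheory.beta
        rw [show 1 - q + ((k + 1 : ℕ) : ℝ) = 1 - q + k + 1 by push_cast; ring,
          Real.Gamma_add_one hk.ne',
          show 1 - q + k + 1 + (1 + q) = (1 - q + k + (1 + q)) + 1 by ring,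
          Real.Gamma_add_one (by positivity : (1 - q + k + (1 + q)) ≠ 0)]
        have : 0 < Real.Gamma (1 - q + k + (1 + q)) := Real.Gamma_pos_of_pos (by positivity)
        have h3 : 1 - q + k + (1 + q) ≠ 0 := by positivity
        have h4 : (k : ℝ) + 2 = 1 - q + k + (1 + q) := by ring
        rw [h4]
        field_simp
      rw [e]
      push_cast
      field_simp
      ring

/-! ### Taylor series -/

/-- The Taylor series at the origin. -/
noncomputable def taylorSeries (f : ℂ → ℂ) : PowerSeries ℂ :=
  PowerSeries.mk fun n => iteratedDeriv n f 0 / (n.factorial : ℂ)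

theorem coeff_taylorSeries (f : ℂ → ℂ) (n : ℕ) :
    PowerSeries.coeff n (taylorSeries f) = iteratedDeriv n f 0 / (n.factorial : ℂ) := by
  simp [taylorSeries]

theorem constantCoeff_taylorSeries (f : ℂ → ℂ) :
    PowerSeries.constantCoeff (taylorSeries f) = f 0 := by
  rw [← PowerSeries.coeff_zero_eq_constantCoeff_apply, coeff_taylorSeries]
  simp

theorem taylorSeries_congr {f g : ℂ → ℂ} (h : f =ᶠ[𝓝 0] g) : taylorSeries f = taylorSeries g := by
  ext n
  rw [coeff_taylorSeries, coeff_taylorSeries, h.iteratedDeriv_eq]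

theorem taylorSeries_mul {f g : ℂ → ℂ} (hf : AnalyticAt ℂ f 0) (hg : AnalyticAt ℂ g 0) :
    taylorSeries (fun z => f z * g z) = taylorSeries f * taylorSeries g := by
  ext m
  have := iteratedDeriv_mul (n := m) (hf.contDiffAt) (hg.contDiffAt)
  rw [coeff_taylorSeries, show (fun z => f z * g z) = f * g from rfl, this]
  simp only [PowerSeries.coeff_mul, coeff_taylorSeries,
    Finset.Nat.sum_antidiagonal_eq_sum_range_succ_mk, Finset.sum_div]
  refine Finset.sum_congr rfl fun i hi ↦ ?_
  rw [Nat.cast_choose _ (by grind)]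
  field_simp [Nat.factorial_ne_zero]

theorem taylorSeries_add {f g : ℂ → ℂ} (hf : AnalyticAt ℂ f 0) (hg : AnalyticAt ℂ g 0) :
    taylorSeries (fun z => f z + g z) = taylorSeries f + taylorSeries g := by
  ext m
  rw [map_add, coeff_taylorSeries, coeff_taylorSeries, coeff_taylorSeries,
    iteratedDeriv_fun_add hf.contDiffAt hg.contDiffAt, add_div]

theorem taylorSeries_const (c : ℂ) : taylorSeries (fun _ => c) = PowerSeries.C c := by
  ext m
  rw [coeff_taylorSeries, PowerSeries.coeff_C, iteratedDeriv_const]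
  split_ifs with h <;> simp [h]

theorem taylorSeries_const_mul (c : ℂ) {f : ℂ → ℂ} (hf : AnalyticAt ℂ f 0) :
    taylorSeries (fun z => c * f z) = PowerSeries.C c * taylorSeries f := by
  rw [taylorSeries_mul analyticAt_const hf, taylorSeries_const]

theorem taylorSeries_id : taylorSeries (fun z => z) = PowerSeries.X := by
  ext m
  rw [coeff_taylorSeries, PowerSeries.coeff_X]
  rcases m with _ | _ | m
  · simp
  · simp
  · rw [iteratedDeriv_succ', iteratedDeriv_succ']
    simp

theorem taylorSeries_pow {f : ℂ → ℂ} (hf : AnalyticAt ℂ f 0) (n : ℕ) :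
    taylorSeries (fun z => f z ^ n) = taylorSeries f ^ n := by
  induction n with
  | zero => simp only [pow_zero]; rw [taylorSeries_const, map_one]
  | succ n ih =>
    simp only [pow_succ]
    rw [taylorSeries_mul (hf.fun_pow n) hf, ih]

theorem taylorSeries_sum {ι : Type*} (s : Finset ι) (f : ι → ℂ → ℂ)
    (hf : ∀ i ∈ s, AnalyticAt ℂ (f i) 0) :
    taylorSeries (fun z => ∑ i ∈ s, f i z) = ∑ i ∈ s, taylorSeries (f i) := by
  classical
  induction s using Finset.induction_on with
  | empty => simp only [Finset.sum_empty]; rw [taylorSeries_const, map_zero]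
  | insert a s ha ih =>
    simp only [Finset.sum_insert ha]
    rw [taylorSeries_add (hf a (Finset.mem_insert_self a s))
      (Finset.analyticAt_fun_sum s fun i hi => hf i (Finset.mem_insert_of_mem hi)),
      ih fun i hi => hf i (Finset.mem_insert_of_mem hi)]

theorem taylorSeries_deriv (f : ℂ → ℂ) :
    taylorSeries (deriv f) = PowerSeries.derivative ℂ (taylorSeries f) := by
  ext m
  rw [PowerSeries.coeff_derivative, coeff_taylorSeries, coeff_taylorSeries, iteratedDeriv_succ',
    Nat.factorial_succ]
  have h1 : ((m : ℂ) + 1) ≠ 0 := Nat.cast_add_one_ne_zero m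
  have h2 : (m.factorial : ℂ) ≠ 0 := by exact_mod_cast m.factorial_ne_zero
  push_cast
  field_simp

/-- Taylor expansion with analytic remainder. -/
theorem AnalyticAt.exists_eq_taylorSeries_add {f : ℂ → ℂ} (hf : AnalyticAt ℂ f 0) (n : ℕ) :
    ∃ g : ℂ → ℂ, AnalyticAt ℂ g 0 ∧ ∀ z, f z =
      ∑ i ∈ Finset.range n, PowerSeries.coeff i (taylorSeries f) * z ^ i + z ^ n * g z := by
  obtain ⟨g, hg, h⟩ := hf.exists_eq_sum_add_pow_mul n
  refine ⟨g, hg, fun z => ?_⟩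
  rw [h z, smul_eq_mul]
  congr 1
  refine Finset.sum_congr rfl fun i _ => ?_
  rw [coeff_taylorSeries, smul_eq_mul]
  ring

theorem coeff_taylorSeries_pow_mul {g : ℂ → ℂ} (hg : AnalyticAt ℂ g 0) {n m : ℕ} (h : m < n) :
    PowerSeries.coeff m (taylorSeries fun z => z ^ n * g z) = 0 := by
  rw [taylorSeries_mul (by fun_prop) hg, taylorSeries_pow (by fun_prop), taylorSeries_id,
    PowerSeries.coeff_X_pow_mul', if_neg (by omega)]

/-- Change of variables in a residue. -/
theorem coeff_taylorSeries_comp {F E : ℂ → ℂ} (hF : AnalyticAt ℂ F 0) (hE : AnalyticAt ℂ E 0)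
    (hE0 : E 0 = 0) (M : PowerSeries ℂ) (hM : PowerSeries.constantCoeff M ≠ 0)
    (hEM : taylorSeries E = PowerSeries.X * M) (k : ℕ) :
    PowerSeries.coeff k (taylorSeries F) =
      PowerSeries.coeff k (taylorSeries (fun u => F (E u) * deriv E u) * M⁻¹ ^ (k + 1)) := by
  -- With F split into a polynomial of degree k and a multiple of z^(k+1), the polynomial part is
  -- handled by the residues of monomials; the remainder becomes divisible by X^(k+1) and does not
  -- contribute.
  obtain ⟨g, hg, h⟩ := hF.exists_eq_taylorSeries_add (k + 1)
  have hgE : AnalyticAt ℂ (fun u => g (E u)) 0 := by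
    have : AnalyticAt ℂ g (E 0) := by rwa [hE0]
    exact this.comp hE
  have h1 : taylorSeries (fun u => F (E u) * deriv E u) =
      (∑ i ∈ Finset.range (k + 1), PowerSeries.C (PowerSeries.coeff i (taylorSeries F)) *
        (PowerSeries.X * M) ^ i + (PowerSeries.X * M) ^ (k + 1) * taylorSeries fun u => g (E u)) *
        PowerSeries.derivative ℂ (PowerSeries.X * M) := by
    have h2 : (fun u => F (E u) * deriv E u) = fun u =>
        (∑ i ∈ Finset.range (k + 1), PowerSeries.coeff i (taylorSeries F) * E u ^ i +
          E u ^ (k + 1) * g (E u)) * deriv E u := by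
      funext u
      rw [h (E u)]
    have h3 : AnalyticAt ℂ (fun u => ∑ i ∈ Finset.range (k + 1),
        PowerSeries.coeff i (taylorSeries F) * E u ^ i) 0 := by fun_prop
    have h4 : AnalyticAt ℂ (fun u => E u ^ (k + 1) * g (E u)) 0 := (hE.fun_pow _).fun_mul hgE
    rw [h2, taylorSeries_mul (h3.fun_add h4) hE.deriv, taylorSeries_deriv, hEM,
      taylorSeries_add h3 h4, taylorSeries_sum _ _ (by fun_prop),
      taylorSeries_mul (hE.fun_pow _) hgE, taylorSeries_pow hE, hEM]
    congr 2
    refine Finset.sum_congr rfl fun i _ => ?_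
    rw [taylorSeries_const_mul _ (by fun_prop), taylorSeries_pow hE, hEM]
  rw [h1, add_mul, add_mul, Finset.sum_mul, Finset.sum_mul, map_add, map_sum]
  have h3 : PowerSeries.coeff k ((PowerSeries.X * M) ^ (k + 1) * (taylorSeries fun u => g (E u)) *
      PowerSeries.derivative ℂ (PowerSeries.X * M) * M⁻¹ ^ (k + 1)) = 0 := by
    rw [mul_pow, mul_assoc, mul_assoc, mul_assoc, PowerSeries.coeff_X_pow_mul', if_neg (by omega)]
  rw [h3, add_zero]
  have h4 : ∀ i, PowerSeries.coeff k (PowerSeries.C (PowerSeries.coeff i (taylorSeries F)) *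
        (PowerSeries.X * M) ^ i * PowerSeries.derivative ℂ (PowerSeries.X * M) * M⁻¹ ^ (k + 1)) =
      PowerSeries.coeff i (taylorSeries F) * if i = k then 1 else 0 := by
    intro i
    rw [← PowerSeries.coeff_residue_monomial M hM i k, ← PowerSeries.coeff_C_mul]
    congr 1
    ring
  simp only [h4]
  simp

/-! ### The binomial series -/

/-- The Taylor series of `(1 + z) ^ s`. -/
noncomputable def binomSeries (s : ℂ) : PowerSeries ℂ := taylorSeries fun z => (1 + z) ^ s

theorem eventually_one_add_mem_slitPlane : ∀ᶠ z : ℂ in 𝓝 0, 1 + z ∈ Complex.slitPlane := by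
  have : Tendsto (fun z : ℂ => 1 + z) (𝓝 0) (𝓝 1) := by
    have : ContinuousAt (fun z : ℂ => 1 + z) 0 := by fun_prop
    simpa using this.tendsto
  exact this.eventually (Complex.isOpen_slitPlane.mem_nhds (by simp))

theorem analyticAt_one_add_cpow (s : ℂ) : AnalyticAt ℂ (fun z : ℂ => (1 + z) ^ s) 0 :=
  AnalyticAt.cpow (by fun_prop) analyticAt_const (by simp)

theorem constantCoeff_binomSeries (s : ℂ) : PowerSeries.constantCoeff (binomSeries s) = 1 := by
  rw [binomSeries, constantCoeff_taylorSeries]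
  simp

theorem binomSeries_add_one (s : ℂ) :
    binomSeries (s + 1) = (1 + PowerSeries.X) * binomSeries s := by
  have h : (fun z : ℂ => (1 + z) ^ (s + 1)) =ᶠ[𝓝 0] fun z => (1 + z) * (1 + z) ^ s := by
    filter_upwards [eventually_one_add_mem_slitPlane] with z hz
    rw [Complex.cpow_add _ _ (Complex.slitPlane_ne_zero hz), Complex.cpow_one, mul_comm]
  rw [binomSeries, taylorSeries_congr h, taylorSeries_mul (by fun_prop) (analyticAt_one_add_cpow s),
    taylorSeries_add (by fun_prop) (by fun_prop), taylorSeries_const, taylorSeries_id, map_one]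
  rfl

theorem derivative_binomSeries (s : ℂ) :
    PowerSeries.derivative ℂ (binomSeries (s + 1)) = PowerSeries.C (s + 1) * binomSeries s := by
  have h : deriv (fun z : ℂ => (1 + z) ^ (s + 1)) =ᶠ[𝓝 0] fun z => (s + 1) * (1 + z) ^ s := by
    filter_upwards [eventually_one_add_mem_slitPlane] with z hz
    have := (((hasDerivAt_id z).const_add 1).cpow_const (c := s + 1) hz).deriv
    simpa using this
  rw [binomSeries, ← taylorSeries_deriv, taylorSeries_congr h,
    taylorSeries_const_mul _ (analyticAt_one_add_cpow s)]
  rfl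

/-- The differential equation (1+z) f' = s f gives the recursion (n+1) c_(n+1) = (s-n) c_n. -/
theorem coeff_binomSeries (s : ℂ) (n : ℕ) : PowerSeries.coeff n (binomSeries s) =
    (∏ i ∈ Finset.range n, (s - i)) / (n.factorial : ℂ) := by
  induction n with
  | zero => simp [constantCoeff_binomSeries]
  | succ n ih =>
    have h1 := derivative_binomSeries (s - 1)
    have h2 := binomSeries_add_one (s - 1)
    rw [sub_add_cancel] at h1 h2
    have h3 : (1 + PowerSeries.X) * PowerSeries.derivative ℂ (binomSeries s) =
        PowerSeries.C s * binomSeries s := by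
      rw [h1, h2]; ring
    have h4 := congrArg (PowerSeries.coeff n) h3
    rw [add_mul, one_mul, map_add, PowerSeries.coeff_C_mul, PowerSeries.coeff_derivative] at h4
    have h5 : PowerSeries.coeff n (PowerSeries.X * PowerSeries.derivative ℂ (binomSeries s)) =
        n * PowerSeries.coeff n (binomSeries s) := by
      rcases n with _ | n
      · simp
      · rw [PowerSeries.coeff_succ_X_mul, PowerSeries.coeff_derivative]
        push_cast; ring
    rw [h5, ih] at h4
    have h6 : ((n : ℂ) + 1) ≠ 0 := Nat.cast_add_one_ne_zero n
    have h7 : (n.factorial : ℂ) ≠ 0 := by exact_mod_cast n.factorial_ne_zero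
    rw [Finset.prod_range_succ, Nat.factorial_succ]
    push_cast
    apply mul_right_cancel₀ h6
    rw [eq_sub_of_add_eq h4]
    field_simp

/-! ### The deformed exponential -/

theorem eventually_one_sub_mul_mem_slitPlane (q : ℝ) :
    ∀ᶠ u : ℂ in 𝓝 0, 1 - (q : ℂ) * u ∈ Complex.slitPlane := by
  have : Tendsto (fun z : ℂ => 1 - (q : ℂ) * z) (𝓝 0) (𝓝 1) := by
    have : ContinuousAt (fun z : ℂ => 1 - (q : ℂ) * z) 0 := by fun_prop
    simpa using this.tendsto
  exact this.eventually (Complex.isOpen_slitPlane.mem_nhds (by simp))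

theorem expQ_zero (q : ℝ) : expQ q 0 = 1 := by
  unfold expQ; split_ifs <;> simp

theorem analyticAt_expQ (q : ℝ) : AnalyticAt ℂ (expQ q) 0 := by
  unfold expQ
  split_ifs with h
  · fun_prop
  · exact AnalyticAt.cpow (by fun_prop) analyticAt_const (by simp)

theorem eventually_deriv_expQ (q : ℝ) :
    ∀ᶠ u in 𝓝 0, deriv (expQ q) u * (1 - q * u) = expQ q u := by
  by_cases h : q = 0
  · subst h
    have : expQ 0 = Complex.exp := by funext u; simp [expQ]
    simp [this]
  · have hq : (q : ℂ) ≠ 0 := by exact_mod_cast h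
    have : expQ q = fun u => (1 - (q : ℂ) * u) ^ (-1 / (q : ℂ)) := by funext u; simp [expQ, h]
    rw [this]
    filter_upwards [eventually_one_sub_mul_mem_slitPlane q] with u hu
    have h0 := Complex.slitPlane_ne_zero hu
    have h1 : HasDerivAt (fun u : ℂ => 1 - (q : ℂ) * u) (-(q : ℂ)) u := by
      simpa using ((hasDerivAt_id u).const_mul (q : ℂ)).const_sub 1
    have h2 := (h1.cpow_const (c := -1 / (q : ℂ)) hu).deriv
    rw [h2, Complex.cpow_sub _ _ h0, Complex.cpow_one]
    field_simp

/-- The relation e_q(u)^(-q) = 1 - q u. Together with e_q' (1 - q u) = e_q it gives (1+z)^(p-q) dz =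
e_q^(p+1) du for 1+z = e_q(u), which is why the deformed exponential appears. -/
theorem eventually_expQ_cpow (q : ℝ) (p : ℕ) :
    ∀ᶠ u in 𝓝 0, expQ q u ^ ((p : ℂ) - q) = expQ q u ^ p * (1 - q * u) := by
  by_cases h : q = 0
  · subst h
    simp
  · have hq : (q : ℂ) ≠ 0 := by exact_mod_cast h
    have h3 : ∀ u, expQ q u = (1 - (q : ℂ) * u) ^ (-1 / (q : ℂ)) := by intro u; simp [expQ, h]
    have hc : Tendsto (fun u : ℂ => (Complex.log (1 - (q : ℂ) * u) * (-1 / (q : ℂ))).im) (𝓝 0)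
        (𝓝 0) := by
      have : ContinuousAt (fun u : ℂ => (Complex.log (1 - (q : ℂ) * u) * (-1 / (q : ℂ))).im) 0 :=
        Complex.continuous_im.continuousAt.comp
          (ContinuousAt.mul (ContinuousAt.clog (by fun_prop) (by simp)) continuousAt_const)
      simpa using this.tendsto
    -- Near 0 the exponent has imaginary part in (-π, π), so the principal logarithm inverts the
    -- exponential.
    have hc' := hc.eventually (Ioo_mem_nhds (neg_lt_zero.2 Real.pi_pos) Real.pi_pos)
    filter_upwards [eventually_one_sub_mul_mem_slitPlane q, hc'] with u hu hu'
    have h0 := Complex.slitPlane_ne_zero hu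
    rw [h3, Complex.cpow_def_of_ne_zero h0,
      Complex.cpow_sub _ _ (Complex.exp_ne_zero _), Complex.cpow_natCast,
      Complex.cpow_def_of_ne_zero (Complex.exp_ne_zero _), Complex.log_exp hu'.1 hu'.2.le,
      show Complex.log (1 - ↑q * u) * (-1 / ↑q) * ↑q = -Complex.log (1 - ↑q * u) by field_simp,
      Complex.exp_neg, Complex.exp_log h0, div_inv_eq_mul]

/-! ### The substitution `1 + z = e_q(u)` -/

theorem exists_taylorSeries_expQ_sub_one (q : ℝ) : ∃ M : PowerSeries ℂ,
    PowerSeries.constantCoeff M = 1 ∧ taylorSeries (fun u => expQ q u - 1) = PowerSeries.X * M := by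
  have h : PowerSeries.constantCoeff (taylorSeries (fun u => expQ q u - 1)) = 0 := by
    rw [constantCoeff_taylorSeries, expQ_zero, sub_self]
  obtain ⟨M, hM⟩ := PowerSeries.X_dvd_iff.2 h
  refine ⟨M, ?_, hM⟩
  have h1 := congrArg (PowerSeries.coeff 1) hM
  have h2 := (eventually_deriv_expQ q).self_of_nhds
  rw [expQ_zero, mul_zero, sub_zero, mul_one] at h2
  rw [PowerSeries.coeff_succ_X_mul, coeff_taylorSeries, iteratedDeriv_one, deriv_sub_const_fun,
    h2] at h1
  simpa using h1.symm

/-- The reciprocal of `(e_q(u) - 1) / u` times `e_q(u)`. -/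
noncomputable def betaSeries (q : ℝ) : PowerSeries ℂ :=
  (exists_taylorSeries_expQ_sub_one q).choose⁻¹ * taylorSeries (expQ q)

theorem constantCoeff_betaSeries (q : ℝ) : PowerSeries.constantCoeff (betaSeries q) = 1 := by
  rw [betaSeries, map_mul, PowerSeries.constantCoeff_inv,
    (exists_taylorSeries_expQ_sub_one q).choose_spec.1, constantCoeff_taylorSeries, expQ_zero]
  simp

/-- Substitution 1+z = e_q(u) in the residue defining the coefficient: (1+z)^(j-q) dz becomes
e_q^(j+1) du, and u e_q (1 + zψ)/z equals u e_q/(e_q - 1) + u e_q ψ(e_q). Applied with γ = 1 for the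
moments and with the correction factor as γ for the 1/N terms. -/
theorem coeff_binomSeries_mul_pow (q : ℝ) {ψ γ : ℂ → ℂ} (hψ : AnalyticAt ℂ ψ 1)
    (hγ : AnalyticAt ℂ γ 1) (j : ℕ) :
    PowerSeries.coeff j (binomSeries (j - q) *
      (1 + PowerSeries.X * taylorSeries fun z => ψ (1 + z)) ^ (j + 1) *
        taylorSeries fun z => γ (1 + z)) =
    PowerSeries.coeff j ((betaSeries q +
      PowerSeries.X * taylorSeries fun u => expQ q u * ψ (expQ q u)) ^ (j + 1) *
        taylorSeries fun u => γ (expQ q u)) := by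
  obtain ⟨hM1, hM2⟩ := (exists_taylorSeries_expQ_sub_one q).choose_spec
  set M := (exists_taylorSeries_expQ_sub_one q).choose with hM
  have he := analyticAt_expQ q
  have he1 : ∀ g : ℂ → ℂ, AnalyticAt ℂ g 1 → AnalyticAt ℂ (fun z => g (1 + z)) 0 := fun g hg => by
    have : AnalyticAt ℂ g (1 + 0) := by simpa using hg
    exact this.comp (f := fun z : ℂ => 1 + z) (by fun_prop)
  have he2 : ∀ g : ℂ → ℂ, AnalyticAt ℂ g 1 → AnalyticAt ℂ (fun u => g (expQ q u)) 0 :=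
    fun g hg => by
      have : AnalyticAt ℂ g (expQ q 0) := by rwa [expQ_zero]
      exact this.comp he
  have hψ1 := he1 ψ hψ
  have hγ1 := he1 γ hγ
  have hψ2 := he2 ψ hψ
  have hγ2 := he2 γ hγ
  have hb := analyticAt_one_add_cpow ((j : ℂ) - q)
  have hM0 : PowerSeries.constantCoeff M ≠ 0 := by rw [hM1]; exact one_ne_zero
  have hMM : M * M⁻¹ = 1 := PowerSeries.mul_inv_cancel M hM0
  have hid : AnalyticAt ℂ (fun z : ℂ => z) 0 := analyticAt_id
  have hP : AnalyticAt ℂ (fun z => (1 + z * ψ (1 + z)) ^ (j + 1)) 0 :=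
    (analyticAt_const.fun_add (hid.fun_mul hψ1)).fun_pow _
  have hF : AnalyticAt ℂ (fun z => (1 + z) ^ ((j : ℂ) - q) * (1 + z * ψ (1 + z)) ^ (j + 1) *
      γ (1 + z)) 0 := (hb.fun_mul hP).fun_mul hγ1
  have h1 : taylorSeries (fun z => (1 + z) ^ ((j : ℂ) - q) * (1 + z * ψ (1 + z)) ^ (j + 1) *
      γ (1 + z)) = binomSeries (j - q) *
      (1 + PowerSeries.X * taylorSeries fun z => ψ (1 + z)) ^ (j + 1) *
        taylorSeries fun z => γ (1 + z) := by
    rw [taylorSeries_mul (hb.fun_mul hP) hγ1, taylorSeries_mul hb hP,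
      taylorSeries_pow (analyticAt_const.fun_add (hid.fun_mul hψ1)),
      taylorSeries_add analyticAt_const (hid.fun_mul hψ1),
      taylorSeries_mul hid hψ1, taylorSeries_const, taylorSeries_id, map_one, binomSeries]
  have hE : AnalyticAt ℂ (fun u => expQ q u - 1) 0 := he.fun_sub analyticAt_const
  rw [← h1, coeff_taylorSeries_comp hF hE (by rw [expQ_zero, sub_self]) M hM0 hM2]
  congr 1
  have hR : AnalyticAt ℂ (fun u => expQ q u * ψ (expQ q u)) 0 := he.fun_mul hψ2
  have hER : AnalyticAt ℂ (fun u => (expQ q u - 1) * (expQ q u * ψ (expQ q u))) 0 := hE.fun_mul hR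
  have h2 : (fun u => ((1 + (expQ q u - 1)) ^ ((j : ℂ) - q) *
      (1 + (expQ q u - 1) * ψ (1 + (expQ q u - 1))) ^ (j + 1) * γ (1 + (expQ q u - 1))) *
        deriv (fun u => expQ q u - 1) u) =ᶠ[𝓝 0]
      fun u => (expQ q u + (expQ q u - 1) * (expQ q u * ψ (expQ q u))) ^ (j + 1) *
        γ (expQ q u) := by
    filter_upwards [eventually_expQ_cpow q j, eventually_deriv_expQ q] with u hu hu'
    rw [deriv_sub_const_fun, add_sub_cancel, hu,
      show expQ q u + (expQ q u - 1) * (expQ q u * ψ (expQ q u)) =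
        expQ q u * (1 + (expQ q u - 1) * ψ (expQ q u)) by ring, mul_pow]
    linear_combination expQ q u ^ j * (1 + (expQ q u - 1) * ψ (expQ q u)) ^ (j + 1) *
      γ (expQ q u) * hu'
  rw [taylorSeries_congr h2, taylorSeries_mul ((he.fun_add hER).fun_pow _) hγ2,
    taylorSeries_pow (he.fun_add hER), taylorSeries_add he hER, taylorSeries_mul hE hR, hM2,
    betaSeries, ← hM, mul_right_comm, ← mul_pow]
  congr 2
  linear_combination PowerSeries.X * (taylorSeries fun u => expQ q u * ψ (expQ q u)) * hMM

/-- The case ψ = 0, γ = 1 of the substitution: [z^k] (1+z)^(k-q) is the product (1-q)(2-q)…(k-q)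
over k!, that is, k+1 times the k-th beta moment. -/
theorem freeCumulant_betaPP {q : ℝ} (hq : q ∈ Set.Icc (-1 : ℝ) 1) (n : ℕ) (hn : 1 ≤ n) :
    (freeCumulant (momentSeq (betaPP q)) n : ℂ) = PowerSeries.coeff n (betaSeries q) := by
  refine freeCumulant_eq_coeff _ _ (constantCoeff_betaSeries q) (fun k _ => ?_) n hn
  have h1 := coeff_binomSeries_mul_pow q (ψ := fun _ => 0) (γ := fun _ => 1) analyticAt_const
    analyticAt_const k
  simp only [mul_zero, taylorSeries_const, map_zero, map_one, add_zero, one_pow, mul_one] at h1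
  rw [← h1, coeff_binomSeries]
  have h2 := congrArg (fun x : ℝ => (x : ℂ)) (momentSeq_betaPP hq k)
  have h3 : (k.factorial : ℂ) ≠ 0 := by exact_mod_cast k.factorial_ne_zero
  rw [eq_div_iff h3, ← Finset.prod_range_reflect]
  rw [Nat.factorial_succ] at h2
  push_cast at h2
  rw [show ((k : ℂ) + 1) * (momentSeq (betaPP q) k : ℂ) * (k.factorial : ℂ) =
    ((k : ℂ) + 1) * (k.factorial : ℂ) * (momentSeq (betaPP q) k : ℂ) by ring, h2]
  refine Finset.prod_congr rfl fun i hi => ?_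
  rw [Finset.mem_range] at hi
  rw [Nat.cast_sub (by omega), Nat.cast_sub (by omega)]
  push_cast
  ring

/-! ### First order expansions in `1 / N` -/

/-- `x N = a + b / N + o(1 / N)`. -/
def HasExpansion (x : ℕ → ℂ) (a b : ℂ) : Prop :=
  Tendsto (fun N : ℕ => (N : ℂ) * (x N - a)) atTop (𝓝 b)

theorem tendsto_inv_natCast_complex : Tendsto (fun N : ℕ => ((N : ℂ))⁻¹) atTop (𝓝 0) :=
  tendsto_inv_atTop_nhds_zero_nat (𝕜 := ℂ)

namespace HasExpansion

variable {x y : ℕ → ℂ} {a b c d : ℂ}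

theorem tendsto (h : HasExpansion x a b) : Tendsto x atTop (𝓝 a) := by
  have h1 := (tendsto_inv_natCast_complex.mul h).add_const a
  rw [zero_mul, zero_add] at h1
  refine h1.congr' ?_
  filter_upwards [eventually_ne_atTop 0] with N hN
  have : (N : ℂ) ≠ 0 := by exact_mod_cast hN
  field_simp
  ring

theorem congr' (h : HasExpansion x a b) (hxy : x =ᶠ[atTop] y) : HasExpansion y a b := by
  refine Tendsto.congr' ?_ h
  filter_upwards [hxy] with N hN
  rw [hN]

theorem const (a : ℂ) : HasExpansion (fun _ => a) a 0 := by
  simp [HasExpansion]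

theorem add (hx : HasExpansion x a b) (hy : HasExpansion y c d) :
    HasExpansion (fun N => x N + y N) (a + c) (b + d) := by
  refine (Tendsto.add hx hy).congr fun N => ?_
  ring

theorem mul (hx : HasExpansion x a b) (hy : HasExpansion y c d) :
    HasExpansion (fun N => x N * y N) (a * c) (a * d + b * c) := by
  have := (Tendsto.mul (tendsto_const_nhds (x := a)) hy).add (Tendsto.mul hx hy.tendsto)
  refine this.congr fun N => ?_
  ring

theorem const_mul (c : ℂ) (hx : HasExpansion x a b) :
    HasExpansion (fun N => c * x N) (c * a) (c * b) := by
  simpa using (HasExpansion.const c).mul hx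

theorem sum {ι : Type*} (s : Finset ι) {x : ι → ℕ → ℂ} {a b : ι → ℂ}
    (h : ∀ i ∈ s, HasExpansion (x i) (a i) (b i)) :
    HasExpansion (fun N => ∑ i ∈ s, x i N) (∑ i ∈ s, a i) (∑ i ∈ s, b i) := by
  have := tendsto_finsetSum s h
  refine this.congr fun N => ?_
  rw [← Finset.mul_sum, Finset.sum_sub_distrib]

theorem inv_natCast : HasExpansion (fun N => ((N : ℂ))⁻¹) 0 1 := by
  refine (tendsto_const_nhds (x := (1 : ℂ))).congr' ?_
  filter_upwards [eventually_ne_atTop 0] with N hN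
  have : (N : ℂ) ≠ 0 := by exact_mod_cast hN
  field_simp
  ring

theorem inv_natCast_pow (n : ℕ) : HasExpansion (fun N => ((N : ℂ))⁻¹ ^ (n + 2)) 0 0 := by
  induction n with
  | zero => simpa [pow_succ] using inv_natCast.mul inv_natCast
  | succ n ih => simpa [pow_succ] using ih.mul inv_natCast

/-- Induction through (m+1)(N choose m+1) = (N-m)(N choose m); the corrections -0, -1, …, -(m-1) add
up to -(m choose 2). -/
theorem choose_div (m : ℕ) : HasExpansion (fun N => (N.choose m : ℂ) / (N : ℂ) ^ m)
    (1 / (m.factorial : ℂ)) (-(m.choose 2 : ℂ) / (m.factorial : ℂ)) := by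
  induction m with
  | zero => simpa using HasExpansion.const 1
  | succ m ih =>
    have h1 := (ih.mul ((HasExpansion.const 1).add (inv_natCast.const_mul (-(m : ℂ))))).const_mul
      (((m : ℂ) + 1)⁻¹)
    have hm : ((m : ℂ) + 1) ≠ 0 := Nat.cast_add_one_ne_zero m
    have hm' : (m.factorial : ℂ) ≠ 0 := by exact_mod_cast m.factorial_ne_zero
    have e1 : 1 / ((m + 1).factorial : ℂ) =
        ((m : ℂ) + 1)⁻¹ * (1 / (m.factorial : ℂ) * (1 + -(m : ℂ) * 0)) := by
      rw [Nat.factorial_succ]; push_cast; field_simp; ring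
    have e2 : -((m + 1).choose 2 : ℂ) / ((m + 1).factorial : ℂ) =
        ((m : ℂ) + 1)⁻¹ * (1 / (m.factorial : ℂ) * (0 + -(m : ℂ) * 1) +
          -(m.choose 2 : ℂ) / (m.factorial : ℂ) * (1 + -(m : ℂ) * 0)) := by
      rw [Nat.factorial_succ, Nat.choose_succ_succ' m 1, Nat.choose_one_right]
      push_cast; field_simp; ring
    rw [e1, e2]
    refine h1.congr' ?_
    filter_upwards [eventually_ne_atTop 0] with N hN
    have hN' : (N : ℂ) ≠ 0 := by exact_mod_cast hN
    have h2 : (N.choose (m + 1) : ℂ) * ((m : ℂ) + 1) = N.choose m * ((N : ℂ) - m) := by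
      have h3 := Nat.choose_succ_right_eq N m
      rcases le_or_gt m N with h | h
      · rw [← Nat.cast_sub h]
        exact_mod_cast h3
      · rw [Nat.choose_eq_zero_of_lt h, Nat.choose_eq_zero_of_lt (by omega)]
        simp
    field_simp
    linear_combination (-(N : ℂ) * (N : ℂ) ^ m) * h2

end HasExpansion

/-- Coefficientwise expansions of power series, up to degree `k`. -/
def HasSeriesExpansion (k : ℕ) (x : ℕ → PowerSeries ℂ) (a b : PowerSeries ℂ) : Prop :=
  ∀ m ≤ k, HasExpansion (fun N => PowerSeries.coeff m (x N)) (PowerSeries.coeff m a)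
    (PowerSeries.coeff m b)

namespace HasSeriesExpansion

variable {k : ℕ} {x y : ℕ → PowerSeries ℂ} {a b c d : PowerSeries ℂ}

theorem mul (hx : HasSeriesExpansion k x a b) (hy : HasSeriesExpansion k y c d) :
    HasSeriesExpansion k (fun N => x N * y N) (a * c) (a * d + b * c) := by
  intro m hm
  simp only [PowerSeries.coeff_mul, map_add, ← Finset.sum_add_distrib]
  refine HasExpansion.sum _ fun p hp => ?_
  have := Finset.HasAntidiagonal.mem_antidiagonal.1 hp
  exact (hx p.1 (by omega)).mul (hy p.2 (by omega))

theorem const (a : PowerSeries ℂ) : HasSeriesExpansion k (fun _ => a) a 0 := by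
  intro m _
  simpa using HasExpansion.const _

theorem smul {s : ℕ → ℂ} {σ τ : ℂ} (hs : HasExpansion s σ τ) (hx : HasSeriesExpansion k x a b) :
    HasSeriesExpansion k (fun N => PowerSeries.C (s N) * x N) (PowerSeries.C σ * a)
      (PowerSeries.C σ * b + PowerSeries.C τ * a) := by
  intro m hm
  simp only [PowerSeries.coeff_C_mul, map_add]
  exact hs.mul (hx m hm)

theorem sum {ι : Type*} (s : Finset ι) {x : ι → ℕ → PowerSeries ℂ} {a b : ι → PowerSeries ℂ}
    (h : ∀ i ∈ s, HasSeriesExpansion k (x i) (a i) (b i)) :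
    HasSeriesExpansion k (fun N => ∑ i ∈ s, x i N) (∑ i ∈ s, a i) (∑ i ∈ s, b i) := by
  intro m hm
  simp only [map_sum]
  exact HasExpansion.sum s fun i hi => h i hi m hm

theorem congr' (h : HasSeriesExpansion k x a b) (hxy : x =ᶠ[atTop] y) :
    HasSeriesExpansion k y a b := fun m hm => (h m hm).congr' <| by
  filter_upwards [hxy] with N hN
  rw [hN]

end HasSeriesExpansion

/-- The expansion of the derivatives of an exponential. -/
theorem hasSeriesExpansion_exp {k : ℕ} {G D : ℕ → ℕ → PowerSeries ℂ} {a b : ℕ → PowerSeries ℂ}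
    (hG0 : ∀ᶠ N in atTop, ∀ m ≤ k, PowerSeries.coeff m (G N 0) = PowerSeries.coeff m 1)
    (hG : ∀ᶠ N in atTop, ∀ n, G N (n + 1) =
      ∑ i ∈ Finset.range (n + 1), (n.choose i : PowerSeries ℂ) * (D N (i + 1) * G N (n - i)))
    (hD : ∀ i, 1 ≤ i →
      HasSeriesExpansion k (fun N => PowerSeries.C ((N : ℂ)⁻¹) * D N i) (a i) (b i)) (n : ℕ) :
    HasSeriesExpansion k (fun N => PowerSeries.C ((N : ℂ)⁻¹ ^ n) * G N n) (a 1 ^ n)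
      ((n : PowerSeries ℂ) * a 1 ^ (n - 1) * b 1 +
        (n.choose 2 : PowerSeries ℂ) * a 1 ^ (n - 2) * a 2) := by
  induction n using Nat.strong_induction_on with
  | _ n ih =>
    rcases n with _ | n
    · intro m hm
      have := HasExpansion.const (PowerSeries.coeff m (1 : PowerSeries ℂ))
      simp only [pow_zero, map_one, one_mul, Nat.cast_zero, zero_mul, Nat.choose_zero_succ, add_zero,
        map_zero]
      refine this.congr' ?_
      filter_upwards [hG0] with N hN
      exact (hN m hm).symm
    -- N^(-(n+1)) is split as N^(-i) · N^(-1) · N^(-(n-i)). The surplus N^(-i) makes i = 0 the main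
    -- term, lets i = 1 enter only at order 1/N, with the second derivative a 2, and makes i ≥ 2
    -- negligible.
    · have key : ∀ i ∈ Finset.range (n + 1), HasSeriesExpansion k (fun N =>
          PowerSeries.C ((N : ℂ)⁻¹ ^ i) * ((n.choose i : PowerSeries ℂ) *
            ((PowerSeries.C ((N : ℂ)⁻¹) * D N (i + 1)) *
              (PowerSeries.C ((N : ℂ)⁻¹ ^ (n - i)) * G N (n - i)))))
          (if i = 0 then a 1 ^ (n + 1) else 0)
          (if i = 0 then a 1 * ((n : PowerSeries ℂ) * a 1 ^ (n - 1) * b 1 +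
            (n.choose 2 : PowerSeries ℂ) * a 1 ^ (n - 2) * a 2) + b 1 * a 1 ^ n else
            if i = 1 then (n : PowerSeries ℂ) * (a 2 * a 1 ^ (n - 1)) else 0) := by
        intro i hi
        have h1 := (HasSeriesExpansion.const (k := k) (n.choose i : PowerSeries ℂ)).mul
          ((hD (i + 1) (by omega)).mul (ih (n - i) (by omega)))
        rcases i with _ | _ | i
        · simpa [pow_succ'] using h1
        · have h2 := HasSeriesExpansion.smul HasExpansion.inv_natCast h1
          simpa using h2
        · have h2 := HasSeriesExpansion.smul (HasExpansion.inv_natCast_pow i) h1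
          simpa using h2
      have h3 := HasSeriesExpansion.sum _ key
      have e1 : (∑ i ∈ Finset.range (n + 1), if i = 0 then a 1 ^ (n + 1) else 0) = a 1 ^ (n + 1) := by
        rw [Finset.sum_ite_eq' (Finset.range (n + 1)) 0 (fun _ => a 1 ^ (n + 1)), if_pos (by simp)]
      rw [e1] at h3
      have e2 : (∑ i ∈ Finset.range (n + 1), if i = 0 then
            a 1 * ((n : PowerSeries ℂ) * a 1 ^ (n - 1) * b 1 +
            (n.choose 2 : PowerSeries ℂ) * a 1 ^ (n - 2) * a 2) + b 1 * a 1 ^ n else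
            if i = 1 then (n : PowerSeries ℂ) * (a 2 * a 1 ^ (n - 1)) else 0) =
          ((n + 1 : ℕ) : PowerSeries ℂ) * a 1 ^ (n + 1 - 1) * b 1 +
            ((n + 1).choose 2 : PowerSeries ℂ) * a 1 ^ (n + 1 - 2) * a 2 := by
        rcases n with _ | _ | n
        · simp
        · simp [Finset.sum_range_succ]
          ring
        · rw [Finset.sum_range_succ', Finset.sum_range_succ', Finset.sum_eq_zero]
          · rw [Nat.choose_succ_succ' (n + 1 + 1) 1, Nat.choose_one_right]
            simp only [Nat.add_sub_cancel, show n + 1 + 1 + 1 - 2 = n + 1 by omega,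
              show n + 1 + 1 - 2 = n by omega]
            push_cast
            simp
            ring
          · intro i _
            simp
      rw [e2] at h3
      refine h3.congr' ?_
      filter_upwards [hG] with N hN
      rw [hN, Finset.mul_sum]
      refine Finset.sum_congr rfl fun i hi => ?_
      rw [Finset.mem_range] at hi
      have e3 : (N : ℂ)⁻¹ ^ (n + 1) = (N : ℂ)⁻¹ ^ i * ((N : ℂ)⁻¹ * (N : ℂ)⁻¹ ^ (n - i)) := by
        rw [← pow_succ', ← pow_add]
        congr 1
        omega
      rw [e3, map_mul, map_mul]
      ring

/-! ### Closed forms of the limiting moment and of its 1/N correction. -/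

theorem PowerSeries.sum_choose_coeff_mul_pow (P A : PowerSeries ℂ) (n r : ℕ) :
    ∑ m ∈ Finset.range (n + 1), (n.choose m : ℂ) * PowerSeries.coeff (m + r) (P * A ^ (n - m)) =
      PowerSeries.coeff (n + r) (P * (1 + PowerSeries.X * A) ^ n) := by
  rw [add_pow, Finset.mul_sum, map_sum]
  refine Finset.sum_congr rfl fun m hm => ?_
  rw [Finset.mem_range] at hm
  have e : P * (1 ^ m * (PowerSeries.X * A) ^ (n - m) * (n.choose m : PowerSeries ℂ)) =
      PowerSeries.C (n.choose m : ℂ) * (PowerSeries.X ^ (n - m) * (P * A ^ (n - m))) := by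
    rw [map_natCast]; ring
  rw [e, PowerSeries.coeff_C_mul, PowerSeries.coeff_X_pow_mul', if_pos (by omega)]
  congr 3
  omega

/-- Binomial expansion of (1 + X A)^(n+1), whose term (X A)^(n+1) does not reach degree n; this
accounts for the shifted binomial coefficient. -/
theorem PowerSeries.sum_choose_succ_coeff_mul_pow (P A : PowerSeries ℂ) (n : ℕ) :
    ∑ m ∈ Finset.range (n + 1), ((n + 1).choose (m + 1) : ℂ) *
      PowerSeries.coeff m (P * A ^ (n - m)) =
      PowerSeries.coeff n (P * (1 + PowerSeries.X * A) ^ (n + 1)) := by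
  rw [add_pow, Finset.mul_sum, map_sum, Finset.sum_range_succ' _ (n + 1)]
  have e0 : PowerSeries.coeff n (P * (1 ^ 0 * (PowerSeries.X * A) ^ (n + 1 - 0) *
      ((n + 1).choose 0 : PowerSeries ℂ))) = 0 := by
    have : P * (1 ^ 0 * (PowerSeries.X * A) ^ (n + 1 - 0) * ((n + 1).choose 0 : PowerSeries ℂ)) =
        PowerSeries.X ^ (n + 1) * (P * A ^ (n + 1)) := by
      simp only [Nat.choose_zero_right, Nat.sub_zero]; push_cast; ring
    rw [this, PowerSeries.coeff_X_pow_mul', if_neg (by omega)]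
  rw [e0, add_zero]
  refine Finset.sum_congr rfl fun m hm => ?_
  rw [Finset.mem_range] at hm
  have e : P * (1 ^ (m + 1) * (PowerSeries.X * A) ^ (n + 1 - (m + 1)) *
      ((n + 1).choose (m + 1) : PowerSeries ℂ)) =
      PowerSeries.C ((n + 1).choose (m + 1) : ℂ) * (PowerSeries.X ^ (n - m) * (P * A ^ (n - m))) := by
    rw [map_natCast, Nat.add_sub_add_right]; ring
  rw [e, PowerSeries.coeff_C_mul, PowerSeries.coeff_X_pow_mul', if_pos (by omega)]
  congr 3
  omega

theorem choose_mul_factorial_div (k m : ℕ) :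
    (k.choose m : ℂ) * (m.factorial : ℂ) * (1 / ((m + 1).factorial : ℂ)) =
      ((k + 1).choose (m + 1) : ℂ) / ((k : ℂ) + 1) := by
  have h := Nat.add_one_mul_choose_eq k m
  have h' : ((k : ℂ) + 1) * k.choose m = (k + 1).choose (m + 1) * ((m : ℂ) + 1) := by
    exact_mod_cast h
  have h1 : (m.factorial : ℂ) ≠ 0 := by exact_mod_cast m.factorial_ne_zero
  have h2 : ((m : ℂ) + 1) ≠ 0 := Nat.cast_add_one_ne_zero m
  have h3 : ((k : ℂ) + 1) ≠ 0 := Nat.cast_add_one_ne_zero k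
  rw [Nat.factorial_succ]
  push_cast
  field_simp
  linear_combination h'

/-- The leading coefficient of the `k`-th moment. -/
noncomputable def limMoment (q : ℝ) (A : PowerSeries ℂ) (k : ℕ) : ℂ :=
  ∑ m ∈ Finset.range (k + 1), (k.choose m : ℂ) * (m.factorial : ℂ) *
    (1 / ((m + 1).factorial : ℂ) * PowerSeries.coeff m (binomSeries (k - q) * A ^ (k - m)))

theorem limMoment_eq (q : ℝ) (A : PowerSeries ℂ) (k : ℕ) :
    ((k : ℂ) + 1) * limMoment q A k =
      PowerSeries.coeff k (binomSeries (k - q) * (1 + PowerSeries.X * A) ^ (k + 1)) := by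
  rw [← PowerSeries.sum_choose_succ_coeff_mul_pow, limMoment, Finset.mul_sum]
  refine Finset.sum_congr rfl fun m _ => ?_
  have := choose_mul_factorial_div k m
  have h3 : ((k : ℂ) + 1) ≠ 0 := Nat.cast_add_one_ne_zero k
  rw [← mul_assoc (_ * _), this]
  field_simp

/-- The `1 / N`-correction of the `k`-th moment. -/
noncomputable def corrMoment (q : ℝ) (A B : PowerSeries ℂ) (k : ℕ) : ℂ :=
  (∑ m ∈ Finset.range (k + 1), (k.choose m : ℂ) * (m.factorial : ℂ) *
    (1 / ((m + 1).factorial : ℂ) * PowerSeries.coeff m (binomSeries (k - q) *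
      (((k - m : ℕ) : PowerSeries ℂ) * A ^ (k - m - 1) * B + ((k - m).choose 2 : PowerSeries ℂ) *
        A ^ (k - m - 2) * PowerSeries.derivative ℂ A)) +
      -((m + 1).choose 2 : ℂ) / ((m + 1).factorial : ℂ) *
        PowerSeries.coeff m (binomSeries (k - q) * A ^ (k - m)))) +
  (k.choose 2 : ℂ) * ∑ m ∈ Finset.range k, ((k - 1).choose m : ℂ) * (m.factorial : ℂ) *
    (1 / ((m + 1).factorial : ℂ) *
      PowerSeries.coeff m (binomSeries (k - 1 - q) * A ^ (k - 1 - m)))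

theorem corrMoment_eq_sum (q : ℝ) (A B : PowerSeries ℂ) (k : ℕ) : corrMoment q A B k =
    (∑ m ∈ Finset.range (k + 1), (k.choose m : ℂ) * (m.factorial : ℂ) *
      (1 / ((m + 1).factorial : ℂ) * PowerSeries.coeff m (binomSeries (k - q) *
        (((k - m : ℕ) : PowerSeries ℂ) * A ^ (k - m - 1) * B)))) +
    (∑ m ∈ Finset.range (k + 1), (k.choose m : ℂ) * (m.factorial : ℂ) *
      (1 / ((m + 1).factorial : ℂ) * PowerSeries.coeff m (binomSeries (k - q) *
        (((k - m).choose 2 : PowerSeries ℂ) * A ^ (k - m - 2) * PowerSeries.derivative ℂ A)))) +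
    (∑ m ∈ Finset.range (k + 1), (k.choose m : ℂ) * (m.factorial : ℂ) *
      (-((m + 1).choose 2 : ℂ) / ((m + 1).factorial : ℂ) *
        PowerSeries.coeff m (binomSeries (k - q) * A ^ (k - m)))) +
    (k.choose 2 : ℂ) * ∑ m ∈ Finset.range k, ((k - 1).choose m : ℂ) * (m.factorial : ℂ) *
      (1 / ((m + 1).factorial : ℂ) *
        PowerSeries.coeff m (binomSeries (k - 1 - q) * A ^ (k - 1 - m))) := by
  rw [corrMoment]
  congr 1
  rw [← Finset.sum_add_distrib, ← Finset.sum_add_distrib]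
  refine Finset.sum_congr rfl fun m _ => ?_
  rw [mul_add (binomSeries _), map_add]
  ring

theorem corrMoment_zero (q : ℝ) (A B : PowerSeries ℂ) : corrMoment q A B 0 = 0 := by
  simp [corrMoment]

/-- With U = 1 + X A, b = (1+X)^(j+1-q) and b' = (1+X)^(j-q), the correction is the sum of four
contributions: Φ, the second derivative of Ψ, the 1/N term of (N choose m+1), and the Stirling
number (j+1 choose 2). Integration by parts (`t5`) cancels the derivative of A, and the last three
collapse to (q-1)/2 times [X^j] b' U^(j+1). -/
theorem corrMoment_succ (q : ℝ) (A B : PowerSeries ℂ) (j : ℕ) :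
    corrMoment q A B (j + 1) = PowerSeries.coeff j (binomSeries (j - q) *
      (1 + PowerSeries.X * A) ^ (j + 1) *
        ((1 + PowerSeries.X) * B + PowerSeries.C (((q : ℂ) - 1) / 2))) := by
  set b := binomSeries ((j + 1 : ℕ) - q) with hb
  set b' := binomSeries (j - q) with hb'
  set U := 1 + PowerSeries.X * A with hU
  set A' := PowerSeries.derivative ℂ A with hA'
  have hbb : b = (1 + PowerSeries.X) * b' := by
    rw [hb, hb', ← binomSeries_add_one]; push_cast; ring_nf
  have hdb : PowerSeries.derivative ℂ b = PowerSeries.C ((j : ℂ) + 1 - q) * b' := by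
    have := derivative_binomSeries ((j : ℂ) - q)
    rw [hb, hb']
    rw [show ((j + 1 : ℕ) : ℂ) - q = (j : ℂ) - q + 1 by push_cast; ring, this]
    congr 2
    ring
  have hj : ((j : ℂ) + 1) ≠ 0 := Nat.cast_add_one_ne_zero j
  have hj2 : ((j : ℂ) + 1 + 1) ≠ 0 := by exact_mod_cast Nat.succ_ne_zero (j + 1)
  -- the term with `B`
  have t1 : ∑ m ∈ Finset.range (j + 2), ((j + 1).choose m : ℂ) * (m.factorial : ℂ) *
      (1 / ((m + 1).factorial : ℂ) * PowerSeries.coeff m (b *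
      (((j + 1 - m : ℕ) : PowerSeries ℂ) * A ^ (j + 1 - m - 1) * B))) =
      PowerSeries.coeff j (b * B * U ^ (j + 1)) := by
    rw [hU, ← PowerSeries.sum_choose_succ_coeff_mul_pow, Finset.sum_range_succ, Nat.sub_self]
    simp only [Nat.cast_zero, zero_mul, mul_zero, map_zero, add_zero]
    refine Finset.sum_congr rfl fun m hm => ?_
    rw [Finset.mem_range] at hm
    have e : b * (((j + 1 - m : ℕ) : PowerSeries ℂ) * A ^ (j + 1 - m - 1) * B) =
        PowerSeries.C ((j + 1 - m : ℕ) : ℂ) * (b * B * A ^ (j - m)) := by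
      rw [map_natCast, show j + 1 - m - 1 = j - m by omega]; ring
    rw [e, PowerSeries.coeff_C_mul, ← mul_assoc, ← mul_assoc]
    congr 1
    have h1 := Nat.choose_succ_right_eq (j + 1) m
    have h1' : ((j + 1).choose (m + 1) : ℂ) * ((m : ℂ) + 1) =
      (j + 1).choose m * ((j + 1 - m : ℕ) : ℂ) := by exact_mod_cast h1
    have h2 : (m.factorial : ℂ) ≠ 0 := by exact_mod_cast m.factorial_ne_zero
    have h3 : ((m : ℂ) + 1) ≠ 0 := Nat.cast_add_one_ne_zero m
    rw [Nat.factorial_succ]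
    push_cast [-Nat.cast_sub]
    field_simp
    linear_combination -h1'
  -- the term with `A'`
  have t2 : ∑ m ∈ Finset.range (j + 2), ((j + 1).choose m : ℂ) * (m.factorial : ℂ) *
      (1 / ((m + 1).factorial : ℂ) * PowerSeries.coeff m (b *
      (((j + 1 - m).choose 2 : PowerSeries ℂ) * A ^ (j + 1 - m - 2) * A'))) =
      ((j : ℂ) + 1) / 2 * PowerSeries.coeff j (PowerSeries.X * (b * A' * U ^ j)) := by
    rcases j with _ | i
    · simp [Finset.sum_range_succ]
    · rw [PowerSeries.coeff_succ_X_mul, hU, ← PowerSeries.sum_choose_succ_coeff_mul_pow,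
        Finset.sum_range_succ, Finset.sum_range_succ, Finset.mul_sum]
      have e1 : (i + 1 + 1 - (i + 1)).choose 2 = 0 := by
        rw [show i + 1 + 1 - (i + 1) = 1 by omega]; rfl
      rw [e1, Nat.sub_self]
      simp only [Nat.choose_zero_succ, Nat.cast_zero, zero_mul, mul_zero, map_zero, add_zero]
      refine Finset.sum_congr rfl fun m hm => ?_
      rw [Finset.mem_range] at hm
      have e : b * (((i + 1 + 1 - m).choose 2 : PowerSeries ℂ) * A ^ (i + 1 + 1 - m - 2) * A') =
          PowerSeries.C ((i + 1 + 1 - m).choose 2 : ℂ) * (b * A' * A ^ (i - m)) := by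
        rw [map_natCast, show i + 1 + 1 - m - 2 = i - m by omega]; ring
      rw [e, PowerSeries.coeff_C_mul, ← mul_assoc, ← mul_assoc, ← mul_assoc]
      congr 1
      obtain ⟨r, rfl⟩ : ∃ r, i = m + r := ⟨i - m, by omega⟩
      rw [show m + r + 1 + 1 - m = r + 2 by omega]
      have h1 := Nat.choose_mul (n := m + r + 1 + 1) (k := m + 2) (s := m) (by omega)
      have h2 := Nat.add_one_mul_choose_eq (m + r + 1) (m + 1)
      have h3 := Nat.choose_symm_add (a := m) (b := 2)
      have h4 := Nat.add_one_mul_choose_eq (m + 1) 1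
      rw [show m + r + 1 + 1 - m = r + 2 by omega, show m + 2 - m = 2 by omega, h3] at h1
      have h1' : ((m + r + 1 + 1).choose (m + 2) : ℂ) * ((m + 2).choose 2 : ℂ) =
        (m + r + 1 + 1).choose m * (r + 2).choose 2 := by exact_mod_cast h1
      have h2' : ((m : ℂ) + r + 1 + 1) * (m + r + 1).choose (m + 1) =
        (m + r + 1 + 1).choose (m + 2) * ((m : ℂ) + 1 + 1) := by exact_mod_cast h2
      have h4' : ((m : ℂ) + 1 + 1) * ((m : ℂ) + 1) = (m + 2).choose 2 * (1 + 1) := by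
        rw [Nat.choose_one_right] at h4
        exact_mod_cast h4
      have h5 : (m.factorial : ℂ) ≠ 0 := by exact_mod_cast m.factorial_ne_zero
      have h6 : ((m : ℂ) + 1) ≠ 0 := Nat.cast_add_one_ne_zero m
      rw [Nat.factorial_succ]
      push_cast
      field_simp
      linear_combination (-2 : ℂ) * h1' - ((m : ℂ) + 1) * h2' -
        ((m + r + 1 + 1).choose (m + 2) : ℂ) * h4'
  -- the term from the binomial coefficients
  have t3 : ∑ m ∈ Finset.range (j + 2), ((j + 1).choose m : ℂ) * (m.factorial : ℂ) *
      (-((m + 1).choose 2 : ℂ) / ((m + 1).factorial : ℂ) *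
        PowerSeries.coeff m (b * A ^ (j + 1 - m))) =
      -((j : ℂ) + 1) / 2 * PowerSeries.coeff (j + 1) (b * U ^ j) := by
    rw [hU, ← PowerSeries.sum_choose_coeff_mul_pow, Finset.sum_range_succ', Finset.mul_sum]
    have e0 : (((0 + 1).choose 2 : ℕ) : ℂ) = 0 := by simp
    rw [e0]
    simp only [neg_zero, zero_div, zero_mul, mul_zero, add_zero]
    refine Finset.sum_congr rfl fun m hm => ?_
    rw [Nat.add_sub_add_right, ← mul_assoc, ← mul_assoc]
    congr 1
    have h1 := Nat.add_one_mul_choose_eq j m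
    have h1' : ((j : ℂ) + 1) * j.choose m = (j + 1).choose (m + 1) * ((m : ℂ) + 1) := by
      exact_mod_cast h1
    have h2 := Nat.add_one_mul_choose_eq (m + 1) 1
    have h2' : ((m : ℂ) + 1 + 1) * ((m : ℂ) + 1) = (m + 1 + 1).choose 2 * (1 + 1) := by
      rw [Nat.choose_one_right] at h2
      exact_mod_cast h2
    have h5 : ((m + 1).factorial : ℂ) ≠ 0 := by exact_mod_cast (m + 1).factorial_ne_zero
    have h6 : ((m : ℂ) + 1 + 1) ≠ 0 := by exact_mod_cast Nat.succ_ne_zero (m + 1)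
    rw [Nat.factorial_succ (m + 1)]
    push_cast
    field_simp
    linear_combination ((j + 1).choose (m + 1) : ℂ) * h2' + ((m : ℂ) + 1 + 1) * h1'
  -- The Stirling contribution is a multiple of the leading moment of order j, already in closed
  -- form.
  have t4 : ((j + 1).choose 2 : ℂ) * ∑ m ∈ Finset.range (j + 1), (j.choose m : ℂ) *
      (m.factorial : ℂ) * (1 / ((m + 1).factorial : ℂ) *
      PowerSeries.coeff m (b' * A ^ (j - m))) =
      (j : ℂ) / 2 * PowerSeries.coeff j (b' * U ^ (j + 1)) := by
    have h1 := limMoment_eq q A j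
    have h2 := Nat.add_one_mul_choose_eq j 1
    have h2' : ((j : ℂ) + 1) * j = (j + 1).choose 2 * (1 + 1) := by
      rw [Nat.choose_one_right] at h2
      exact_mod_cast h2
    rw [← h1, limMoment, hb']
    linear_combination (-(1 : ℂ) / 2) * (∑ m ∈ Finset.range (j + 1), (j.choose m : ℂ) *
      (m.factorial : ℂ) * (1 / ((m + 1).factorial : ℂ) *
      PowerSeries.coeff m (binomSeries (j - q) * A ^ (j - m)))) * h2'
  -- The coefficient of X^j in the derivative of b U^(j+1), with b U^(j+1) = b U^j + X b A U^j on
  -- the left; the terms with b A U^j cancel.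
  have t5 : ((j : ℂ) + 1) * PowerSeries.coeff (j + 1) (b * U ^ j) =
      ((j : ℂ) + 1 - q) * PowerSeries.coeff j (b' * U ^ (j + 1)) +
      ((j : ℂ) + 1) * PowerSeries.coeff j (PowerSeries.X * (b * A' * U ^ j)) := by
    have hdU : PowerSeries.derivative ℂ U = A + PowerSeries.X * A' := by
      rw [hU, map_add, Derivation.leibniz, Derivation.map_one_eq_zero]
      simp only [PowerSeries.derivative_X, smul_eq_mul, mul_one]
      ring
    have h1 : PowerSeries.derivative ℂ (b * U ^ (j + 1)) =
        PowerSeries.C ((j : ℂ) + 1 - q) * (b' * U ^ (j + 1)) +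
        PowerSeries.C ((j : ℂ) + 1) * (b * A * U ^ j) +
        PowerSeries.C ((j : ℂ) + 1) * (PowerSeries.X * (b * A' * U ^ j)) := by
      rw [Derivation.leibniz, PowerSeries.derivative_pow, hdU, hdb]
      simp only [smul_eq_mul, Nat.add_sub_cancel, map_add, map_sub, map_natCast, map_one]
      push_cast
      ring
    have h2 := congrArg (PowerSeries.coeff j) h1
    have h3 : b * U ^ (j + 1) = b * U ^ j + PowerSeries.X * (b * A * U ^ j) := by
      rw [pow_succ]
      nth_rewrite 2 [hU]
      ring
    rw [PowerSeries.coeff_derivative, h3, map_add (PowerSeries.coeff (j + 1)),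
      PowerSeries.coeff_succ_X_mul] at h2
    simp only [map_add (PowerSeries.coeff j), PowerSeries.coeff_C_mul] at h2
    linear_combination h2
  have hsplit : corrMoment q A B (j + 1) =
      (∑ m ∈ Finset.range (j + 2), ((j + 1).choose m : ℂ) * (m.factorial : ℂ) *
      (1 / ((m + 1).factorial : ℂ) * PowerSeries.coeff m (b *
      (((j + 1 - m : ℕ) : PowerSeries ℂ) * A ^ (j + 1 - m - 1) * B)))) +
      (∑ m ∈ Finset.range (j + 2), ((j + 1).choose m : ℂ) * (m.factorial : ℂ) *
      (1 / ((m + 1).factorial : ℂ) * PowerSeries.coeff m (b *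
      (((j + 1 - m).choose 2 : PowerSeries ℂ) * A ^ (j + 1 - m - 2) * A')))) +
      (∑ m ∈ Finset.range (j + 2), ((j + 1).choose m : ℂ) * (m.factorial : ℂ) *
      (-((m + 1).choose 2 : ℂ) / ((m + 1).factorial : ℂ) *
        PowerSeries.coeff m (b * A ^ (j + 1 - m)))) +
      ((j + 1).choose 2 : ℂ) * ∑ m ∈ Finset.range (j + 1), (j.choose m : ℂ) *
      (m.factorial : ℂ) * (1 / ((m + 1).factorial : ℂ) *
      PowerSeries.coeff m (b' * A ^ (j - m))) := by
    have h := corrMoment_eq_sum q A B (j + 1)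
    rw [show ((j + 1 : ℕ) : ℂ) - 1 - q = j - q by push_cast; ring, Nat.add_sub_cancel] at h
    exact h
  rw [hsplit, t1, t2, t3, t4]
  have e : b' * U ^ (j + 1) * ((1 + PowerSeries.X) * B + PowerSeries.C (((q : ℂ) - 1) / 2)) =
      b * B * U ^ (j + 1) + PowerSeries.C (((q : ℂ) - 1) / 2) * (b' * U ^ (j + 1)) := by
    rw [hbb]; ring
  rw [e, map_add, PowerSeries.coeff_C_mul]
  linear_combination (-(1 : ℂ) / 2) * t5

/-! ### Asymptotics of the falling factorial moments and of the ordinary moments. -/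

/-- The contribution of the falling factorial of degree `p` in terms of the Taylor coefficients of
the Schur generating function. -/
noncomputable def fallingMoment (q : ℝ) (N p : ℕ) (G : ℕ → PowerSeries ℂ) : ℂ :=
  ∑ m ∈ Finset.range (p + 1), (p.choose m : ℂ) * (m.factorial : ℂ) * ((N.choose (m + 1) : ℂ) *
    PowerSeries.coeff m (binomSeries (p - q) * G (p - m)))

/-- In the m-th summand N^(-(p+1)) splits into N^(-(m+1)), which normalizes the binomial
coefficient, and N^(-(p-m)), which normalizes the derivative of order p-m. -/
theorem hasExpansion_fallingMoment {k : ℕ} (q : ℝ) {G D : ℕ → ℕ → PowerSeries ℂ}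
    {a b : ℕ → PowerSeries ℂ}
    (hG0 : ∀ᶠ N in atTop, ∀ m ≤ k, PowerSeries.coeff m (G N 0) = PowerSeries.coeff m 1)
    (hG : ∀ᶠ N in atTop, ∀ n, G N (n + 1) =
      ∑ i ∈ Finset.range (n + 1), (n.choose i : PowerSeries ℂ) * (D N (i + 1) * G N (n - i)))
    (hD : ∀ i, 1 ≤ i →
      HasSeriesExpansion k (fun N => PowerSeries.C ((N : ℂ)⁻¹) * D N i) (a i) (b i))
    {p : ℕ} (hp : p ≤ k) :
    HasExpansion (fun N => (N : ℂ)⁻¹ ^ (p + 1) * fallingMoment q N p (G N))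
      (limMoment q (a 1) p)
      (∑ m ∈ Finset.range (p + 1), (p.choose m : ℂ) * (m.factorial : ℂ) *
        (1 / ((m + 1).factorial : ℂ) * PowerSeries.coeff m (binomSeries (p - q) *
          (((p - m : ℕ) : PowerSeries ℂ) * a 1 ^ (p - m - 1) * b 1 +
            ((p - m).choose 2 : PowerSeries ℂ) * a 1 ^ (p - m - 2) * a 2)) +
          -((m + 1).choose 2 : ℂ) / ((m + 1).factorial : ℂ) *
            PowerSeries.coeff m (binomSeries (p - q) * a 1 ^ (p - m)))) := by
  have h := hasSeriesExpansion_exp hG0 hG hD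
  unfold limMoment
  refine (HasExpansion.sum (Finset.range (p + 1)) (x := fun m N => (p.choose m : ℂ) *
      (m.factorial : ℂ) * ((N.choose (m + 1) : ℂ) / (N : ℂ) ^ (m + 1) *
        PowerSeries.coeff m (binomSeries (p - q) *
          (PowerSeries.C ((N : ℂ)⁻¹ ^ (p - m)) * G N (p - m))))) fun m hm => ?_).congr'
      (Eventually.of_forall fun N => ?_)
  · rw [Finset.mem_range] at hm
    have h2 := ((HasSeriesExpansion.const (k := k) (binomSeries (p - q))).mul (h (p - m))) m
      (by omega)
    rw [zero_mul, add_zero] at h2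
    exact ((HasExpansion.choose_div (m + 1)).mul h2).const_mul _
  dsimp only
  rw [fallingMoment, Finset.mul_sum]
  refine Finset.sum_congr rfl fun m hm => ?_
  rw [Finset.mem_range] at hm
  have e : binomSeries (p - q) * (PowerSeries.C ((N : ℂ)⁻¹ ^ (p - m)) * G N (p - m)) =
      PowerSeries.C ((N : ℂ)⁻¹ ^ (p - m)) * (binomSeries (p - q) * G N (p - m)) := by ring
  have e2 : (N : ℂ)⁻¹ ^ (p + 1) = (N : ℂ)⁻¹ ^ (m + 1) * (N : ℂ)⁻¹ ^ (p - m) := by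
    rw [← pow_add]; congr 1; omega
  rw [e, PowerSeries.coeff_C_mul, e2, div_eq_mul_inv, ← inv_pow]
  ring

/-- The falling factorial of degree p has size N^(p+1), so after division by N^(k+1) only p = k
contributes to the limit. At order 1/N there is in addition p = k-1, with Stirling number (k choose
2). -/
theorem hasExpansion_moment {k : ℕ} (q : ℝ) {G D : ℕ → ℕ → PowerSeries ℂ}
    {a b : ℕ → PowerSeries ℂ}
    (hG0 : ∀ᶠ N in atTop, ∀ m ≤ k, PowerSeries.coeff m (G N 0) = PowerSeries.coeff m 1)
    (hG : ∀ᶠ N in atTop, ∀ n, G N (n + 1) =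
      ∑ i ∈ Finset.range (n + 1), (n.choose i : PowerSeries ℂ) * (D N (i + 1) * G N (n - i)))
    (hD : ∀ i, 1 ≤ i →
      HasSeriesExpansion k (fun N => PowerSeries.C ((N : ℂ)⁻¹) * D N i) (a i) (b i))
    (ha : a 2 = PowerSeries.derivative ℂ (a 1)) :
    HasExpansion (fun N => (N : ℂ)⁻¹ ^ (k + 1) * ∑ p ∈ Finset.range (k + 1),
      (k.stirlingSecond p : ℂ) * fallingMoment q N p (G N))
      (limMoment q (a 1) k) (corrMoment q (a 1) (b 1) k) := by
  have h1 : ∀ p ∈ Finset.range (k + 1), HasExpansion (fun N => (k.stirlingSecond p : ℂ) *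
      ((N : ℂ)⁻¹ ^ (k - p) * ((N : ℂ)⁻¹ ^ (p + 1) * fallingMoment q N p (G N))))
      (if p = k then limMoment q (a 1) k else 0)
      ((if p = k then ∑ m ∈ Finset.range (k + 1), (k.choose m : ℂ) * (m.factorial : ℂ) *
        (1 / ((m + 1).factorial : ℂ) * PowerSeries.coeff m (binomSeries (k - q) *
          (((k - m : ℕ) : PowerSeries ℂ) * a 1 ^ (k - m - 1) * b 1 +
            ((k - m).choose 2 : PowerSeries ℂ) * a 1 ^ (k - m - 2) *
              PowerSeries.derivative ℂ (a 1))) +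
          -((m + 1).choose 2 : ℂ) / ((m + 1).factorial : ℂ) *
            PowerSeries.coeff m (binomSeries (k - q) * a 1 ^ (k - m))) else 0) +
        if p + 1 = k then (k.choose 2 : ℂ) * limMoment q (a 1) p else 0) := by
    intro p hp
    rw [Finset.mem_range] at hp
    have h2 := hasExpansion_fallingMoment q hG0 hG hD (p := p) (by omega)
    rcases (show p = k ∨ p + 1 = k ∨ p + 2 ≤ k by omega) with rfl | rfl | h3
    · simp only [Nat.stirlingSecond_self, Nat.sub_self, pow_zero, one_mul, Nat.cast_one, if_true,
        Nat.succ_ne_self, if_false, add_zero]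
      rw [← ha]
      exact h2
    · have h4 := (HasExpansion.inv_natCast.mul h2).const_mul ((p + 1).stirlingSecond p : ℂ)
      rw [Nat.stirlingSecond_succ_self_left] at h4 ⊢
      simpa using h4
    · obtain ⟨r, rfl⟩ : ∃ r, k = p + (r + 2) := ⟨k - p - 2, by omega⟩
      have h4 := ((HasExpansion.inv_natCast_pow r).mul h2).const_mul
        ((p + (r + 2)).stirlingSecond p : ℂ)
      rw [if_neg (by omega), if_neg (by omega), if_neg (by omega), Nat.add_sub_cancel_left]
      simpa using h4
  have h2 := HasExpansion.sum _ h1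
  rw [Finset.sum_add_distrib, Finset.sum_ite_eq' _ k (fun _ => limMoment q (a 1) k),
    Finset.sum_ite_eq' _ k, if_pos (by simp), if_pos (by simp)] at h2
  have e : (∑ p ∈ Finset.range (k + 1), if p + 1 = k then (k.choose 2 : ℂ) * limMoment q (a 1) p
      else 0) = (k.choose 2 : ℂ) * ∑ m ∈ Finset.range k, ((k - 1).choose m : ℂ) *
      (m.factorial : ℂ) * (1 / ((m + 1).factorial : ℂ) *
      PowerSeries.coeff m (binomSeries (k - 1 - q) * a 1 ^ (k - 1 - m))) := by
    rcases k with _ | k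
    · simp
    · rw [Finset.sum_eq_single_of_mem k (by simp), if_pos rfl, limMoment, Nat.add_sub_cancel,
        Nat.cast_add_one, add_sub_cancel_right]
      intro p _ hp
      rw [if_neg (by omega)]
  rw [e] at h2
  rw [corrMoment]
  refine h2.congr' (Eventually.of_forall fun N => ?_)
  dsimp only
  rw [Finset.mul_sum]
  refine Finset.sum_congr rfl fun p hp => ?_
  rw [Finset.mem_range] at hp
  have e2 : (N : ℂ)⁻¹ ^ (k + 1) = (N : ℂ)⁻¹ ^ (k - p) * (N : ℂ)⁻¹ ^ (p + 1) := by
    rw [← pow_add]; congr 1; omega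
  rw [e2]
  ring

/-! ### Derivatives in the first variable on the diagonal -/

noncomputable def diagDeriv (n : ℕ) (F : ℂ × ℂ → ℂ) (z : ℂ) : ℂ :=
  iteratedDeriv n (fun Y => F (Y, z)) z

theorem AnalyticOnNhd.slice {F : ℂ × ℂ → ℂ} {U : Set (ℂ × ℂ)} (hF : AnalyticOnNhd ℂ F U)
    {p : ℂ × ℂ} (hp : p ∈ U) : AnalyticAt ℂ (fun Y => F (Y, p.2)) p.1 :=
  (hF p hp).comp (f := fun Y : ℂ => (Y, p.2)) (by fun_prop)

theorem AnalyticOnNhd.iteratedDeriv_fst {F : ℂ × ℂ → ℂ} {U : Set (ℂ × ℂ)} (hU : IsOpen U)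
    (hF : AnalyticOnNhd ℂ F U) (n : ℕ) :
    AnalyticOnNhd ℂ (fun p : ℂ × ℂ => iteratedDeriv n (fun Y => F (Y, p.2)) p.1) U := by
  induction n with
  | zero => simpa using hF
  | succ n ih =>
    have h1 := ih.fderiv
    have h2 : AnalyticOnNhd ℂ (fun p => fderiv ℂ (fun p : ℂ × ℂ =>
        iteratedDeriv n (fun Y => F (Y, p.2)) p.1) p (1, 0)) U :=
      (ContinuousLinearMap.apply ℂ ℂ ((1, 0) : ℂ × ℂ)).comp_analyticOnNhd h1
    refine h2.congr hU fun p hp => ?_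
    rw [iteratedDeriv_succ]
    have h3 := (ih p hp).differentiableAt.hasFDerivAt
    have h4 : HasDerivAt (fun Y : ℂ => (Y, p.2)) (1, 0) p.1 :=
      (hasDerivAt_id p.1).prodMk (hasDerivAt_const p.1 p.2)
    have h5 := HasFDerivAt.comp_hasDerivAt (f := fun Y : ℂ => (Y, p.2)) p.1 h3 h4
    exact h5.deriv.symm

theorem AnalyticOnNhd.diagDeriv {F : ℂ × ℂ → ℂ} {r : ℝ}
    (hF : AnalyticOnNhd ℂ F (Metric.ball 0 r)) (n : ℕ) :
    AnalyticOnNhd ℂ (diagDeriv n F) (Metric.ball 0 r) := by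
  intro z hz
  have hz' : (z, z) ∈ Metric.ball (0 : ℂ × ℂ) r := by
    rw [Metric.mem_ball, dist_zero_right] at hz ⊢
    simpa [Prod.norm_def] using hz
  exact (hF.iteratedDeriv_fst Metric.isOpen_ball n (z, z) hz').comp (f := fun z : ℂ => (z, z))
    (by fun_prop)

theorem AnalyticOnNhd.analyticAt_diagDeriv {F : ℂ × ℂ → ℂ} {r : ℝ} (hr : 0 < r)
    (hF : AnalyticOnNhd ℂ F (Metric.ball 0 r)) (n : ℕ) : AnalyticAt ℂ (_root_.diagDeriv n F) 0 :=
  hF.diagDeriv n 0 (Metric.mem_ball_self hr)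

theorem mk_mem_ball_zero {y z : ℂ} {r : ℝ} (hy : ‖y‖ < r) (hz : ‖z‖ < r) :
    (y, z) ∈ Metric.ball (0 : ℂ × ℂ) r := by
  rw [Metric.mem_ball, dist_zero_right, Prod.norm_def]
  exact max_lt hy hz

/-- The Taylor coefficients of `diagDeriv n F`. -/
noncomputable def diagCoeff (n m : ℕ) (F : ℂ × ℂ → ℂ) : ℂ :=
  PowerSeries.coeff m (taylorSeries (diagDeriv n F))

/-- Cauchy estimate for `diagCoeff`. -/
theorem exists_norm_diagCoeff_le {r : ℝ} (hr : 0 < r) (n m : ℕ) : ∃ K : ℝ, 0 < K ∧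
    ∀ (F : ℂ × ℂ → ℂ) (C : ℝ), AnalyticOnNhd ℂ F (Metric.ball 0 r) →
      (∀ p ∈ Metric.ball (0 : ℂ × ℂ) r, ‖F p‖ ≤ C) → ‖diagCoeff n m F‖ ≤ K * C := by
  -- Cauchy estimates are applied twice, on a circle of radius s about z and on one about 0; the
  -- points reached have norm at most 2s < r.
  set s := r / 3 with hs
  have hs0 : 0 < s := by positivity
  refine ⟨(m.factorial * (n.factorial / s ^ n) / s ^ m) / m.factorial, by positivity,
    fun F C hF hC => ?_⟩
  have h1 : ∀ z : ℂ, ‖z‖ ≤ s → ‖diagDeriv n F z‖ ≤ n.factorial * C / s ^ n := by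
    intro z hz
    have hmem : ∀ Y ∈ Metric.closedBall z s, (Y, z) ∈ Metric.ball (0 : ℂ × ℂ) r := by
      intro Y hY
      have h2 : ‖Y‖ ≤ s + s := by
        have := norm_le_norm_add_norm_sub' Y z
        rw [Metric.mem_closedBall, dist_eq_norm] at hY
        linarith
      exact mk_mem_ball_zero (by linarith) (by linarith)
    refine Complex.norm_iteratedDeriv_le_of_forall_mem_sphere_norm_le n hs0 ?_ ?_
    · refine DifferentiableOn.diffContOnCl ?_
      rw [closure_ball z hs0.ne']
      intro Y hY
      exact (hF.slice (hmem Y hY)).differentiableAt.differentiableWithinAt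
    · intro Y hY
      exact hC _ (hmem Y (Metric.sphere_subset_closedBall hY))
  have h2 : ‖iteratedDeriv m (diagDeriv n F) 0‖ ≤
      m.factorial * (n.factorial * C / s ^ n) / s ^ m := by
    refine Complex.norm_iteratedDeriv_le_of_forall_mem_sphere_norm_le m hs0 ?_ ?_
    · refine DifferentiableOn.diffContOnCl ?_
      rw [closure_ball 0 hs0.ne']
      intro z hz
      refine (hF.diagDeriv n z ?_).differentiableAt.differentiableWithinAt
      rw [Metric.mem_closedBall] at hz
      rw [Metric.mem_ball]
      linarith
    · intro z hz
      exact h1 z (by simpa using hz.le)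
  rw [diagCoeff, coeff_taylorSeries, norm_div, Complex.norm_natCast]
  calc _ ≤ m.factorial * (n.factorial * C / s ^ n) / s ^ m / m.factorial := by gcongr
    _ = _ := by ring

theorem diagDeriv_add {F G : ℂ × ℂ → ℂ} {r : ℝ} (hF : AnalyticOnNhd ℂ F (Metric.ball 0 r))
    (hG : AnalyticOnNhd ℂ G (Metric.ball 0 r)) (n : ℕ) {z : ℂ} (hz : ‖z‖ < r) :
    diagDeriv n (fun p => F p + G p) z = diagDeriv n F z + diagDeriv n G z :=
  iteratedDeriv_fun_add (hF.slice (mk_mem_ball_zero hz hz)).contDiffAt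
    (hG.slice (mk_mem_ball_zero hz hz)).contDiffAt

theorem eventually_norm_lt {r : ℝ} (hr : 0 < r) : ∀ᶠ z : ℂ in 𝓝 0, ‖z‖ < r := by
  filter_upwards [Metric.ball_mem_nhds (0 : ℂ) hr] with z hz
  simpa using hz

theorem diagCoeff_add {F G : ℂ × ℂ → ℂ} {r : ℝ} (hr : 0 < r)
    (hF : AnalyticOnNhd ℂ F (Metric.ball 0 r))
    (hG : AnalyticOnNhd ℂ G (Metric.ball 0 r)) (n m : ℕ) :
    diagCoeff n m (fun p => F p + G p) = diagCoeff n m F + diagCoeff n m G := by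
  have h : diagDeriv n (fun p => F p + G p) =ᶠ[𝓝 0] fun z => diagDeriv n F z + diagDeriv n G z := by
    filter_upwards [eventually_norm_lt hr] with z hz
    exact diagDeriv_add hF hG n hz
  rw [diagCoeff, taylorSeries_congr h, taylorSeries_add (hF.analyticAt_diagDeriv hr n)
    (hG.analyticAt_diagDeriv hr n), map_add]
  rfl

theorem diagDeriv_const_mul (c : ℂ) (F : ℂ × ℂ → ℂ) (n : ℕ) :
    diagDeriv n (fun p => c * F p) = fun z => c * diagDeriv n F z := by
  funext z
  exact iteratedDeriv_const_mul_field c _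

theorem diagCoeff_const_mul (c : ℂ) {F : ℂ × ℂ → ℂ} {r : ℝ} (hr : 0 < r)
    (hF : AnalyticOnNhd ℂ F (Metric.ball 0 r)) (n m : ℕ) :
    diagCoeff n m (fun p => c * F p) = c * diagCoeff n m F := by
  rw [diagCoeff, diagDeriv_const_mul, taylorSeries_const_mul _ (hF.analyticAt_diagDeriv hr n),
    PowerSeries.coeff_C_mul]
  rfl

theorem diagCoeff_sub {F G : ℂ × ℂ → ℂ} {r : ℝ} (hr : 0 < r)
    (hF : AnalyticOnNhd ℂ F (Metric.ball 0 r))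
    (hG : AnalyticOnNhd ℂ G (Metric.ball 0 r)) (n m : ℕ) :
    diagCoeff n m (fun p => F p - G p) = diagCoeff n m F - diagCoeff n m G := by
  have h := diagCoeff_add hr hF (analyticOnNhd_const.mul hG (f := fun _ => (-1 : ℂ))) n m
  have h2 := diagCoeff_const_mul (-1) hr hG n m
  have e : (fun p => F p - G p) = fun p => F p + -1 * G p := by
    funext p; ring
  rw [e, h, h2]
  ring

theorem diagCoeff_sum {ι : Type*} (s : Finset ι) {F : ι → ℂ × ℂ → ℂ} {r : ℝ} (hr : 0 < r)
    (hF : ∀ i ∈ s, AnalyticOnNhd ℂ (F i) (Metric.ball 0 r)) (n m : ℕ) :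
    diagCoeff n m (fun p => ∑ i ∈ s, F i p) = ∑ i ∈ s, diagCoeff n m (F i) := by
  classical
  induction s using Finset.induction_on with
  | empty =>
    have := diagCoeff_const_mul (F := fun _ => 0) 0 hr analyticOnNhd_const n m
    simpa using this
  | insert a s ha ih =>
    simp only [Finset.sum_insert ha]
    rw [diagCoeff_add hr (hF a (Finset.mem_insert_self a s))
      (Finset.analyticOnNhd_fun_sum s fun i hi => hF i (Finset.mem_insert_of_mem hi)),
      ih fun i hi => hF i (Finset.mem_insert_of_mem hi)]

/-- `diagCoeff` commutes with uniformly convergent series. -/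
theorem hasSum_diagCoeff {ι : Type*} {F : ι → ℂ × ℂ → ℂ} {S : ℂ × ℂ → ℂ} {r : ℝ} (hr : 0 < r)
    (hF : ∀ i, AnalyticOnNhd ℂ (F i) (Metric.ball 0 r))
    (hS : AnalyticOnNhd ℂ S (Metric.ball 0 r))
    (h : TendstoUniformlyOn (fun (s : Finset ι) p => ∑ i ∈ s, F i p) S atTop (Metric.ball 0 r))
    (n m : ℕ) : HasSum (fun i => diagCoeff n m (F i)) (diagCoeff n m S) := by
  obtain ⟨K, hK, hb⟩ := exists_norm_diagCoeff_le hr n m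
  rw [HasSum, SummationFilter.unconditional_filter, Metric.tendsto_nhds]
  intro ε hε
  rw [Metric.tendstoUniformlyOn_iff] at h
  filter_upwards [h (ε / (2 * K)) (by positivity)] with s hs
  have hFs : AnalyticOnNhd ℂ (fun p => ∑ i ∈ s, F i p) (Metric.ball 0 r) :=
    Finset.analyticOnNhd_fun_sum s fun i _ => hF i
  rw [dist_comm, dist_eq_norm, ← diagCoeff_sum s hr (fun i _ => hF i), ← diagCoeff_sub hr hS hFs]
  have := hb (fun p => S p - ∑ i ∈ s, F i p) (ε / (2 * K)) (hS.sub hFs) fun p hp => by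
    rw [← dist_eq_norm]
    exact (hs p hp).le
  calc _ ≤ K * (ε / (2 * K)) := this
    _ = ε / 2 := by field_simp
    _ < ε := by linarith

/-- Cauchy's criterion combined with the Cauchy estimate for finite partial sums; analyticity of the
limit S is not needed. -/
theorem summable_diagCoeff {ι : Type*} {F : ι → ℂ × ℂ → ℂ} {S : ℂ × ℂ → ℂ} {r : ℝ} (hr : 0 < r)
    (hF : ∀ i, AnalyticOnNhd ℂ (F i) (Metric.ball 0 r))
    (h : TendstoUniformlyOn (fun (s : Finset ι) p => ∑ i ∈ s, F i p) S atTop (Metric.ball 0 r))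
    (n m : ℕ) : Summable (fun i => diagCoeff n m (F i)) := by
  classical
  obtain ⟨K, hK, hb⟩ := exists_norm_diagCoeff_le hr n m
  rw [summable_iff_vanishing_norm]
  intro ε hε
  rw [Metric.tendstoUniformlyOn_iff] at h
  obtain ⟨s, hs⟩ := eventually_atTop.1 (h (ε / (4 * K)) (by positivity))
  refine ⟨s, fun t ht => ?_⟩
  have hFt : AnalyticOnNhd ℂ (fun p => ∑ i ∈ t, F i p) (Metric.ball 0 r) :=
    Finset.analyticOnNhd_fun_sum t fun i _ => hF i
  rw [← diagCoeff_sum t hr (fun i _ => hF i)]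
  have := hb (fun p => ∑ i ∈ t, F i p) (ε / (2 * K)) hFt fun p hp => by
    have h1 := hs s le_rfl p hp
    have h2 := hs (s ∪ t) Finset.subset_union_left p hp
    rw [Finset.sum_union ht.symm] at h2
    rw [dist_comm] at h2
    have h3 := dist_triangle (∑ i ∈ s, F i p + ∑ i ∈ t, F i p) (S p) (∑ i ∈ s, F i p)
    rw [dist_eq_norm (_ + _) (∑ i ∈ s, F i p), add_sub_cancel_left] at h3
    have h4 : ε / (2 * K) = ε / (4 * K) + ε / (4 * K) := by field_simp; norm_num
    linarith
  calc _ ≤ K * (ε / (2 * K)) := this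
    _ = ε / 2 := by field_simp
    _ < ε := by linarith

/-- Uniform expansions imply expansions of the coefficients. -/
theorem hasExpansion_diagCoeff {L : ℕ → ℂ × ℂ → ℂ} {P Q : ℂ × ℂ → ℂ} {r : ℝ} (hr : 0 < r)
    (hL : ∀ᶠ N in atTop, AnalyticOnNhd ℂ (L N) (Metric.ball 0 r))
    (hP : AnalyticOnNhd ℂ P (Metric.ball 0 r)) (hQ : AnalyticOnNhd ℂ Q (Metric.ball 0 r))
    (h : TendstoUniformlyOn (fun (N : ℕ) p => (N : ℂ) * (1 / (N : ℂ) * L N p - P p)) Q atTop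
      (Metric.ball 0 r)) (n m : ℕ) :
    HasExpansion (fun N => (N : ℂ)⁻¹ * diagCoeff n m (L N)) (diagCoeff n m P)
      (diagCoeff n m Q) := by
  obtain ⟨K, hK, hb⟩ := exists_norm_diagCoeff_le hr n m
  rw [HasExpansion, Metric.tendsto_nhds]
  intro ε hε
  rw [Metric.tendstoUniformlyOn_iff] at h
  filter_upwards [h (ε / (2 * K)) (by positivity), hL, eventually_ne_atTop 0] with N hN hLN hN0
  have hN0' : (N : ℂ) ≠ 0 := by exact_mod_cast hN0
  have hNP : AnalyticOnNhd ℂ (fun p => (N : ℂ) * P p) (Metric.ball 0 r) :=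
    analyticOnNhd_const.mul hP
  have e : (N : ℂ) * ((N : ℂ)⁻¹ * diagCoeff n m (L N) - diagCoeff n m P) =
      diagCoeff n m (fun p => L N p - (N : ℂ) * P p) := by
    rw [diagCoeff_sub hr hLN hNP, diagCoeff_const_mul _ hr hP]
    field_simp
  have hD : AnalyticOnNhd ℂ (fun p => L N p - (N : ℂ) * P p) (Metric.ball 0 r) := hLN.sub hNP
  rw [dist_comm, dist_eq_norm, e, ← diagCoeff_sub hr hQ hD]
  have := hb (fun p => Q p - (L N p - (N : ℂ) * P p)) (ε / (2 * K))
    (hQ.sub hD) fun p hp => by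
      have := (hN p hp).le
      rw [dist_eq_norm] at this
      have e2 : (N : ℂ) * (1 / (N : ℂ) * L N p - P p) = L N p - (N : ℂ) * P p := by field_simp
      rwa [e2] at this
  calc _ ≤ K * (ε / (2 * K)) := this
    _ = ε / 2 := by field_simp
    _ < ε := by linarith

/-- The derivatives of an exponential on the diagonal. -/
theorem taylorSeries_diagDeriv_exp {L G : ℂ × ℂ → ℂ} {r : ℝ} (hr : 0 < r)
    (hL : AnalyticOnNhd ℂ L (Metric.ball 0 r))
    (hG : ∀ p ∈ Metric.ball (0 : ℂ × ℂ) r, Complex.exp (L p) = G p) (n : ℕ) :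
    taylorSeries (diagDeriv (n + 1) G) = ∑ i ∈ Finset.range (n + 1), (n.choose i : PowerSeries ℂ) *
      (taylorSeries (diagDeriv (i + 1) L) * taylorSeries (diagDeriv (n - i) G)) := by
  have hGa : AnalyticOnNhd ℂ G (Metric.ball 0 r) :=
    (hL.cexp).congr Metric.isOpen_ball fun p hp => hG p hp
  have h : diagDeriv (n + 1) G =ᶠ[𝓝 0] fun z => ∑ i ∈ Finset.range (n + 1),
      (n.choose i : ℂ) * (diagDeriv (i + 1) L z * diagDeriv (n - i) G z) := by
    filter_upwards [eventually_norm_lt hr] with z hz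
    have hzz := mk_mem_ball_zero hz hz
    have hLs := hL.slice hzz
    have hGs := hGa.slice hzz
    -- The recursion is Leibniz' rule applied to G' = L' G.
    have h1 : deriv (fun Y => G (Y, z)) =ᶠ[𝓝 z] (deriv fun Y => L (Y, z)) * fun Y => G (Y, z) := by
      have hzb : Metric.ball (0 : ℂ) r ∈ 𝓝 z := Metric.isOpen_ball.mem_nhds (by simpa using hz)
      filter_upwards [hzb] with Y hY
      have hY' : ‖Y‖ < r := by simpa using hY
      have h2 : (fun Y => G (Y, z)) =ᶠ[𝓝 Y] fun Y => Complex.exp (L (Y, z)) := by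
        filter_upwards [Metric.isOpen_ball.mem_nhds hY] with Y' hY2
        exact (hG _ (mk_mem_ball_zero (by simpa using hY2) hz)).symm
      rw [h2.deriv_eq, deriv_cexp (hL.slice (mk_mem_ball_zero hY' hz)).differentiableAt,
        hG _ (mk_mem_ball_zero hY' hz), Pi.mul_apply, mul_comm]
    rw [diagDeriv, iteratedDeriv_succ', h1.iteratedDeriv_eq,
      iteratedDeriv_mul hLs.deriv.contDiffAt hGs.contDiffAt]
    refine Finset.sum_congr rfl fun i _ => ?_
    rw [← iteratedDeriv_succ', mul_assoc]
    rfl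
  rw [taylorSeries_congr h, taylorSeries_sum]
  · refine Finset.sum_congr rfl fun i _ => ?_
    rw [taylorSeries_const_mul _ ((hL.analyticAt_diagDeriv hr _).fun_mul
      (hGa.analyticAt_diagDeriv hr _)), taylorSeries_mul (hL.analyticAt_diagDeriv hr _)
      (hGa.analyticAt_diagDeriv hr _), map_natCast]
  · intro i _
    exact analyticAt_const.fun_mul ((hL.analyticAt_diagDeriv hr _).fun_mul
      (hGa.analyticAt_diagDeriv hr _))

theorem diagDeriv_shift_add (f g : ℂ → ℂ) (n : ℕ) :
    diagDeriv (n + 1) (fun p => f (1 + p.1) + g p.2) = fun z => iteratedDeriv (n + 1) f (1 + z) := by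
  funext z
  have h : deriv (fun Y => f (1 + Y) + g z) = fun Y => deriv f (1 + Y) := by
    funext Y
    rw [deriv_add_const, deriv_comp_const_add]
  rw [diagDeriv, iteratedDeriv_succ', h, iteratedDeriv_comp_const_add n (deriv f),
    iteratedDeriv_succ']

/-! ### Schur polynomials in terms of the characteristic polynomial of the variables -/

/-- The determinant of the coefficients of the remainders `X ^ e j % p`; for `p = ∏ (X - x i)` it
is the ratio of an alternant and the Vandermonde determinant. -/
noncomputable def schurDet {R : Type*} [CommRing R] {N : ℕ} (e : Fin N → ℕ) (p : Polynomial R) :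
    R :=
  (Matrix.of fun k j : Fin N => (Polynomial.X ^ e j %ₘ p).coeff k).det

-- As x_i is a root of p, the value x_i^(e_j) is that of the remainder of X^(e_j) modulo p, so the
-- alternant factors as the Vandermonde matrix times the matrix of remainder coefficients. The
-- second factor needs no division and depends on the alphabet only through its characteristic
-- polynomial, hence makes sense over rings with zero divisors.
open Polynomial in
theorem det_pow_eq_vandermonde_mul_schurDet {R : Type*} [CommRing R] [Nontrivial R] {N : ℕ}
    (e : Fin N → ℕ) (x : Fin N → R) :
    (Matrix.of fun i j : Fin N => x i ^ e j).det =
      (Matrix.vandermonde x).det * schurDet e (∏ i, (X - C (x i))) := by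
  rw [schurDet, ← Matrix.det_mul]
  congr 1
  ext i j
  have hp : (∏ i, (X - C (x i))).Monic := monic_prod_X_sub_C x Finset.univ
  have hdeg : (X ^ e j %ₘ ∏ i, (X - C (x i))).natDegree < N ∨ N = 0 := by
    rcases Nat.eq_zero_or_pos N with h | h
    · exact Or.inr h
    · left
      have h1 := natDegree_modByMonic_lt (X ^ e j) hp (by
        intro h1
        have := congrArg natDegree h1
        rw [natDegree_finsetProd_X_sub_C_eq_card] at this
        simp at this
        omega)
      rwa [natDegree_finsetProd_X_sub_C_eq_card, Finset.card_univ, Fintype.card_fin] at h1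
  have hdeg : (X ^ e j %ₘ ∏ i, (X - C (x i))).natDegree < N :=
    hdeg.resolve_right (by have := i.2; omega)
  have hroot : (∏ i, (X - C (x i))).IsRoot (x i) := by
    rw [IsRoot, eval_prod]
    exact Finset.prod_eq_zero (Finset.mem_univ i) (by simp)
  have h2 : (X ^ e j %ₘ ∏ i, (X - C (x i))).eval (x i) = x i ^ e j := by
    have h3 := congrArg (eval (x i)) (modByMonic_add_div (X ^ e j) (∏ i, (X - C (x i))))
    rw [eval_add, eval_mul, hroot, zero_mul, add_zero] at h3
    simpa using h3
  rw [Matrix.of_apply, ← h2, eval_eq_sum_range' hdeg, Matrix.mul_apply, Finset.sum_range]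
  refine Finset.sum_congr rfl fun k _ => ?_
  rw [Matrix.vandermonde_apply, Matrix.of_apply, mul_comm]

-- Division by a monic polynomial commutes with ring homomorphisms. This permits both evaluation at
-- numbers and reduction modulo a power of z.
open Polynomial in
theorem map_schurDet {R S : Type*} [CommRing R] [CommRing S] (f : R →+* S) {N : ℕ}
    (e : Fin N → ℕ) {p : Polynomial R} (hp : p.Monic) :
    f (schurDet e p) = schurDet e (p.map f) := by
  rw [schurDet, schurDet, RingHom.map_det]
  congr 1
  ext k j
  simp only [RingHom.mapMatrix_apply, Matrix.map_apply, Matrix.of_apply]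
  rw [← coeff_map, map_modByMonic f hp, Polynomial.map_pow, map_X]

open Polynomial in
/-- The Schur polynomial as a polynomial in the variables. -/
theorem exists_mvPolynomial_schurDet {N : ℕ} (e : Fin N → ℕ) :
    ∃ P : MvPolynomial (Fin N) ℂ, ∀ u : Fin N → ℂ,
      MvPolynomial.eval u P = schurDet e (∏ i, (X - C (u i))) := by
  refine ⟨schurDet e (∏ i, (X - C (MvPolynomial.X i))), fun u => ?_⟩
  rw [map_schurDet _ _ (monic_prod_X_sub_C _ _), Polynomial.map_prod]
  simp

/-! ### Rational Schur functions at points with non-zero coordinates -/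

/-- The shift making the exponents `l.pos` non-negative. -/
def Signature.shift {N : ℕ} (l : Signature N) : ℕ := ∑ j, (l.pos j).natAbs

def Signature.exponent {N : ℕ} (l : Signature N) (j : Fin N) : ℕ := (l.pos j + l.shift).toNat

theorem Signature.coe_exponent {N : ℕ} (l : Signature N) (j : Fin N) :
    (l.exponent j : ℤ) = l.pos j + l.shift := by
  have h : (l.pos j).natAbs ≤ l.shift :=
    Finset.single_le_sum (f := fun j => (l.pos j).natAbs) (fun _ _ => Nat.zero_le _)
      (Finset.mem_univ j)
  rw [Signature.exponent]
  omega

/-- The sign relating the Vandermonde determinant to `∏_{i < j} (u_i - u_j)`. -/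
def vandermondeSign (N : ℕ) : ℂ := ∏ i : Fin N, ∏ _j ∈ Finset.Ioi i, -1

theorem vandermondeSign_ne_zero (N : ℕ) : vandermondeSign N ≠ 0 :=
  Finset.prod_ne_zero_iff.2 fun _ _ => Finset.prod_ne_zero_iff.2 fun _ _ => by norm_num

theorem prod_sub_eq_sign_mul_vandermonde {N : ℕ} (u : Fin N → ℂ) :
    ∏ i : Fin N, ∏ j ∈ Finset.Ioi i, (u i - u j) =
      vandermondeSign N * (Matrix.vandermonde u).det := by
  rw [Matrix.det_vandermonde, vandermondeSign, ← Finset.prod_mul_distrib]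
  refine Finset.prod_congr rfl fun i _ => ?_
  rw [← Finset.prod_mul_distrib]
  refine Finset.prod_congr rfl fun j _ => ?_
  ring

theorem det_zpow_eq {N : ℕ} (l : Signature N) {u : Fin N → ℂ} (hu : ∀ i, u i ≠ 0) :
    (Matrix.of fun i j : Fin N => u i ^ l.pos j).det =
      ((∏ i, u i) ^ l.shift)⁻¹ * (Matrix.of fun i j : Fin N => u i ^ l.exponent j).det := by
  have h : (Matrix.of fun i j : Fin N => u i ^ l.pos j) = Matrix.of fun i j =>
      (u i ^ l.shift)⁻¹ * (Matrix.of fun i j : Fin N => u i ^ l.exponent j) i j := by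
    ext i j
    simp only [Matrix.of_apply]
    rw [← zpow_natCast (u i) (l.exponent j), l.coe_exponent, zpow_add₀ (hu i), zpow_natCast]
    have := pow_ne_zero l.shift (hu i)
    field_simp
  rw [h, Matrix.det_mul_column, ← Finset.prod_pow, Finset.prod_inv_distrib]

/-- The regularized form of the rational Schur function. -/
noncomputable def schurReg {N : ℕ} (l : Signature N) (u : Fin N → ℂ) : ℂ :=
  ((∏ i, u i) ^ l.shift)⁻¹ * schurDet l.exponent (∏ i, (Polynomial.X - Polynomial.C (u i)))

theorem det_zpow_eq_schurReg {N : ℕ} (l : Signature N) {u : Fin N → ℂ} (hu : ∀ i, u i ≠ 0) :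
    (Matrix.of fun i j : Fin N => u i ^ l.pos j).det =
      (Matrix.vandermonde u).det * schurReg l u := by
  rw [det_zpow_eq l hu, det_pow_eq_vandermonde_mul_schurDet, schurReg]
  ring

theorem analyticAt_schurReg {N : ℕ} (l : Signature N) {u : Fin N → ℂ} (hu : ∀ i, u i ≠ 0) :
    AnalyticAt ℂ (schurReg l) u := by
  obtain ⟨P, hP⟩ := exists_mvPolynomial_schurDet l.exponent
  have h1 : ∀ i, AnalyticAt ℂ (fun u : Fin N → ℂ => u i) u := fun i =>
    (ContinuousLinearMap.proj (R := ℂ) (φ := fun _ : Fin N => ℂ) i).analyticAt u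
  have h2 : AnalyticAt ℂ (fun u : Fin N → ℂ => MvPolynomial.eval u P) u :=
    AnalyticOnNhd.eval_mvPolynomial P u (Set.mem_univ u)
  have h3 : schurReg l = fun u => ((∏ i, u i) ^ l.shift)⁻¹ * MvPolynomial.eval u P := by
    funext u
    rw [schurReg, ← hP u]
  have h4 : AnalyticAt ℂ (fun u : Fin N → ℂ => (∏ i, u i) ^ l.shift) u :=
    (Finset.analyticAt_fun_prod Finset.univ fun i _ => h1 i).fun_pow l.shift
  have h5 : (∏ i, u i) ^ l.shift ≠ 0 :=
    pow_ne_zero _ (Finset.prod_ne_zero_iff.2 fun i _ => hu i)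
  have h6 : AnalyticAt ℂ (fun u : Fin N → ℂ => ((∏ i, u i) ^ l.shift)⁻¹) u := h4.fun_inv h5
  have h7 : AnalyticAt ℂ (fun u : Fin N → ℂ => ((∏ i, u i) ^ l.shift)⁻¹ * MvPolynomial.eval u P) u :=
    AnalyticAt.fun_mul h6 h2
  rw [h3]
  exact h7

/-- For small t ≠ 0 the perturbation u_i + t i separates coinciding coordinates and keeps all of
them non-zero. -/
theorem mem_closure_regularPoints {N : ℕ} {u : Fin N → ℂ} (hu : ∀ i, u i ≠ 0) :
    u ∈ closure (regularPoints N) := by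
  have hlim : Tendsto (fun (t : ℂ) (i : Fin N) => u i + t * (i : ℕ)) (𝓝[≠] 0) (𝓝 u) := by
    have h : Continuous (fun (t : ℂ) (i : Fin N) => u i + t * (i : ℕ)) := by fun_prop
    have h2 := h.tendsto 0
    simp only [zero_mul, add_zero] at h2
    exact h2.mono_left nhdsWithin_le_nhds
  refine mem_closure_of_tendsto hlim ?_
  have h1 : ∀ i, ∀ᶠ t : ℂ in 𝓝[≠] 0, u i + t * (i : ℕ) ≠ 0 := fun i => by
    have h : Continuous (fun t : ℂ => u i + t * (i : ℕ)) := by fun_prop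
    exact (h.continuousAt.eventually_ne (by simpa using hu i)).filter_mono nhdsWithin_le_nhds
  have h2 : ∀ i j, i ≠ j → ∀ᶠ t : ℂ in 𝓝[≠] 0, u i + t * (i : ℕ) ≠ u j + t * (j : ℕ) := by
    intro i j hij
    have hij' : ((i : ℕ) : ℂ) - (j : ℕ) ≠ 0 := by
      rw [sub_ne_zero]
      exact_mod_cast Fin.val_injective.ne hij
    by_cases h : u i = u j
    · filter_upwards [self_mem_nhdsWithin] with t ht h3
      rw [h, add_right_inj] at h3
      exact mul_ne_zero (show t ≠ 0 from ht) hij' (by rw [mul_sub, h3, sub_self])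
    · have h3 : Continuous (fun t : ℂ => u i + t * (i : ℕ) - (u j + t * (j : ℕ))) := by fun_prop
      filter_upwards [(h3.continuousAt.eventually_ne (x := 0) (y := 0)
        (by simpa using sub_ne_zero.2 h)).filter_mono nhdsWithin_le_nhds] with t ht
      exact sub_ne_zero.1 ht
  filter_upwards [eventually_all.2 h1, eventually_all.2 fun i => eventually_all.2 fun j =>
    eventually_imp_distrib_left.2 (h2 i j)] with t ht1 ht2
  refine ⟨fun i j hij => ?_, ht1⟩
  by_contra h
  exact ht2 i j h hij

/-- The regularized form is continuous and agrees with the ratio at regular points, which accumulate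
at u. The sign compares the two orderings of the Vandermonde product. -/
theorem schurChar_eq {N : ℕ} (l : Signature N) {u : Fin N → ℂ} (hu : ∀ i, u i ≠ 0) :
    schurChar l u = (vandermondeSign N)⁻¹ * schurReg l u := by
  refine extendFrom_eq (mem_closure_regularPoints hu) ?_
  have h : Tendsto (fun u => (vandermondeSign N)⁻¹ * schurReg l u) (𝓝[regularPoints N] u)
      (𝓝 ((vandermondeSign N)⁻¹ * schurReg l u)) :=
    ((analyticAt_schurReg l hu).continuousAt.tendsto.const_mul _).mono_left nhdsWithin_le_nhds
  refine h.congr' ?_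
  filter_upwards [self_mem_nhdsWithin] with w hw
  have hV : (Matrix.vandermonde w).det ≠ 0 := Matrix.det_vandermonde_ne_zero_iff.2 hw.1
  rw [schurRatio, det_zpow_eq_schurReg l hw.2, prod_sub_eq_sign_mul_vandermonde]
  have := vandermondeSign_ne_zero N
  field_simp

theorem schurChar_div_eq {N : ℕ} (l : Signature N) {u w : Fin N → ℂ} (hu : ∀ i, u i ≠ 0)
    (hw : ∀ i, w i ≠ 0) : schurChar l u / schurChar l w = schurReg l u / schurReg l w := by
  rw [schurChar_eq l hu, schurChar_eq l hw,
    mul_div_mul_left _ _ (inv_ne_zero (vandermondeSign_ne_zero N))]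

/-! ### Determinants -/

theorem Matrix.det_updateRow_eq_sum_adjugate {R n : Type*} [CommRing R] [Fintype n]
    [DecidableEq n] (A : Matrix n n R) (a : n) (b : n → R) :
    (A.updateRow a b).det = ∑ j, A.adjugate j a * b j := by
  rw [← Matrix.cramer_transpose_apply, Matrix.cramer_eq_adjugate_mulVec,
    ← Matrix.adjugate_transpose]
  rfl

/-- Both sides are the trace of adj(A) B. This exchanges operators acting on the variables (rows)
for operations on the exponents (columns). -/
theorem Matrix.sum_det_updateRow_eq_sum_det_updateCol {R n : Type*} [CommRing R] [Fintype n]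
    [DecidableEq n] (A B : Matrix n n R) :
    ∑ a, (A.updateRow a (B a)).det = ∑ j, (A.updateCol j fun i => B i j).det := by
  have h1 : ∀ a, (A.updateRow a (B a)).det = ∑ j, A.adjugate j a * B a j := fun a =>
    A.det_updateRow_eq_sum_adjugate a (B a)
  have h2 : ∀ j, (A.updateCol j fun i => B i j).det = ∑ a, A.adjugate j a * B a j := fun j => by
    rw [← Matrix.cramer_apply, Matrix.cramer_eq_adjugate_mulVec]
    rfl
  simp only [h1, h2]
  exact Finset.sum_comm

theorem Matrix.det_vandermonde_update_zero {R : Type*} [CommRing R] {n : ℕ} (x : Fin (n + 1) → R)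
    (y : R) : (Matrix.vandermonde (Function.update x 0 y)).det *
      ∏ i ∈ Finset.univ.erase 0, (x 0 - x i) =
      (Matrix.vandermonde x).det * ∏ i ∈ Finset.univ.erase 0, (y - x i) := by
  have e : (Finset.univ.erase 0 : Finset (Fin (n + 1))) = Finset.Ioi 0 := by
    ext i
    simp
  have h0 : ∀ (w : R) (i : Fin (n + 1)), i ∈ Finset.Ioi 0 → w - x i = -1 * (x i - w) :=
    fun w i _ => by ring
  rw [e, Finset.prod_congr rfl (h0 y), Finset.prod_congr rfl (h0 (x 0)), Finset.prod_mul_distrib,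
    Finset.prod_mul_distrib, Matrix.det_vandermonde, Matrix.det_vandermonde, Fin.prod_univ_succ,
    Fin.prod_univ_succ]
  have h1 : ∏ j ∈ Finset.Ioi 0, (Function.update x 0 y j - Function.update x 0 y 0) =
      ∏ j ∈ Finset.Ioi 0, (x j - y) := by
    refine Finset.prod_congr rfl fun j hj => ?_
    rw [Function.update_self, Function.update_of_ne (Finset.mem_Ioi.1 hj).ne']
  have h2 : ∀ i : Fin n, ∏ j ∈ Finset.Ioi i.succ,
      (Function.update x 0 y j - Function.update x 0 y i.succ) =
      ∏ j ∈ Finset.Ioi i.succ, (x j - x i.succ) := by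
    intro i
    refine Finset.prod_congr rfl fun j hj => ?_
    have hj' : j ≠ 0 := ((Fin.succ_pos i).trans (Finset.mem_Ioi.1 hj)).ne'
    rw [Function.update_of_ne hj', Function.update_of_ne (Fin.succ_ne_zero i)]
  rw [h1, Finset.prod_congr rfl fun i _ => h2 i]
  ring

theorem Matrix.det_vandermonde_comp_perm {R : Type*} [CommRing R] {n : ℕ} (x : Fin n → R)
    (σ : Equiv.Perm (Fin n)) : (Matrix.vandermonde (x ∘ σ)).det =
      (Equiv.Perm.sign σ : ℤ) * (Matrix.vandermonde x).det := by
  rw [← Matrix.det_permute]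
  rfl

/-- Transposing the indices 0 and a reduces to the case a = 0, and the two signs cancel. With y =
x_a - q the ratio of the products is the Perelomov-Popov weight. -/
theorem Matrix.det_vandermonde_update {R : Type*} [CommRing R] {n : ℕ} (x : Fin n → R)
    (a : Fin n) (y : R) : (Matrix.vandermonde (Function.update x a y)).det *
      ∏ i ∈ Finset.univ.erase a, (x a - x i) =
      (Matrix.vandermonde x).det * ∏ i ∈ Finset.univ.erase a, (y - x i) := by
  obtain ⟨n, rfl⟩ : ∃ m, n = m + 1 := ⟨n - 1, by have := a.2; omega⟩
  set σ := Equiv.swap 0 a with hσ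
  have h := Matrix.det_vandermonde_update_zero (x ∘ σ) y
  have h1 : Function.update (x ∘ σ) 0 y = Function.update x a y ∘ σ := by
    have := Function.update_comp_equiv x σ a y
    rw [this, hσ, Equiv.symm_swap, Equiv.swap_apply_right]
  have h2 : ∀ w, ∏ i ∈ Finset.univ.erase 0, (w - (x ∘ σ) i) =
      ∏ i ∈ Finset.univ.erase a, (w - x i) := by
    intro w
    refine Finset.prod_bij' (fun i _ => σ i) (fun i _ => σ.symm i) ?_ ?_ ?_ ?_ ?_
    · intro i hi
      rw [Finset.mem_erase] at hi ⊢
      refine ⟨fun h => hi.1 ?_, Finset.mem_univ _⟩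
      rw [← σ.symm_apply_apply i, h, hσ, Equiv.symm_swap, Equiv.swap_apply_right]
    · intro i hi
      rw [Finset.mem_erase] at hi ⊢
      refine ⟨fun h => hi.1 ?_, Finset.mem_univ _⟩
      rw [← σ.apply_symm_apply i, h, hσ, Equiv.swap_apply_left]
    · intro i _; exact σ.symm_apply_apply i
    · intro i _; exact σ.apply_symm_apply i
    · intro i _; rfl
  rw [h1, Matrix.det_vandermonde_comp_perm, Matrix.det_vandermonde_comp_perm, h2, h2,
    Function.comp_apply, hσ, Equiv.swap_apply_left, mul_assoc, mul_assoc] at h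
  have hs : ((Equiv.Perm.sign (Equiv.swap 0 a) : ℤ) : R) * (Equiv.Perm.sign (Equiv.swap 0 a) : ℤ) =
      1 := by
    rw [← Int.cast_mul, ← Units.val_mul, Int.units_mul_self]
    simp
  have := congrArg (fun w => ((Equiv.Perm.sign (Equiv.swap 0 a) : ℤ) : R) * w) h
  simpa only [← mul_assoc, hs, one_mul] using this

/-- The determinant of the Taylor coefficients of binomial functions. -/
theorem det_coeff_binomSeries {N : ℕ} (s : Fin N → ℂ) :
    (Matrix.of fun n b : Fin N => PowerSeries.coeff n (binomSeries (s b))).det =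
      (∏ n : Fin N, ((n : ℕ).factorial : ℂ)⁻¹) * (Matrix.vandermonde s).det := by
  -- The n-th coefficient is 1/n! times a monic polynomial of degree n in the exponent, so
  -- triangularity leaves the Vandermonde determinant.
  rw [Matrix.det_eval_matrixOfPolynomials_eq_det_vandermonde s (fun n => descPochhammer ℂ n)
    (fun n => descPochhammer_natDegree ℂ n) (fun n => monic_descPochhammer ℂ n),
    ← Matrix.det_transpose (Matrix.of fun i j : Fin N => Polynomial.eval (s i) _),
    ← Matrix.det_mul_column]
  congr 1
  ext n b
  simp only [Matrix.of_apply, Matrix.transpose_apply]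
  rw [coeff_binomSeries, descPochhammer_eval_eq_prod_range, div_eq_inv_mul]

/-! ### Limits along roots of unity -/

theorem IsPrimitiveRoot.prod_sub_pow_mul {R : Type*} [CommRing R] [IsDomain R] {n : ℕ}
    (hn : 0 < n) {ω : R} (hω : IsPrimitiveRoot ω n) (x y : R) :
    ∏ i : Fin n, (x - ω ^ (i : ℕ) * y) = x ^ n - y ^ n := by
  classical
  rw [hω.pow_sub_pow_eq_prod_sub_mul x y hn]
  have hinj : Function.Injective fun i : Fin n => ω ^ (i : ℕ) := fun i j h =>
    Fin.ext (hω.pow_inj i.2 j.2 h)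
  have h : Polynomial.nthRootsFinset n (1 : R) = Finset.univ.image fun i : Fin n => ω ^ (i : ℕ) := by
    refine (Finset.eq_of_subset_of_card_le ?_ ?_).symm
    · intro w hw
      obtain ⟨i, -, rfl⟩ := Finset.mem_image.1 hw
      rw [Polynomial.mem_nthRootsFinset hn, ← pow_mul, mul_comm, pow_mul, hω.pow_eq_one, one_pow]
    · rw [Finset.card_image_of_injective _ hinj, hω.card_nthRootsFinset, Finset.card_univ,
        Fintype.card_fin]
  rw [h, Finset.prod_image fun i _ j _ h => hinj h]

theorem IsPrimitiveRoot.injective_pow_fin_mul {n : ℕ} {ω : ℂ} (hω : IsPrimitiveRoot ω n) {z : ℂ}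
    (hz : z ≠ 0) : Function.Injective fun i : Fin n => ω ^ (i : ℕ) * z := fun i j h =>
  Fin.ext (hω.pow_inj i.2 j.2 (mul_right_cancel₀ hz h))

/-- Taylor expansion to order N writes the matrix as the Vandermonde matrix times the Taylor
coefficients, plus a remainder with factor (ω^i z)^N = z^N. The inverse of the matrix (ω^(in)) lets
this remainder be absorbed into the coefficient matrix as a perturbation that vanishes at z = 0. -/
theorem tendsto_det_div_vandermonde {N : ℕ} {ω : ℂ} (hω : IsPrimitiveRoot ω N)
    {f : Fin N → ℂ → ℂ} (hf : ∀ b, AnalyticAt ℂ (f b) 0) :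
    Tendsto (fun z => (Matrix.of fun i b : Fin N => f b (ω ^ (i : ℕ) * z)).det /
      (Matrix.vandermonde fun i : Fin N => ω ^ (i : ℕ) * z).det) (𝓝[≠] 0)
      (𝓝 (Matrix.of fun n b : Fin N => PowerSeries.coeff n (taylorSeries (f b))).det) := by
  choose g hg hfg using fun b => (hf b).exists_eq_taylorSeries_add N
  set D : Matrix (Fin N) (Fin N) ℂ := Matrix.vandermonde fun i => ω ^ (i : ℕ) with hD
  have hDu : IsUnit D.det := by
    rw [isUnit_iff_ne_zero]
    refine Matrix.det_vandermonde_ne_zero_iff.2 ?_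
    simpa using hω.injective_pow_fin_mul one_ne_zero
  set A : Matrix (Fin N) (Fin N) ℂ := Matrix.of fun n b =>
    PowerSeries.coeff n (taylorSeries (f b)) with hA
  -- The remainder in the basis of the columns of the Vandermonde matrix; the exponent N - n is
  -- positive for every row index n < N.
  set E : ℂ → Matrix (Fin N) (Fin N) ℂ := fun z => Matrix.of fun n b =>
    z ^ (N - n) * ∑ i, D⁻¹ n i * g b (ω ^ (i : ℕ) * z) with hE
  have hE0 : ContinuousAt (fun z => (A + E z).det) 0 := by
    have h1 : ContinuousAt (fun z => A + E z) 0 := by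
      refine continuousAt_const.add (continuousAt_pi.2 fun n => continuousAt_pi.2 fun b => ?_)
      refine ((continuous_pow _).continuousAt).mul (tendsto_finsetSum _ fun i _ => ?_)
      have h2 : ContinuousAt (g b) (ω ^ (i : ℕ) * 0) := by
        rw [mul_zero]; exact (hg b).continuousAt
      exact (continuousAt_const.mul (ContinuousAt.comp (f := fun z => ω ^ (i : ℕ) * z) h2
        (by fun_prop)))
    exact (Continuous.matrix_det continuous_id).continuousAt.comp h1
  have hEz : E 0 = 0 := by
    ext n b
    simp only [hE, Matrix.of_apply, Matrix.zero_apply]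
    rw [zero_pow (by have := n.2; omega), zero_mul]
  have h := hE0.tendsto
  simp only [hEz, add_zero] at h
  refine (h.mono_left nhdsWithin_le_nhds).congr' ?_
  filter_upwards [self_mem_nhdsWithin] with z hz
  have hV : (Matrix.vandermonde fun i : Fin N => ω ^ (i : ℕ) * z).det ≠ 0 :=
    Matrix.det_vandermonde_ne_zero_iff.2 (hω.injective_pow_fin_mul hz)
  rw [eq_div_iff hV, mul_comm, ← Matrix.det_mul]
  congr 1
  ext i b
  have hrem : ∑ n : Fin N, (ω ^ (i : ℕ) * z) ^ (n : ℕ) * E z n b =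
      (ω ^ (i : ℕ) * z) ^ N * g b (ω ^ (i : ℕ) * z) := by
    have h1 : (D * D⁻¹) = 1 := Matrix.mul_nonsing_inv D hDu
    have h2 : g b (ω ^ (i : ℕ) * z) = ∑ n, D i n * ∑ k, D⁻¹ n k * g b (ω ^ (k : ℕ) * z) := by
      have : (fun i : Fin N => g b (ω ^ (i : ℕ) * z)) =
          D.mulVec (D⁻¹.mulVec fun i : Fin N => g b (ω ^ (i : ℕ) * z)) := by
        rw [Matrix.mulVec_mulVec, h1, Matrix.one_mulVec]
      exact congrFun this i
    have hωN : (ω ^ (i : ℕ)) ^ N = 1 := by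
      rw [← pow_mul, mul_comm, pow_mul, hω.pow_eq_one, one_pow]
    rw [h2, Finset.mul_sum]
    refine Finset.sum_congr rfl fun n _ => ?_
    have hz' : z ^ N = z ^ (n : ℕ) * z ^ (N - n) := by
      rw [← pow_add]; congr 1; have := n.2; omega
    simp only [hE, hD, Matrix.of_apply, Matrix.vandermonde_apply]
    rw [mul_pow _ _ N, hωN, hz', mul_pow]
    ring
  rw [Matrix.mul_apply, Matrix.of_apply, hfg b, ← hrem, Finset.sum_range, ← Finset.sum_add_distrib]
  refine Finset.sum_congr rfl fun n _ => ?_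
  simp only [hA, Matrix.vandermonde_apply, Matrix.add_apply, Matrix.of_apply]
  ring

/-- Averages over roots of unity extract a Taylor coefficient. -/
theorem tendsto_sum_roots_of_unity {n : ℕ} {ω : ℂ} (hω : IsPrimitiveRoot ω (n + 1)) {H : ℂ → ℂ}
    (hH : AnalyticAt ℂ H 0) :
    Tendsto (fun z => ∑ a : Fin (n + 1), H (ω ^ (a : ℕ) * z) /
      (((n + 1 : ℕ) : ℂ) * (ω ^ (a : ℕ) * z) ^ n)) (𝓝[≠] 0)
      (𝓝 (PowerSeries.coeff n (taylorSeries H))) := by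
  obtain ⟨g, hg, hHg⟩ := hH.exists_eq_taylorSeries_add (n + 1)
  have hn0 : ((n + 1 : ℕ) : ℂ) ≠ 0 := by exact_mod_cast n.succ_ne_zero
  have hlim : Tendsto (fun z => PowerSeries.coeff n (taylorSeries H) +
      ∑ a : Fin (n + 1), ω ^ (a : ℕ) * z * g (ω ^ (a : ℕ) * z) / ((n + 1 : ℕ) : ℂ)) (𝓝[≠] 0)
      (𝓝 (PowerSeries.coeff n (taylorSeries H))) := by
    have h1 : ContinuousAt (fun z => PowerSeries.coeff n (taylorSeries H) +
      ∑ a : Fin (n + 1), ω ^ (a : ℕ) * z * g (ω ^ (a : ℕ) * z) / ((n + 1 : ℕ) : ℂ)) 0 := by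
      refine continuousAt_const.add (tendsto_finsetSum _ fun a _ => ?_)
      have h2 : ContinuousAt g (ω ^ (a : ℕ) * 0) := by
        rw [mul_zero]; exact hg.continuousAt
      have h3 : ContinuousAt (fun z => ω ^ (a : ℕ) * z) 0 := by fun_prop
      exact (h3.mul (ContinuousAt.comp (f := fun z => ω ^ (a : ℕ) * z) h2 h3)).div_const _
    have h := h1.tendsto
    simp only [mul_zero, zero_mul, zero_div, Finset.sum_const_zero, add_zero] at h
    exact h.mono_left nhdsWithin_le_nhds
  refine hlim.congr' ?_
  filter_upwards [self_mem_nhdsWithin] with z hz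
  have hz : z ≠ 0 := hz
  have hω0 : ω ≠ 0 := hω.ne_zero n.succ_ne_zero
  have key : ∀ m ∈ Finset.range (n + 1), ∑ a : Fin (n + 1), (ω ^ (a : ℕ) * z) ^ m /
      (((n + 1 : ℕ) : ℂ) * (ω ^ (a : ℕ) * z) ^ n) = if m = n then 1 else 0 := by
    intro m hm
    rw [Finset.mem_range] at hm
    split_ifs with h
    · subst h
      rw [Finset.sum_congr rfl fun a _ => by
        rw [div_mul_cancel_right₀ (pow_ne_zero _ (mul_ne_zero (pow_ne_zero _ hω0) hz))]]
      rw [Finset.sum_const, Finset.card_univ, Fintype.card_fin, nsmul_eq_mul, mul_inv_cancel₀ hn0]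
    -- Since ω^(n+1) = 1, dividing by ω^(an) is multiplying by ω^a; the resulting geometric sum in
    -- ω^(m+1) vanishes for m < n.
    · have h1 : ∀ a : Fin (n + 1), (ω ^ (a : ℕ) * z) ^ m / (((n + 1 : ℕ) : ℂ) *
          (ω ^ (a : ℕ) * z) ^ n) = (ω ^ (m + 1)) ^ (a : ℕ) * (z ^ m / (((n + 1 : ℕ) : ℂ) * z ^ n)) := by
        intro a
        have h2 : ω ^ (a : ℕ) * (ω ^ (a : ℕ)) ^ n = 1 := by
          rw [← pow_succ', ← pow_mul, mul_comm, pow_mul, hω.pow_eq_one, one_pow]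
        have h3 : (ω ^ (a : ℕ)) ^ n ≠ 0 := pow_ne_zero _ (pow_ne_zero _ hω0)
        have h4 : (ω ^ (m + 1)) ^ (a : ℕ) = (ω ^ (a : ℕ)) ^ m * ω ^ (a : ℕ) := by
          rw [← pow_succ, ← pow_mul, ← pow_mul, mul_comm]
        rw [h4, mul_pow, mul_pow, div_eq_iff (mul_ne_zero hn0 (mul_ne_zero h3 (pow_ne_zero _ hz)))]
        have h5 := pow_ne_zero n hz
        field_simp
        linear_combination -h2
      rw [Finset.sum_congr rfl fun a _ => h1 a, ← Finset.sum_mul,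
        Fin.sum_univ_eq_sum_range fun a => (ω ^ (m + 1)) ^ a]
      have h2 : ω ^ (m + 1) ≠ 1 := hω.pow_ne_one_of_pos_of_lt (by omega) (by omega)
      rw [geom_sum_eq h2, ← pow_mul, mul_comm (m + 1), pow_mul, hω.pow_eq_one, one_pow, sub_self,
        zero_div, zero_mul]
  have h6 : ∀ a : Fin (n + 1), H (ω ^ (a : ℕ) * z) / (((n + 1 : ℕ) : ℂ) * (ω ^ (a : ℕ) * z) ^ n) =
      ∑ m ∈ Finset.range (n + 1), PowerSeries.coeff m (taylorSeries H) * ((ω ^ (a : ℕ) * z) ^ m /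
      (((n + 1 : ℕ) : ℂ) * (ω ^ (a : ℕ) * z) ^ n)) +
      ω ^ (a : ℕ) * z * g (ω ^ (a : ℕ) * z) / ((n + 1 : ℕ) : ℂ) := by
    intro a
    have h7 : (ω ^ (a : ℕ) * z) ^ n ≠ 0 := pow_ne_zero _ (mul_ne_zero (pow_ne_zero _ hω0) hz)
    rw [hHg, add_div, Finset.sum_div]
    congr 1
    · exact Finset.sum_congr rfl fun m _ => by ring
    · rw [pow_succ]
      field_simp
  rw [Finset.sum_congr rfl fun a _ => h6 a, Finset.sum_add_distrib, Finset.sum_comm]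
  congr 1
  rw [Finset.sum_congr rfl fun m hm => by rw [← Finset.mul_sum, key m hm]]
  simp

/-! ### Rational Schur functions along roots of unity -/

/-- The point `(1 + Y, 1 + ω z, …, 1 + ω ^ K z, 1, …, 1)`. -/
noncomputable def rootPoint (K N : ℕ) (ω : ℂ) (p : ℂ × ℂ) (i : Fin N) : ℂ :=
  if (i : ℕ) = 0 then 1 + p.1 else if (i : ℕ) ≤ K then 1 + ω ^ (i : ℕ) * p.2 else 1

theorem norm_rootPoint_sub_one_le (K : ℕ) {N : ℕ} {ω : ℂ} (hω : ‖ω‖ = 1) (p : ℂ × ℂ) (i : Fin N) :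
    ‖rootPoint K N ω p i - 1‖ ≤ ‖p‖ := by
  unfold rootPoint
  split_ifs
  · simpa using norm_fst_le p
  · simpa [hω] using norm_snd_le p
  · simp

theorem rootPoint_mem_ball (K : ℕ) {N : ℕ} {ω : ℂ} (hω : ‖ω‖ = 1) {r : ℝ} (hr : 0 < r) {p : ℂ × ℂ}
    (hp : p ∈ Metric.ball (0 : ℂ × ℂ) r) : rootPoint K N ω p ∈ Metric.ball 1 r := by
  rw [Metric.mem_ball, dist_zero_right] at hp
  rw [Metric.mem_ball, dist_eq_norm, pi_norm_lt_iff hr]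
  exact fun i => (norm_rootPoint_sub_one_le K hω p i).trans_lt hp

theorem ne_zero_of_mem_ball_one {N : ℕ} {u : Fin N → ℂ} (hu : u ∈ Metric.ball 1 1) (i : Fin N) :
    u i ≠ 0 := by
  intro h
  rw [Metric.mem_ball, dist_eq_norm, pi_norm_lt_iff one_pos] at hu
  have := hu i
  simp [h] at this

theorem analyticAt_rootPoint (K N : ℕ) (ω : ℂ) (p : ℂ × ℂ) :
    AnalyticAt ℂ (rootPoint K N ω) p := by
  rw [analyticAt_pi_iff]
  intro i
  unfold rootPoint
  split_ifs
  · exact analyticAt_const.fun_add analyticAt_fst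
  · exact analyticAt_const.fun_add (analyticAt_const.fun_mul analyticAt_snd)
  · exact analyticAt_const

/-- A rational Schur function along `rootPoint`. -/
noncomputable def schurSlice (K : ℕ) {N : ℕ} (ω : ℂ) (l : Signature N) (p : ℂ × ℂ) : ℂ :=
  schurReg l (rootPoint K N ω p)

theorem analyticOnNhd_schurSlice (K : ℕ) {N : ℕ} {ω : ℂ} (hω : ‖ω‖ = 1) (l : Signature N) :
    AnalyticOnNhd ℂ (schurSlice K ω l) (Metric.ball 0 1) := fun p hp =>
  AnalyticAt.comp (f := rootPoint K N ω) (analyticAt_schurReg l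
    (ne_zero_of_mem_ball_one (rootPoint_mem_ball K hω one_pos hp))) (analyticAt_rootPoint K N ω p)

/-- Leibniz rule on the diagonal. -/
theorem taylorSeries_diagDeriv_mul {F G : ℂ × ℂ → ℂ} {r : ℝ} (hr : 0 < r)
    (hF : AnalyticOnNhd ℂ F (Metric.ball 0 r)) (hG : AnalyticOnNhd ℂ G (Metric.ball 0 r)) (n : ℕ) :
    taylorSeries (diagDeriv n (fun p => F p * G p)) = ∑ i ∈ Finset.range (n + 1),
      (n.choose i : PowerSeries ℂ) *
        (taylorSeries (diagDeriv i F) * taylorSeries (diagDeriv (n - i) G)) := by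
  have h : diagDeriv n (fun p => F p * G p) =ᶠ[𝓝 0] fun z => ∑ i ∈ Finset.range (n + 1),
      (n.choose i : ℂ) * (diagDeriv i F z * diagDeriv (n - i) G z) := by
    filter_upwards [eventually_norm_lt hr] with z hz
    have hzz := mk_mem_ball_zero hz hz
    have := iteratedDeriv_fun_mul (n := n) (hF.slice hzz).contDiffAt (hG.slice hzz).contDiffAt
    rw [diagDeriv, this]
    exact Finset.sum_congr rfl fun i _ => by rw [mul_assoc]; rfl
  rw [taylorSeries_congr h, taylorSeries_sum]
  · refine Finset.sum_congr rfl fun i _ => ?_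
    rw [taylorSeries_const_mul _ ((hF.analyticAt_diagDeriv hr _).fun_mul
      (hG.analyticAt_diagDeriv hr _)), taylorSeries_mul (hF.analyticAt_diagDeriv hr _)
      (hG.analyticAt_diagDeriv hr _), map_natCast]
  · intro i _
    exact analyticAt_const.fun_mul ((hF.analyticAt_diagDeriv hr _).fun_mul
      (hG.analyticAt_diagDeriv hr _))

/-- The kernel `(Y ^ (n + 1) - z ^ (n + 1)) / (Y - z)`. -/
noncomputable def geomKernel (n : ℕ) (p : ℂ × ℂ) : ℂ :=
  ∑ a ∈ Finset.range (n + 1), p.1 ^ a * p.2 ^ (n - a)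

theorem analyticOnNhd_geomKernel (n : ℕ) (U : Set (ℂ × ℂ)) :
    AnalyticOnNhd ℂ (geomKernel n) U := fun p _ => by
  exact Finset.analyticAt_fun_sum _ fun a _ => (analyticAt_fst.fun_pow a).fun_mul
    (analyticAt_snd.fun_pow _)

theorem geomKernel_self (n : ℕ) (z : ℂ) : geomKernel n (z, z) = ((n + 1 : ℕ) : ℂ) * z ^ n := by
  rw [geomKernel, Finset.sum_congr rfl fun a ha => by
    rw [← pow_add, Nat.add_sub_cancel' (by rw [Finset.mem_range] at ha; omega)]]
  simp

-- The identity is proved for polynomials, where X - z can be cancelled, and then evaluated at Y;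
-- this includes Y = z.
open Polynomial in
theorem prod_erase_sub_eq_geomKernel {n : ℕ} {ω : ℂ} (hω : IsPrimitiveRoot ω (n + 1)) (Y z : ℂ) :
    ∏ i ∈ Finset.univ.erase (0 : Fin (n + 1)), (Y - ω ^ (i : ℕ) * z) = geomKernel n (Y, z) := by
  have hω' : IsPrimitiveRoot (C ω) (n + 1) := hω.map_of_injective C_injective
  have h1 := hω'.prod_sub_pow_mul n.succ_pos X (C z)
  have h2 : (X - C z) * ∏ i ∈ Finset.univ.erase (0 : Fin (n + 1)), (X - C ω ^ (i : ℕ) * C z) =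
      (X - C z) * ∑ a ∈ Finset.range (n + 1), X ^ a * C z ^ (n - a) := by
    rw [mul_comm (X - C z) (∑ a ∈ _, _)]
    have h3 := geom_sum₂_mul X (C z) (n + 1)
    rw [Nat.add_sub_cancel] at h3
    rw [h3, ← h1, ← Finset.mul_prod_erase _ _ (Finset.mem_univ (0 : Fin (n + 1)))]
    simp
  have h4 := congrArg (eval Y) (mul_left_cancel₀ (X_sub_C_ne_zero z) h2)
  simpa [eval_prod, eval_finsetSum, geomKernel] using h4

/-- The hockey-stick identity sums the coefficients (a choose m). This is the origin of the
binomials (N choose m+1) in the moment formula. -/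
theorem diagDeriv_geomKernel (n m : ℕ) (z : ℂ) : diagDeriv m (geomKernel n) z =
    ((m.factorial * (n + 1).choose (m + 1) : ℕ) : ℂ) * z ^ (n - m) := by
  have h1 : ∀ a ∈ Finset.range (n + 1), iteratedDeriv m (fun Y : ℂ => Y ^ a * z ^ (n - a)) z =
      ((m.factorial * a.choose m : ℕ) : ℂ) * z ^ (n - m) := by
    intro a ha
    rw [Finset.mem_range] at ha
    rw [iteratedDeriv_mul_const_field, iteratedDeriv_eq_iterate, iter_deriv_pow,
      ← descPochhammer_eval_eq_prod_range, descPochhammer_eval_eq_descFactorial,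
      Nat.descFactorial_eq_factorial_mul_choose]
    rcases le_or_gt m a with h | h
    · rw [mul_assoc, ← pow_add]
      congr 2
      omega
    · simp [Nat.choose_eq_zero_of_lt h]
  have h2 : ∑ a ∈ Finset.range (n + 1), a.choose m = (n + 1).choose (m + 1) := by
    rw [← Nat.sum_Icc_choose]
    refine (Finset.sum_subset (fun a ha => ?_) fun a ha ha' => ?_).symm
    · rw [Finset.mem_Icc] at ha
      rw [Finset.mem_range]
      omega
    · rw [Finset.mem_Icc] at ha'
      rw [Finset.mem_range] at ha
      exact Nat.choose_eq_zero_of_lt (by omega)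
  rw [diagDeriv]
  simp only [geomKernel]
  rw [iteratedDeriv_fun_sum fun a _ => by fun_prop, Finset.sum_congr rfl h1, ← Finset.sum_mul,
    ← Nat.cast_sum, ← Finset.mul_sum, h2]

/-- Leibniz' rule for the kernel times G: the m-th derivative of the kernel is a multiple of
z^(n-m), so extracting degree n leaves a coefficient of degree m of the rest. -/
theorem coeff_taylorSeries_diagDeriv_geomKernel_mul (q : ℝ) (n p : ℕ) {G : ℂ × ℂ → ℂ}
    (hG : AnalyticOnNhd ℂ G (Metric.ball 0 1)) :
    PowerSeries.coeff n (taylorSeries fun z => (1 + z) ^ ((p : ℂ) - q) *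
      diagDeriv p (fun x => geomKernel n x * G x) z) =
    fallingMoment q (n + 1) p (fun k => taylorSeries (diagDeriv k G)) := by
  have hQ := analyticOnNhd_geomKernel n (Metric.ball (0 : ℂ × ℂ) 1)
  have hQG : AnalyticOnNhd ℂ (fun x => geomKernel n x * G x) (Metric.ball 0 1) := hQ.mul hG
  have hT : ∀ m, taylorSeries (diagDeriv m (geomKernel n)) =
      PowerSeries.C ((m.factorial * (n + 1).choose (m + 1) : ℕ) : ℂ) * PowerSeries.X ^ (n - m) := by
    intro m
    rw [show diagDeriv m (geomKernel n) = _ from funext (diagDeriv_geomKernel n m),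
      taylorSeries_const_mul _ (by fun_prop), taylorSeries_pow (by fun_prop), taylorSeries_id]
  rw [taylorSeries_mul (analyticAt_one_add_cpow _) (hQG.analyticAt_diagDeriv one_pos p),
    taylorSeries_diagDeriv_mul one_pos hQ hG, Finset.mul_sum, map_sum, fallingMoment]
  refine Finset.sum_congr rfl fun m _ => ?_
  rw [hT]
  have e : taylorSeries (fun z => (1 + z) ^ ((p : ℂ) - q)) * ((p.choose m : PowerSeries ℂ) *
      (PowerSeries.C ((m.factorial * (n + 1).choose (m + 1) : ℕ) : ℂ) * PowerSeries.X ^ (n - m) *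
        taylorSeries (diagDeriv (p - m) G))) =
      PowerSeries.C ((p.choose m : ℂ) * ((m.factorial * (n + 1).choose (m + 1) : ℕ) : ℂ)) *
        (PowerSeries.X ^ (n - m) * (binomSeries (p - q) * taylorSeries (diagDeriv (p - m) G))) := by
    simp only [map_mul, map_natCast, binomSeries]
    ring
  rw [e, PowerSeries.coeff_C_mul, PowerSeries.coeff_X_pow_mul', if_pos (Nat.sub_le n m)]
  rcases le_or_gt m n with h | h
  · rw [Nat.sub_sub_self h]
    push_cast
    ring
  · rw [Nat.choose_eq_zero_of_lt (show n + 1 < m + 1 by omega)]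
    simp

/-- The matrix `(1 + ω ^ i z) ^ (l_j)`. -/
noncomputable def nodeMatrix {n : ℕ} (l : Signature (n + 1)) (ω z : ℂ) :
    Matrix (Fin (n + 1)) (Fin (n + 1)) ℂ :=
  Matrix.of fun i j => (1 + ω ^ (i : ℕ) * z) ^ (l.pos j : ℂ)

/-- The image of `nodeMatrix` under the `p`-th order difference operator. -/
noncomputable def nodeMatrixDeriv {n : ℕ} (q : ℝ) (p : ℕ) (l : Signature (n + 1)) (ω z : ℂ) :
    Matrix (Fin (n + 1)) (Fin (n + 1)) ℂ :=
  Matrix.of fun i j => (∏ a ∈ Finset.range p, ((l.pos j : ℂ) - a)) *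
    (1 + ω ^ (i : ℕ) * z) ^ ((l.pos j : ℂ) - q)

theorem one_add_ne_zero_of_norm_lt {z : ℂ} (hz : ‖z‖ < 1) : 1 + z ≠ 0 := by
  intro h
  have : z = -1 := by linear_combination h
  simp [this] at hz

/-- The alternant at (1+Y, 1+ωz, …) is expanded along its first row, the only one depending on Y.
The kernel is the change of the Vandermonde determinant when the first node moves from z to Y, up to
the factor (n+1) z^n. -/
theorem geomKernel_mul_schurSlice {n : ℕ} {ω : ℂ} (hω : IsPrimitiveRoot ω (n + 1))
    (l : Signature (n + 1)) {Y z : ℂ} (hY : ‖Y‖ < 1) (hz : ‖z‖ < 1) :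
    geomKernel n (Y, z) * schurSlice n ω l (Y, z) *
      (Matrix.vandermonde fun i : Fin (n + 1) => ω ^ (i : ℕ) * z).det =
    ((n + 1 : ℕ) : ℂ) * z ^ n *
      ∑ j, (nodeMatrix l ω z).adjugate j 0 * (1 + Y) ^ l.pos j := by
  have hω1 := hω.norm'_eq_one n.succ_ne_zero
  set x : Fin (n + 1) → ℂ := fun i => ω ^ (i : ℕ) * z with hx
  have hx0 : x 0 = z := by simp [hx]
  have h1 := Matrix.det_vandermonde_update_zero x Y
  rw [hx0, prod_erase_sub_eq_geomKernel hω, prod_erase_sub_eq_geomKernel hω, geomKernel_self] at h1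
  have hv : rootPoint n (n + 1) ω (Y, z) = fun i => Function.update x 0 Y i + 1 := by
    funext i
    unfold rootPoint
    rcases eq_or_ne i 0 with rfl | hi
    · simp [add_comm]
    · have hi' : (i : ℕ) ≠ 0 := fun h => hi (Fin.ext h)
      rw [if_neg hi', if_pos (by omega), Function.update_of_ne hi, add_comm]
  have hv0 : ∀ i, rootPoint n (n + 1) ω (Y, z) i ≠ 0 := ne_zero_of_mem_ball_one
    (rootPoint_mem_ball n hω1 one_pos (mk_mem_ball_zero hY hz))
  have h2 := det_zpow_eq_schurReg l hv0
  have h3 : (Matrix.of fun i j => rootPoint n (n + 1) ω (Y, z) i ^ l.pos j) =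
      (nodeMatrix l ω z).updateRow 0 fun j => (1 + Y) ^ l.pos j := by
    ext i j
    rcases eq_or_ne i 0 with rfl | hi
    · simp [rootPoint]
    · rw [Matrix.updateRow_ne hi, nodeMatrix, Matrix.of_apply, Matrix.of_apply, hv]
      dsimp only
      rw [Function.update_of_ne hi, Complex.cpow_intCast, add_comm]
  rw [h3, Matrix.det_updateRow_eq_sum_adjugate] at h2
  rw [h2, schurSlice]
  have h4 : (Matrix.vandermonde (rootPoint n (n + 1) ω (Y, z))).det =
      (Matrix.vandermonde (Function.update x 0 Y)).det := by
    rw [hv, Matrix.det_vandermonde_add]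
  rw [h4]
  linear_combination -schurReg l (rootPoint n (n + 1) ω (Y, z)) * h1

theorem iteratedDeriv_one_add_zpow (m : ℤ) (p : ℕ) (z : ℂ) :
    iteratedDeriv p (fun Y : ℂ => (1 + Y) ^ m) z =
      (∏ a ∈ Finset.range p, ((m : ℂ) - a)) * (1 + z) ^ (m - p) := by
  rw [iteratedDeriv_comp_const_add p (fun Y : ℂ => Y ^ m), iteratedDeriv_eq_iterate]
  exact iter_deriv_zpow m (1 + z) p

/-- The p-th derivative of (1+Y)^l is the falling factorial of l times (1+Y)^(l-p), and the
prefactor (1+z)^(p-q) turns the exponent into l - q. -/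
theorem diagDeriv_geomKernel_mul_schurSlice {n : ℕ} {ω : ℂ} (hω : IsPrimitiveRoot ω (n + 1))
    (l : Signature (n + 1)) (q : ℝ) (p : ℕ) {z : ℂ} (hz : ‖z‖ < 1) :
    (1 + z) ^ ((p : ℂ) - q) * diagDeriv p (fun x => geomKernel n x * schurSlice n ω l x) z *
      (Matrix.vandermonde fun i : Fin (n + 1) => ω ^ (i : ℕ) * z).det =
    ((n + 1 : ℕ) : ℂ) * z ^ n *
      ((nodeMatrix l ω z).updateRow 0 (nodeMatrixDeriv q p l ω z 0)).det := by
  have hω1 := hω.norm'_eq_one n.succ_ne_zero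
  have h1z := one_add_ne_zero_of_norm_lt hz
  have hev : (fun Y => (Matrix.vandermonde fun i : Fin (n + 1) => ω ^ (i : ℕ) * z).det *
      (geomKernel n (Y, z) * schurSlice n ω l (Y, z))) =ᶠ[𝓝 z] fun Y =>
      ((n + 1 : ℕ) : ℂ) * z ^ n * ∑ j, (nodeMatrix l ω z).adjugate j 0 * (1 + Y) ^ l.pos j := by
    have hzb : Metric.ball (0 : ℂ) 1 ∈ 𝓝 z := Metric.isOpen_ball.mem_nhds (by simpa using hz)
    filter_upwards [hzb] with Y hY
    rw [mul_comm]
    exact geomKernel_mul_schurSlice hω l (by simpa using hY) hz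
  have h1 := hev.iteratedDeriv_eq p
  rw [iteratedDeriv_const_mul_field, iteratedDeriv_const_mul_field, iteratedDeriv_fun_sum] at h1
  · have h2 : ∀ j, (1 + z) ^ ((p : ℂ) - q) * iteratedDeriv p
        (fun Y => (nodeMatrix l ω z).adjugate j 0 * (1 + Y) ^ l.pos j) z =
        (nodeMatrix l ω z).adjugate j 0 * nodeMatrixDeriv q p l ω z 0 j := by
      intro j
      rw [iteratedDeriv_const_mul_field, iteratedDeriv_one_add_zpow, nodeMatrixDeriv,
        Matrix.of_apply, Fin.val_zero, pow_zero, one_mul, ← Complex.cpow_intCast]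
      have e : (l.pos j : ℂ) - q = ((p : ℂ) - q) + ((l.pos j - p : ℤ) : ℂ) := by push_cast; ring
      rw [e, Complex.cpow_add _ _ h1z]
      ring
    rw [Matrix.det_updateRow_eq_sum_adjugate, ← Finset.sum_congr rfl fun j _ => h2 j,
      ← Finset.mul_sum, diagDeriv]
    linear_combination (1 + z) ^ ((p : ℂ) - q) * h1
  · intro j _
    have hA : AnalyticAt ℂ (fun Y : ℂ => (1 + Y) ^ l.pos j) z :=
      AnalyticAt.fun_zpow (by fun_prop) h1z
    exact (analyticAt_const.fun_mul hA).contDiffAt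

/-- Replacing z by ω^a z permutes the nodes cyclically and brings the a-th node to the front; the
sign of the permutation occurs in both determinants. -/
theorem diagDeriv_geomKernel_mul_schurSlice_root {n : ℕ} {ω : ℂ} (hω : IsPrimitiveRoot ω (n + 1))
    (l : Signature (n + 1)) (q : ℝ) (p : ℕ) {z : ℂ} (hz : ‖z‖ < 1) (hz0 : z ≠ 0)
    (a : Fin (n + 1)) :
    (1 + ω ^ (a : ℕ) * z) ^ ((p : ℂ) - q) *
        diagDeriv p (fun x => geomKernel n x * schurSlice n ω l x) (ω ^ (a : ℕ) * z) /
        (((n + 1 : ℕ) : ℂ) * (ω ^ (a : ℕ) * z) ^ n) =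
      ((nodeMatrix l ω z).updateRow a (nodeMatrixDeriv q p l ω z a)).det /
        (Matrix.vandermonde fun i : Fin (n + 1) => ω ^ (i : ℕ) * z).det := by
  have hω1 := hω.norm'_eq_one n.succ_ne_zero
  have hω0 : ω ≠ 0 := hω.ne_zero n.succ_ne_zero
  have hn0 : ((n + 1 : ℕ) : ℂ) ≠ 0 := by exact_mod_cast n.succ_ne_zero
  have ha0 : ω ^ (a : ℕ) * z ≠ 0 := mul_ne_zero (pow_ne_zero _ hω0) hz0
  have h := diagDeriv_geomKernel_mul_schurSlice hω l q p (z := ω ^ (a : ℕ) * z)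
    (by simpa [hω1] using hz)
  set σ : Equiv.Perm (Fin (n + 1)) := Equiv.addRight a with hσ
  have hσi : ∀ i : Fin (n + 1), ω ^ (i : ℕ) * (ω ^ (a : ℕ) * z) = ω ^ ((σ i : Fin (n + 1)) : ℕ) * z := by
    intro i
    rw [hσ, Equiv.coe_addRight, Fin.val_add, ← pow_eq_pow_mod _ hω.pow_eq_one, pow_add, mul_assoc]
  have hV : (Matrix.vandermonde fun i : Fin (n + 1) => ω ^ (i : ℕ) * (ω ^ (a : ℕ) * z)).det =
      (Equiv.Perm.sign σ : ℤ) * (Matrix.vandermonde fun i : Fin (n + 1) => ω ^ (i : ℕ) * z).det := by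
    rw [← Matrix.det_vandermonde_comp_perm]
    congr 2
    funext i
    exact hσi i
  have hU : ((nodeMatrix l ω (ω ^ (a : ℕ) * z)).updateRow 0
      (nodeMatrixDeriv q p l ω (ω ^ (a : ℕ) * z) 0)) =
      ((nodeMatrix l ω z).updateRow a (nodeMatrixDeriv q p l ω z a)).submatrix σ id := by
    have hσ0 : σ 0 = a := by simp [hσ]
    ext i j
    rw [Matrix.submatrix_apply, id]
    rcases eq_or_ne i 0 with rfl | hi
    · rw [hσ0, Matrix.updateRow_self, Matrix.updateRow_self]
      simp [nodeMatrixDeriv]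
    · have hi' : σ i ≠ a := fun h => hi (σ.injective (h.trans hσ0.symm))
      rw [Matrix.updateRow_ne hi, Matrix.updateRow_ne hi', nodeMatrix, nodeMatrix, Matrix.of_apply,
        Matrix.of_apply, hσi]
  rw [hV, hU, Matrix.det_permute] at h
  have hs : ((Equiv.Perm.sign σ : ℤ) : ℂ) ≠ 0 := by
    rcases Int.units_eq_one_or (Equiv.Perm.sign σ) with h | h <;> simp [h]
  have hVne : (Matrix.vandermonde fun i : Fin (n + 1) => ω ^ (i : ℕ) * z).det ≠ 0 :=
    Matrix.det_vandermonde_ne_zero_iff.2 (hω.injective_pow_fin_mul hz0)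
  rw [div_eq_div_iff (mul_ne_zero hn0 (pow_ne_zero _ ha0)) hVne]
  refine mul_left_cancel₀ hs ?_
  linear_combination h

theorem tendsto_schurReg {n : ℕ} {ω : ℂ} (hω : IsPrimitiveRoot ω (n + 1))
    (l : Signature (n + 1)) : Tendsto (fun z => (nodeMatrix l ω z).det /
      (Matrix.vandermonde fun i : Fin (n + 1) => ω ^ (i : ℕ) * z).det) (𝓝[≠] 0)
      (𝓝 (schurReg l 1)) := by
  have hω1 := hω.norm'_eq_one n.succ_ne_zero
  have h1 : ContinuousAt (fun z : ℂ => schurReg l fun i => 1 + ω ^ (i : ℕ) * z) 0 := by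
    have h2 : ContinuousAt (fun (z : ℂ) (i : Fin (n + 1)) => 1 + ω ^ (i : ℕ) * z) 0 := by fun_prop
    refine ContinuousAt.comp (g := schurReg l) ?_ h2
    exact (analyticAt_schurReg l (by simp)).continuousAt
  have h2 := h1.tendsto
  simp only [mul_zero, add_zero] at h2
  refine (h2.mono_left nhdsWithin_le_nhds).congr' ?_
  filter_upwards [self_mem_nhdsWithin, (eventually_norm_lt one_pos).filter_mono nhdsWithin_le_nhds]
    with z hz hz1
  have hVne : (Matrix.vandermonde fun i : Fin (n + 1) => ω ^ (i : ℕ) * z).det ≠ 0 :=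
    Matrix.det_vandermonde_ne_zero_iff.2 (hω.injective_pow_fin_mul hz)
  have h3 := det_zpow_eq_schurReg l (u := fun i => 1 + ω ^ (i : ℕ) * z) fun i =>
    one_add_ne_zero_of_norm_lt (by simpa [hω1] using hz1)
  have h4 : (Matrix.vandermonde fun i : Fin (n + 1) => 1 + ω ^ (i : ℕ) * z).det =
      (Matrix.vandermonde fun i : Fin (n + 1) => ω ^ (i : ℕ) * z).det := by
    rw [← Matrix.det_vandermonde_add (fun i : Fin (n + 1) => ω ^ (i : ℕ) * z) 1]
    simp only [add_comm]
  rw [h4] at h3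
  rw [eq_div_iff hVne, mul_comm, ← h3, nodeMatrix]
  simp only [Complex.cpow_intCast]

/-- Complex exponents are allowed because one of them will be shifted by the real number q. -/
theorem tendsto_det_cpow {n : ℕ} {ω : ℂ} (hω : IsPrimitiveRoot ω (n + 1)) (s : Fin (n + 1) → ℂ) :
    Tendsto (fun z => (Matrix.of fun i j : Fin (n + 1) => (1 + ω ^ (i : ℕ) * z) ^ s j).det /
      (Matrix.vandermonde fun i : Fin (n + 1) => ω ^ (i : ℕ) * z).det) (𝓝[≠] 0)
      (𝓝 ((∏ i : Fin (n + 1), ((i : ℕ).factorial : ℂ)⁻¹) * (Matrix.vandermonde s).det)) := by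
  have h := tendsto_det_div_vandermonde hω (f := fun b x => (1 + x) ^ s b)
    fun b => analyticAt_one_add_cpow _
  have h2 := det_coeff_binomSeries s
  unfold binomSeries at h2
  rwa [h2] at h

/-- Weyl's dimension formula, up to sign, obtained by computing one confluent limit in two ways. -/
theorem schurReg_one_eq {n : ℕ} (l : Signature (n + 1)) :
    schurReg l 1 = (∏ i : Fin (n + 1), ((i : ℕ).factorial : ℂ)⁻¹) *
      (Matrix.vandermonde fun j => (l.pos j : ℂ)).det := by
  have hω := Complex.isPrimitiveRoot_exp (n + 1) n.succ_ne_zero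
  exact tendsto_nhds_unique (tendsto_schurReg hω l) (tendsto_det_cpow hω fun j => (l.pos j : ℂ))

theorem schurReg_one_ne_zero {n : ℕ} (l : Signature (n + 1)) : schurReg l 1 ≠ 0 := by
  rw [schurReg_one_eq]
  refine mul_ne_zero (Finset.prod_ne_zero_iff.2 fun i _ =>
    inv_ne_zero (by exact_mod_cast (i : ℕ).factorial_ne_zero))
    (Matrix.det_vandermonde_ne_zero_iff.2 fun i j h => l.pos_injective (by exact_mod_cast h))

theorem det_vandermonde_update_eq_ppWeight {N : ℕ} (q : ℝ) (l : Signature N) (j : Fin N) :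
    (Matrix.vandermonde (Function.update (fun j => (l.pos j : ℂ)) j (l.pos j - q))).det =
      (Matrix.vandermonde fun j => (l.pos j : ℂ)).det * (ppWeight q l j : ℂ) := by
  have h := Matrix.det_vandermonde_update (fun j => (l.pos j : ℂ)) j (l.pos j - q)
  have hne : ∀ i ∈ Finset.univ.erase j, (l.pos j : ℂ) - l.pos i ≠ 0 := fun i hi => by
    rw [sub_ne_zero]
    exact_mod_cast fun h => (Finset.ne_of_mem_erase hi) (l.pos_injective h).symm
  have hP := Finset.prod_ne_zero_iff.2 hne
  rw [ppWeight]
  push_cast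
  rw [Finset.prod_div_distrib, ← mul_div_assoc, eq_div_iff hP, h]
  congr 1
  exact Finset.prod_congr rfl fun i _ => by ring

/-- The moments of the Perelomov-Popov measure in terms of the rational Schur function. -/
theorem sum_fallingFactorial_mul_ppWeight {n : ℕ} {ω : ℂ} (hω : IsPrimitiveRoot ω (n + 1))
    (l : Signature (n + 1)) (q : ℝ) (p : ℕ) :
    (∑ j, (∏ a ∈ Finset.range p, ((l.pos j : ℂ) - a)) * (ppWeight q l j : ℂ)) * schurReg l 1 =
      fallingMoment q (n + 1) p (fun k => taylorSeries (diagDeriv k (schurSlice n ω l))) := by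
  have hω1 := hω.norm'_eq_one n.succ_ne_zero
  have hG := analyticOnNhd_schurSlice n hω1 l
  have hQG : AnalyticOnNhd ℂ (fun x => geomKernel n x * schurSlice n ω l x) (Metric.ball 0 1) :=
    (analyticOnNhd_geomKernel n _).mul hG
  have hH := (analyticAt_one_add_cpow ((p : ℂ) - q)).fun_mul (hQG.analyticAt_diagDeriv one_pos p)
  -- One limit as z → 0 is computed twice: as an average over roots of unity, which is a Taylor
  -- coefficient, and, after exchanging rows for columns, as a combination of confluent alternants
  -- with one shifted exponent.
  have h1 := tendsto_sum_roots_of_unity hω hH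
  rw [coeff_taylorSeries_diagDeriv_geomKernel_mul q n p hG] at h1
  refine tendsto_nhds_unique ?_ h1
  have h2 : Tendsto (fun z => ∑ j, (∏ a ∈ Finset.range p, ((l.pos j : ℂ) - a)) *
      ((Matrix.of fun i b : Fin (n + 1) => (1 + ω ^ (i : ℕ) * z) ^
        (Function.update (fun j => (l.pos j : ℂ)) j (l.pos j - q)) b).det /
      (Matrix.vandermonde fun i : Fin (n + 1) => ω ^ (i : ℕ) * z).det)) (𝓝[≠] 0)
      (𝓝 ((∑ j, (∏ a ∈ Finset.range p, ((l.pos j : ℂ) - a)) * (ppWeight q l j : ℂ)) *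
        schurReg l 1)) := by
    have e : (∑ j, (∏ a ∈ Finset.range p, ((l.pos j : ℂ) - a)) * (ppWeight q l j : ℂ)) *
        schurReg l 1 = ∑ j, (∏ a ∈ Finset.range p, ((l.pos j : ℂ) - a)) *
        ((∏ i : Fin (n + 1), ((i : ℕ).factorial : ℂ)⁻¹) * (Matrix.vandermonde
          (Function.update (fun j => (l.pos j : ℂ)) j (l.pos j - q))).det) := by
      rw [Finset.sum_mul]
      refine Finset.sum_congr rfl fun j _ => ?_
      rw [det_vandermonde_update_eq_ppWeight, schurReg_one_eq]
      ring
    rw [e]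
    exact tendsto_finsetSum _ fun j _ => (tendsto_det_cpow hω _).const_mul _
  refine h2.congr' ?_
  filter_upwards [self_mem_nhdsWithin, (eventually_norm_lt one_pos).filter_mono nhdsWithin_le_nhds]
    with z hz hz1
  rw [Finset.sum_congr rfl fun a _ =>
    diagDeriv_geomKernel_mul_schurSlice_root hω l q p hz1 hz a, ← Finset.sum_div,
    Matrix.sum_det_updateRow_eq_sum_det_updateCol, Finset.sum_div]
  refine Finset.sum_congr rfl fun j _ => ?_
  have e1 : (fun i => nodeMatrixDeriv q p l ω z i j) =
      (∏ a ∈ Finset.range p, ((l.pos j : ℂ) - a)) •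
        fun i : Fin (n + 1) => (1 + ω ^ (i : ℕ) * z) ^ ((l.pos j : ℂ) - q) := rfl
  rw [← mul_div_assoc, e1, Matrix.det_updateCol_smul]
  congr 3
  ext i b
  rcases eq_or_ne b j with rfl | hb
  · rw [Matrix.updateCol_self, Matrix.of_apply, Function.update_self]
  · rw [Matrix.updateCol_ne hb, Matrix.of_apply, Function.update_of_ne hb, nodeMatrix,
      Matrix.of_apply]

/-! ### Truncation of the number of variables -/

/-- The ideal of the polynomials in `(Y, z)` divisible by `z ^ (K + 1)`. -/
noncomputable def truncIdeal (K : ℕ) : Ideal (MvPolynomial (Fin 2) ℂ) :=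
  Ideal.span {MvPolynomial.X 1 ^ (K + 1)}

/-- The coordinates of `rootPoint` as polynomials, with `y` for the first variable. -/
noncomputable def rootPoly (K N : ℕ) (ω : ℂ) (y : MvPolynomial (Fin 2) ℂ) (i : Fin N) :
    MvPolynomial (Fin 2) ℂ :=
  if (i : ℕ) = 0 then 1 + y else
    if (i : ℕ) ≤ K then 1 + MvPolynomial.C ω ^ (i : ℕ) * MvPolynomial.X 1 else 1

theorem eval_rootPoly (K N : ℕ) (ω : ℂ) (y : MvPolynomial (Fin 2) ℂ) (p : ℂ × ℂ) (i : Fin N) :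
    MvPolynomial.eval ![p.1, p.2] (rootPoly K N ω y i) =
      rootPoint K N ω (MvPolynomial.eval ![p.1, p.2] y, p.2) i := by
  unfold rootPoly rootPoint
  split_ifs <;> simp

-- The extra factor X - (1+z) supplies the missing root, so that the product over the K+1 roots of
-- unity is (X-1)^(K+1) - z^(K+1).
open Polynomial in
theorem mul_prod_sub_rootPoly {K n : ℕ} (hK : K ≤ n) {ω : ℂ} (hω : IsPrimitiveRoot ω (K + 1))
    (y : MvPolynomial (Fin 2) ℂ) :
    (X - C (1 + MvPolynomial.X 1)) * ∏ i : Fin (n + 1), (X - C (rootPoly K (n + 1) ω y i)) =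
      (X - C (1 + y)) * (((X - 1) ^ (K + 1) - C (MvPolynomial.X 1) ^ (K + 1)) *
        (X - 1) ^ (n - K)) := by
  have hω' : IsPrimitiveRoot (C (MvPolynomial.C ω : MvPolynomial (Fin 2) ℂ)) (K + 1) :=
    (hω.map_of_injective (MvPolynomial.C_injective _ _)).map_of_injective C_injective
  rw [← hω'.prod_sub_pow_mul K.succ_pos]
  obtain ⟨d, rfl⟩ := Nat.exists_eq_add_of_le hK
  rw [Nat.add_sub_cancel_left,
    Fin.prod_univ_eq_prod_range (fun i => (X - 1 - C (MvPolynomial.C ω) ^ i *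
      C (MvPolynomial.X 1 : MvPolynomial (Fin 2) ℂ))) (K + 1)]
  obtain ⟨g, hg⟩ : ∃ g : ℕ → Polynomial (MvPolynomial (Fin 2) ℂ), ∀ i, g i =
      if i = 0 then X - C (1 + y) else if i ≤ K then X - 1 - C (MvPolynomial.C ω) ^ i *
      C (MvPolynomial.X 1 : MvPolynomial (Fin 2) ℂ) else X - 1 := ⟨_, fun _ => rfl⟩
  have e : ∀ i : Fin (K + d + 1), X - C (rootPoly K (K + d + 1) ω y i) = g i := by
    intro i
    rw [hg]
    unfold rootPoly
    split_ifs
    · rfl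
    · rw [C_add, C_1, C_mul, C_pow, sub_sub]
    · rw [C_1]
  rw [Finset.prod_congr rfl fun i _ => e i, Fin.prod_univ_eq_prod_range g (K + d + 1),
    show K + d + 1 = (K + 1) + d by ring, Finset.prod_range_add _ (K + 1) d,
    Finset.prod_range_succ', Finset.prod_range_succ' _ K]
  have h1 : ∏ i ∈ Finset.range K, g (i + 1) = ∏ i ∈ Finset.range K, (X - 1 - C (MvPolynomial.C ω) ^ (i + 1) *
      C (MvPolynomial.X 1 : MvPolynomial (Fin 2) ℂ)) := by
    refine Finset.prod_congr rfl fun i hi => ?_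
    rw [Finset.mem_range] at hi
    rw [hg, if_neg (by omega), if_pos (by omega)]
  have h2 : ∏ i ∈ Finset.range d, g (K + 1 + i) = (X - 1) ^ d := by
    rw [Finset.prod_congr rfl fun i _ => by rw [hg, if_neg (by omega), if_neg (by omega)]]
    simp
  rw [h1, h2, hg, if_pos rfl, pow_zero, one_mul, C_add, C_1]
  ring

-- Modulo z^(L+1) with L ≤ K the power z^(K+1) disappears, and what remains depends neither on K nor
-- on the root of unity.
open Polynomial in
theorem mul_prod_sub_mk_rootPoly {L K n : ℕ} (hLK : L ≤ K) (hK : K ≤ n) {ω : ℂ}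
    (hω : IsPrimitiveRoot ω (K + 1)) (y : MvPolynomial (Fin 2) ℂ) :
    (X - C (Ideal.Quotient.mk (truncIdeal L) (1 + MvPolynomial.X 1))) *
      ∏ i : Fin (n + 1), (X - C (Ideal.Quotient.mk (truncIdeal L) (rootPoly K (n + 1) ω y i))) =
      (X - C (Ideal.Quotient.mk (truncIdeal L) (1 + y))) * (X - 1) ^ (n + 1) := by
  have h := congrArg (Polynomial.map (Ideal.Quotient.mk (truncIdeal L)))
    (mul_prod_sub_rootPoly hK hω y)
  have hz : Ideal.Quotient.mk (truncIdeal L) (MvPolynomial.X 1) ^ (K + 1) = 0 := by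
    rw [← map_pow, Ideal.Quotient.eq_zero_iff_mem, truncIdeal, Ideal.mem_span_singleton]
    exact pow_dvd_pow _ (by omega)
  simp only [Polynomial.map_mul, Polynomial.map_prod, Polynomial.map_sub, Polynomial.map_pow,
    map_X, map_C, Polynomial.map_one] at h
  rw [← C_pow, hz, C_0, sub_zero, ← pow_add, show K + 1 + (n - K) = n + 1 by omega] at h
  exact h

theorem analyticOnNhd_eval_pair (D : MvPolynomial (Fin 2) ℂ) (U : Set (ℂ × ℂ)) :
    AnalyticOnNhd ℂ (fun p : ℂ × ℂ => MvPolynomial.eval ![p.1, p.2] D) U := by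
  intro p _
  have h : AnalyticAt ℂ (fun p : ℂ × ℂ => ![p.1, p.2]) p := by
    rw [analyticAt_pi_iff]
    intro i
    fin_cases i
    · exact analyticAt_fst
    · exact analyticAt_snd
  exact (AnalyticOnNhd.eval_mvPolynomial D _ (Set.mem_univ _)).comp h

open Polynomial in
/-- If two families of polynomials agree as alphabets modulo `z ^ (K + 1)`, then so do the
rational Schur functions. -/
theorem exists_schurReg_sub_eq {N : ℕ} (l : Signature N) {K : ℕ}
    {a b : Fin N → MvPolynomial (Fin 2) ℂ}
    (h : ∏ i, (X - C (Ideal.Quotient.mk (truncIdeal K) (a i))) =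
      ∏ i, (X - C (Ideal.Quotient.mk (truncIdeal K) (b i)))) {U : Set (ℂ × ℂ)}
    (ha : ∀ p ∈ U, ∀ i, MvPolynomial.eval ![p.1, p.2] (a i) ≠ 0)
    (hb : ∀ p ∈ U, ∀ i, MvPolynomial.eval ![p.1, p.2] (b i) ≠ 0) :
    ∃ D : ℂ × ℂ → ℂ, AnalyticOnNhd ℂ D U ∧ ∀ p ∈ U,
      schurReg l (fun i => MvPolynomial.eval ![p.1, p.2] (a i)) -
        schurReg l (fun i => MvPolynomial.eval ![p.1, p.2] (b i)) = p.2 ^ (K + 1) * D p := by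
  set π := Ideal.Quotient.mk (truncIdeal K)
  have hprod : π (∏ i, a i) = π (∏ i, b i) := by
    have h1 := congrArg (eval 0) h
    have h0 : ∀ c : Fin N → MvPolynomial (Fin 2) ℂ ⧸ truncIdeal K,
        ∏ i, -c i = (-1) ^ N * ∏ i, c i := fun c => by
      rw [Finset.prod_congr rfl fun i _ => neg_eq_neg_one_mul (c i), Finset.prod_mul_distrib]
      simp
    simp only [eval_prod, eval_sub, eval_X, eval_C, zero_sub, h0] at h1
    rw [map_prod, map_prod]
    exact (isUnit_neg_one.pow N).mul_right_inj.1 h1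
  have hS : ∀ c : Fin N → MvPolynomial (Fin 2) ℂ, π (schurDet l.exponent (∏ i, (X - C (c i)))) =
      schurDet l.exponent (∏ i, (X - C (π (c i)))) := fun c => by
    rw [map_schurDet π _ (monic_prod_X_sub_C c Finset.univ), Polynomial.map_prod]
    simp
  have hev : ∀ (c : Fin N → MvPolynomial (Fin 2) ℂ) (p : ℂ × ℂ),
      MvPolynomial.eval ![p.1, p.2] (schurDet l.exponent (∏ i, (X - C (c i)))) =
      schurDet l.exponent (∏ i, (X - C (MvPolynomial.eval ![p.1, p.2] (c i)))) := fun c p => by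
    rw [map_schurDet _ _ (monic_prod_X_sub_C c Finset.univ), Polynomial.map_prod]
    simp
  -- The difference is put over a common denominator; its numerator vanishes in the quotient ring
  -- because both ingredients depend only on the characteristic polynomial.
  have hmem : schurDet l.exponent (∏ i, (X - C (a i))) * (∏ i, b i) ^ l.shift -
      schurDet l.exponent (∏ i, (X - C (b i))) * (∏ i, a i) ^ l.shift ∈ truncIdeal K := by
    rw [← Ideal.Quotient.eq_zero_iff_mem]
    change π _ = 0
    rw [map_sub, map_mul, map_mul, map_pow, map_pow, hS, hS, h, hprod, sub_self]
  rw [truncIdeal, Ideal.mem_span_singleton] at hmem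
  obtain ⟨D, hD⟩ := hmem
  have hA : ∀ p ∈ U, MvPolynomial.eval ![p.1, p.2] (∏ i, a i) ≠ 0 := fun p hp => by
    rw [map_prod]
    exact Finset.prod_ne_zero_iff.2 fun i _ => ha p hp i
  have hB : ∀ p ∈ U, MvPolynomial.eval ![p.1, p.2] (∏ i, b i) ≠ 0 := fun p hp => by
    rw [map_prod]
    exact Finset.prod_ne_zero_iff.2 fun i _ => hb p hp i
  refine ⟨fun p => MvPolynomial.eval ![p.1, p.2] D / (MvPolynomial.eval ![p.1, p.2] (∏ i, a i) ^
    l.shift * MvPolynomial.eval ![p.1, p.2] (∏ i, b i) ^ l.shift), fun p hp => ?_, fun p hp => ?_⟩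
  · exact AnalyticAt.fun_div (analyticOnNhd_eval_pair D U p hp)
      (((analyticOnNhd_eval_pair _ U p hp).fun_pow _).fun_mul
        ((analyticOnNhd_eval_pair _ U p hp).fun_pow _))
      (mul_ne_zero (pow_ne_zero _ (hA p hp)) (pow_ne_zero _ (hB p hp)))
  · have h1 := congrArg (MvPolynomial.eval ![p.1, p.2]) hD
    have hA' := pow_ne_zero l.shift (hA p hp)
    have hB' := pow_ne_zero l.shift (hB p hp)
    rw [map_sub, map_mul, map_mul, map_pow, map_pow, map_mul, map_pow, MvPolynomial.eval_X, hev,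
      hev] at h1
    rw [schurReg, schurReg, ← map_prod, ← map_prod]
    rw [← mul_div_assoc, eq_div_iff (mul_ne_zero hA' hB')]
    have h2 : p.2 ^ (K + 1) * MvPolynomial.eval ![p.1, p.2] D = _ := h1.symm
    rw [h2]
    field_simp

/-- The factor z^(K+1) is constant for derivatives in Y, so it survives the restriction to Y = z. -/
theorem diagCoeff_pow_mul {K : ℕ} {F G D : ℂ × ℂ → ℂ} {r : ℝ} (hr : 0 < r)
    (hF : AnalyticOnNhd ℂ F (Metric.ball 0 r)) (hG : AnalyticOnNhd ℂ G (Metric.ball 0 r))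
    (hD : AnalyticOnNhd ℂ D (Metric.ball 0 r))
    (h : ∀ p ∈ Metric.ball (0 : ℂ × ℂ) r, F p - G p = p.2 ^ (K + 1) * D p) (k : ℕ) {m : ℕ}
    (hm : m ≤ K) : diagCoeff k m F = diagCoeff k m G := by
  rw [← sub_eq_zero, ← diagCoeff_sub hr hF hG, diagCoeff]
  have h1 : diagDeriv k (fun p => F p - G p) =ᶠ[𝓝 0] fun z => z ^ (K + 1) * diagDeriv k D z := by
    filter_upwards [eventually_norm_lt hr] with z hz
    have h2 : (fun Y => F (Y, z) - G (Y, z)) =ᶠ[𝓝 z] fun Y => z ^ (K + 1) * D (Y, z) := by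
      filter_upwards [Metric.isOpen_ball.mem_nhds
        (show z ∈ Metric.ball (0 : ℂ) r by simpa using hz)] with Y hY
      exact h (Y, z) (mk_mem_ball_zero (by simpa using hY) hz)
    rw [diagDeriv, h2.iteratedDeriv_eq, iteratedDeriv_const_mul_field]
    rfl
  rw [taylorSeries_congr h1]
  exact coeff_taylorSeries_pow_mul (hD.analyticAt_diagDeriv hr k) (by omega)

-- The two alphabets have the same characteristic polynomial modulo z^(K+1), so the expansions agree
-- up to degree K. This replaces all the variables by K+1 of them.
open Polynomial in
theorem diagCoeff_schurSlice_eq {n K : ℕ} (hK : K ≤ n) {ω η : ℂ} (hω : IsPrimitiveRoot ω (n + 1))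
    (hη : IsPrimitiveRoot η (K + 1)) (l : Signature (n + 1)) (k : ℕ) {m : ℕ} (hm : m ≤ K) :
    diagCoeff k m (schurSlice n ω l) = diagCoeff k m (schurSlice K η l) := by
  have hω1 := hω.norm'_eq_one n.succ_ne_zero
  have hη1 := hη.norm'_eq_one K.succ_ne_zero
  have h1 := mul_prod_sub_mk_rootPoly (L := K) hK le_rfl hω (MvPolynomial.X 0)
  rw [← mul_prod_sub_mk_rootPoly le_rfl hK hη (MvPolynomial.X 0)] at h1
  -- The quotient ring has zero divisors; the linear factor can be cancelled because it is monic.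
  have h2 := (monic_X_sub_C _).isRegular.left h1
  have hne : ∀ {M : ℕ} {ζ : ℂ}, ‖ζ‖ = 1 → ∀ p ∈ Metric.ball (0 : ℂ × ℂ) 1, ∀ i : Fin (n + 1),
      MvPolynomial.eval ![p.1, p.2] (rootPoly M (n + 1) ζ (MvPolynomial.X 0) i) ≠ 0 := by
    intro M ζ hζ p hp i
    rw [eval_rootPoly]
    exact ne_zero_of_mem_ball_one (rootPoint_mem_ball M hζ one_pos (by simpa using hp)) i
  obtain ⟨D, hD, hD'⟩ := exists_schurReg_sub_eq l h2 (hne hω1) (hne hη1)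
  refine diagCoeff_pow_mul one_pos (analyticOnNhd_schurSlice n hω1 l)
    (analyticOnNhd_schurSlice K hη1 l) hD (fun p hp => ?_) k hm
  have h3 := hD' p hp
  simp only [eval_rootPoly] at h3
  simpa [schurSlice] using h3

-- On the diagonal Y = z the alphabet is a complete set of roots of unity, so modulo z^(K+1) it is
-- indistinguishable from the alphabet 1, …, 1.
open Polynomial in
theorem diagCoeff_zero_schurSlice {n K : ℕ} (hK : K ≤ n) {η : ℂ}
    (hη : IsPrimitiveRoot η (K + 1)) (l : Signature (n + 1)) {m : ℕ} (hm : m ≤ K) :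
    diagCoeff 0 m (schurSlice K η l) =
      PowerSeries.coeff m (1 : PowerSeries ℂ) * schurReg l 1 := by
  have hη1 := hη.norm'_eq_one K.succ_ne_zero
  have h1 := mul_prod_sub_mk_rootPoly (L := K) le_rfl hK hη (MvPolynomial.X 1)
  have h2 := (monic_X_sub_C _).isRegular.left h1
  have h3 : (X - 1) ^ (n + 1) = ∏ i : Fin (n + 1), (X - C (Ideal.Quotient.mk (truncIdeal K)
      ((fun _ => 1 : Fin (n + 1) → MvPolynomial (Fin 2) ℂ) i))) := by
    simp
  rw [h3] at h2
  obtain ⟨D, hD, hD'⟩ := exists_schurReg_sub_eq l h2 (U := Metric.ball 0 1) (fun p hp i => by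
    rw [eval_rootPoly]
    refine ne_zero_of_mem_ball_one (rootPoint_mem_ball K hη1 one_pos ?_) i
    rw [Metric.mem_ball, dist_zero_right] at hp
    simpa [Prod.norm_def] using (norm_snd_le p).trans_lt hp) (fun p hp i => by simp)
  have hF : AnalyticOnNhd ℂ (fun p : ℂ × ℂ => schurSlice K η l (p.2, p.2)) (Metric.ball 0 1) := by
    intro p hp
    refine (analyticOnNhd_schurSlice K hη1 l (p.2, p.2) ?_).comp
      (f := fun p : ℂ × ℂ => (p.2, p.2)) (analyticAt_snd.prod analyticAt_snd)
    rw [Metric.mem_ball, dist_zero_right] at hp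
    simpa [Prod.norm_def] using (norm_snd_le p).trans_lt hp
  have h4 := diagCoeff_pow_mul one_pos hF analyticOnNhd_const hD (G := fun _ => schurReg l 1)
    (fun p hp => by
      have h5 := hD' p hp
      simp only [eval_rootPoly] at h5
      simpa [schurSlice, Pi.one_def] using h5) 0 hm
  have h5 : diagDeriv 0 (fun p : ℂ × ℂ => schurSlice K η l (p.2, p.2)) =
      diagDeriv 0 (schurSlice K η l) := by
    funext z
    simp [diagDeriv]
  have h6 : diagDeriv 0 (fun _ => schurReg l 1) = fun _ => schurReg l 1 := by
    funext z
    simp [diagDeriv]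
  rw [diagCoeff, h5, diagCoeff, h6, taylorSeries_const] at h4
  rw [diagCoeff, h4, PowerSeries.coeff_C, PowerSeries.coeff_one]
  simp

theorem fallingMoment_congr (q : ℝ) (N p : ℕ) {G G' : ℕ → PowerSeries ℂ}
    (h : ∀ k, ∀ m ≤ p, PowerSeries.coeff m (G k) = PowerSeries.coeff m (G' k)) :
    fallingMoment q N p G = fallingMoment q N p G' := by
  refine Finset.sum_congr rfl fun m hm => ?_
  rw [Finset.mem_range] at hm
  congr 2
  rw [PowerSeries.coeff_mul, PowerSeries.coeff_mul]
  refine Finset.sum_congr rfl fun x hx => ?_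
  rw [h _ _ (by have := Finset.HasAntidiagonal.mem_antidiagonal.1 hx; omega)]

/-- The moments of the Perelomov-Popov measure in terms of the rational Schur function in finitely
many variables. -/
theorem sum_fallingFactorial_mul_ppWeight_of_le {n K : ℕ} (hK : K ≤ n) {η : ℂ}
    (hη : IsPrimitiveRoot η (K + 1)) (l : Signature (n + 1)) (q : ℝ) {p : ℕ}
    (hp : p ≤ K ∨ K = n) :
    (∑ j, (∏ a ∈ Finset.range p, ((l.pos j : ℂ) - a)) * (ppWeight q l j : ℂ)) * schurReg l 1 =
      fallingMoment q (n + 1) p (fun k => taylorSeries (diagDeriv k (schurSlice K η l))) := by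
  rcases hp with hp | rfl
  · rw [sum_fallingFactorial_mul_ppWeight (Complex.isPrimitiveRoot_exp (n + 1) n.succ_ne_zero)]
    exact fallingMoment_congr _ _ _ fun k m hm =>
      diagCoeff_schurSlice_eq hK (Complex.isPrimitiveRoot_exp (n + 1) n.succ_ne_zero) hη l k
        (hm.trans hp)
  · exact sum_fallingFactorial_mul_ppWeight hη l q p

/-! ### Moments of the averaged Perelomov-Popov measures -/

theorem pow_eq_sum_stirlingSecond {R : Type*} [CommRing R] (x : R) (k : ℕ) :
    x ^ k = ∑ p ∈ Finset.range (k + 1), (k.stirlingSecond p : R) *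
      ∏ a ∈ Finset.range p, (x - a) := by
  induction k with
  | zero => simp
  | succ k ih =>
    have h1 : ∀ p : ℕ, (∏ a ∈ Finset.range p, (x - (a : R))) * x =
        (∏ a ∈ Finset.range (p + 1), (x - (a : R))) +
          (p : R) * ∏ a ∈ Finset.range p, (x - (a : R)) := by
      intro p
      rw [Finset.prod_range_succ]
      ring
    have h2 : ∑ p ∈ Finset.range (k + 1), (k.stirlingSecond p : R) * ((p : R) *
        ∏ a ∈ Finset.range p, (x - (a : R))) = ∑ p ∈ Finset.range (k + 1),
        (((p + 1) * k.stirlingSecond (p + 1) : ℕ) : R) *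
          ∏ a ∈ Finset.range (p + 1), (x - (a : R)) := by
      rw [Finset.sum_range_succ', Finset.sum_range_succ _ k,
        Nat.stirlingSecond_eq_zero_of_lt (show k < k + 1 by omega)]
      simp only [Nat.cast_zero, zero_mul, mul_zero, add_zero]
      refine Finset.sum_congr rfl fun p _ => ?_
      push_cast
      ring
    rw [pow_succ, ih, Finset.sum_mul, Finset.sum_congr rfl fun p _ => by rw [mul_assoc, h1, mul_add],
      Finset.sum_add_distrib, h2, ← Finset.sum_add_distrib, Finset.sum_range_succ' _ (k + 1)]
    rw [Nat.stirlingSecond_succ_zero]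
    simp only [Nat.cast_zero, zero_mul, add_zero]
    refine Finset.sum_congr rfl fun p _ => ?_
    rw [Nat.stirlingSecond_succ_succ]
    push_cast
    ring

/-- The moment `∑ w_i (λ_i + N - i) ^ k`. -/
noncomputable def ppMoment (q : ℝ) {N : ℕ} (l : Signature N) (k : ℕ) : ℝ :=
  ∑ i, ppWeight q l i * (l.pos i : ℝ) ^ k

theorem coe_ppMoment_eq_sum (q : ℝ) {N : ℕ} (l : Signature N) (k : ℕ) :
    (ppMoment q l k : ℂ) = ∑ p ∈ Finset.range (k + 1), (k.stirlingSecond p : ℂ) *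
      ∑ j, (∏ a ∈ Finset.range p, ((l.pos j : ℂ) - a)) * (ppWeight q l j : ℂ) := by
  rw [ppMoment]
  push_cast
  rw [Finset.sum_congr rfl fun p _ => Finset.mul_sum _ _ _, Finset.sum_comm]
  refine Finset.sum_congr rfl fun j _ => ?_
  rw [pow_eq_sum_stirlingSecond, Finset.mul_sum]
  exact Finset.sum_congr rfl fun p _ => by ring

instance (N : ℕ) : Countable (Signature N) :=
  inferInstanceAs (Countable {l : Fin N → ℤ // Antitone l})

theorem integrable_smul_ppMeasure {N : ℕ} (ρ : PMF (Signature N)) (q : ℝ) (l : Signature N)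
    (f : ℝ → ℝ) : Integrable f (ρ l • ppMeasure q l) := by
  refine Integrable.smul_measure ?_ (ρ.apply_ne_top l)
  rw [ppMeasure, integrable_finsetSum_measure]
  intro i _
  exact (integrable_dirac (by simp)).smul_measure ENNReal.ofReal_ne_top

theorem integral_smul_ppMeasure {q : ℝ} (hq : q ∈ Set.Icc (-1 : ℝ) 1) {N : ℕ}
    (ρ : PMF (Signature N)) (l : Signature N) (f : ℝ → ℝ) :
    ∫ t, f t ∂(ρ l • ppMeasure q l) =
      (ρ l).toReal * ∑ i, 1 / (N : ℝ) * ppWeight q l i * f ((l.pos i : ℝ) / N) := by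
  rw [integral_smul_measure, ppMeasure, integral_finsetSum_measure, smul_eq_mul]
  · congr 1
    refine Finset.sum_congr rfl fun i _ => ?_
    rw [integral_smul_measure, integral_dirac, smul_eq_mul, ENNReal.toReal_ofReal]
    exact mul_nonneg (by positivity) (ppWeight_nonneg hq l i)
  · intro i _
    exact (integrable_dirac (by simp)).smul_measure ENNReal.ofReal_ne_top

theorem sum_ppWeight_mul_pow (q : ℝ) {N : ℕ} (l : Signature N) (k : ℕ) :
    ∑ i, 1 / (N : ℝ) * ppWeight q l i * ((l.pos i : ℝ) / N) ^ k =
      (N : ℝ)⁻¹ ^ (k + 1) * ppMoment q l k := by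
  rw [ppMoment, Finset.mul_sum]
  refine Finset.sum_congr rfl fun i _ => ?_
  rw [div_pow, div_eq_mul_inv, div_eq_mul_inv, ← inv_pow]
  ring

/-- Absolute moments are dominated by even ones through |t|^k ≤ 1 + t^(2k), using that the weights
are non-negative. -/
theorem integrable_pow_meanPP {q : ℝ} (hq : q ∈ Set.Icc (-1 : ℝ) 1) {N : ℕ}
    {ρ : PMF (Signature N)} (h : ∀ k, Summable fun l => (ρ l).toReal * ppMoment q l k) (k : ℕ) :
    Integrable (fun t : ℝ => t ^ k) (meanPP q ρ) := by
  refine integrable_sum_measure (fun l => integrable_smul_ppMeasure ρ q l _) ?_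
  refine Summable.of_nonneg_of_le (f := fun l => (N : ℝ)⁻¹ ^ (0 + 1) *
    ((ρ l).toReal * ppMoment q l 0) + (N : ℝ)⁻¹ ^ (2 * k + 1) * ((ρ l).toReal *
      ppMoment q l (2 * k))) (fun l => integral_nonneg fun t => norm_nonneg _) (fun l => ?_)
    (((h 0).mul_left _).add ((h (2 * k)).mul_left _))
  rw [integral_smul_ppMeasure hq]
  have e : (N : ℝ)⁻¹ ^ (0 + 1) * ((ρ l).toReal * ppMoment q l 0) + (N : ℝ)⁻¹ ^ (2 * k + 1) *
      ((ρ l).toReal * ppMoment q l (2 * k)) = (ρ l).toReal * ∑ i, 1 / (N : ℝ) * ppWeight q l i *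
      (1 + ((l.pos i : ℝ) / N) ^ (2 * k)) := by
    simp only [mul_add, Finset.sum_add_distrib]
    have h0 := sum_ppWeight_mul_pow q l 0
    simp only [pow_zero] at h0
    rw [h0, sum_ppWeight_mul_pow]
    ring
  rw [e]
  refine mul_le_mul_of_nonneg_left (Finset.sum_le_sum fun i _ => ?_) ENNReal.toReal_nonneg
  refine mul_le_mul_of_nonneg_left ?_ (mul_nonneg (by positivity) (ppWeight_nonneg hq l i))
  rw [norm_pow, Real.norm_eq_abs, pow_mul, ← sq_abs, ← pow_mul, mul_comm, pow_mul]
  nlinarith [sq_nonneg (|(l.pos i : ℝ) / N| ^ k - 1 / 2)]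

theorem hasSum_integral_pow_meanPP {q : ℝ} (hq : q ∈ Set.Icc (-1 : ℝ) 1) {N : ℕ}
    {ρ : PMF (Signature N)} (h : ∀ k, Summable fun l => (ρ l).toReal * ppMoment q l k) (k : ℕ) :
    HasSum (fun l => (N : ℝ)⁻¹ ^ (k + 1) * ((ρ l).toReal * ppMoment q l k))
      (∫ t, t ^ k ∂(meanPP q ρ)) := by
  have h1 := hasSum_integral_measure (integrable_pow_meanPP hq h k)
  refine h1.congr_fun fun l => ?_
  rw [integral_smul_ppMeasure hq, sum_ppWeight_mul_pow]
  ring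

/-! ### Exchanging the sum over signatures and the extraction of coefficients -/

theorem fallingMoment_C_mul (q : ℝ) (N p : ℕ) (c : ℂ) (G : ℕ → PowerSeries ℂ) :
    fallingMoment q N p (fun k => PowerSeries.C c * G k) = c * fallingMoment q N p G := by
  rw [fallingMoment, fallingMoment, Finset.mul_sum]
  refine Finset.sum_congr rfl fun m _ => ?_
  rw [mul_left_comm (binomSeries _), PowerSeries.coeff_C_mul]
  ring

theorem hasSum_fallingMoment {ι : Type*} (q : ℝ) (N p : ℕ) {G : ι → ℕ → PowerSeries ℂ}
    {H : ℕ → PowerSeries ℂ}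
    (h : ∀ k m, HasSum (fun l => PowerSeries.coeff m (G l k)) (PowerSeries.coeff m (H k))) :
    HasSum (fun l => fallingMoment q N p (G l)) (fallingMoment q N p H) := by
  unfold fallingMoment
  refine hasSum_sum fun m _ => HasSum.mul_left _ (HasSum.mul_left _ ?_)
  simp only [PowerSeries.coeff_mul]
  exact hasSum_sum fun x _ => (h _ _).mul_left _

theorem schurGenTerm_rootPoint (K : ℕ) {n : ℕ} {η : ℂ} (hη : ‖η‖ = 1) (ρ : PMF (Signature (n + 1)))
    (l : Signature (n + 1)) {p : ℂ × ℂ} (hp : p ∈ Metric.ball (0 : ℂ × ℂ) 1) :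
    schurGenTerm ρ l (rootPoint K (n + 1) η p) =
      ((ρ l).toReal : ℂ) / schurReg l 1 * schurSlice K η l p := by
  rw [schurGenTerm, schurChar_div_eq l (ne_zero_of_mem_ball_one (rootPoint_mem_ball K hη one_pos hp))
    (by simp), schurSlice]
  ring

theorem mul_ppMoment_eq {n K : ℕ} (hK : K ≤ n) {η : ℂ} (hη : IsPrimitiveRoot η (K + 1))
    (ρ : PMF (Signature (n + 1))) (l : Signature (n + 1)) (q : ℝ) {k : ℕ} (hk : k ≤ K ∨ K = n) :
    ((((ρ l).toReal * ppMoment q l k : ℝ)) : ℂ) =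
      ∑ p ∈ Finset.range (k + 1), (k.stirlingSecond p : ℂ) *
        fallingMoment q (n + 1) p (fun j => taylorSeries (diagDeriv j
          (fun p => ((ρ l).toReal : ℂ) / schurReg l 1 * schurSlice K η l p))) := by
  have hη1 := hη.norm'_eq_one K.succ_ne_zero
  have hG := analyticOnNhd_schurSlice K hη1 l
  rw [Complex.ofReal_mul, coe_ppMoment_eq_sum, Finset.mul_sum]
  refine Finset.sum_congr rfl fun p hp => ?_
  rw [Finset.mem_range] at hp
  have h1 := sum_fallingFactorial_mul_ppWeight_of_le hK hη l q (p := p)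
    (hk.imp_left fun h => by omega)
  have h2 : (fun j => taylorSeries (diagDeriv j
      (fun p => ((ρ l).toReal : ℂ) / schurReg l 1 * schurSlice K η l p))) = fun j =>
      PowerSeries.C (((ρ l).toReal : ℂ) / schurReg l 1) *
        taylorSeries (diagDeriv j (schurSlice K η l)) := by
    funext j
    rw [diagDeriv_const_mul, taylorSeries_const_mul _ (hG.analyticAt_diagDeriv one_pos j)]
  rw [h2, fallingMoment_C_mul, ← h1]
  have := schurReg_one_ne_zero l
  field_simp

theorem SchurGenConverges.exists_tendstoUniformlyOn {n : ℕ} {ρ : PMF (Signature (n + 1))}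
    (h : SchurGenConverges ρ) (K : ℕ) {η : ℂ} (hη : ‖η‖ = 1) :
    ∃ r, 0 < r ∧ r ≤ 1 ∧ ∀ s ≤ r, TendstoUniformlyOn (fun (t : Finset (Signature (n + 1))) p =>
      ∑ l ∈ t, ((ρ l).toReal : ℂ) / schurReg l 1 * schurSlice K η l p)
      (fun p => schurGen ρ (rootPoint K (n + 1) η p)) atTop (Metric.ball 0 s) := by
  obtain ⟨V, hV, hs⟩ := h
  obtain ⟨r, hr, hrV⟩ := Metric.mem_nhds_iff.1 hV
  refine ⟨min r 1, lt_min hr one_pos, min_le_right _ _, fun s hs' => ?_⟩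
  have h1 := (hasSumUniformlyOn_iff_tendstoUniformlyOn.1 hs.hasSumUniformlyOn).mono hrV
  have h2 := (h1.comp (rootPoint K (n + 1) η)).mono (s' := Metric.ball 0 s) fun p hp =>
    Metric.ball_subset_ball (min_le_left r 1) (rootPoint_mem_ball K hη (lt_min hr one_pos)
      (Metric.ball_subset_ball hs' hp))
  refine h2.congr (Eventually.of_forall fun t p hp => ?_)
  exact Finset.sum_congr rfl fun l _ => schurGenTerm_rootPoint K hη ρ l
    (Metric.ball_subset_ball (hs'.trans (min_le_right _ _)) hp)

/-- Here K = n: with all variables present there is no truncation, so the moment formula holds for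
every k, including k > n. -/
theorem SchurGenConverges.summable_ppMoment {n : ℕ} {ρ : PMF (Signature (n + 1))}
    (h : SchurGenConverges ρ) (q : ℝ) (k : ℕ) :
    Summable fun l => (ρ l).toReal * ppMoment q l k := by
  obtain ⟨η, hη⟩ : ∃ η : ℂ, IsPrimitiveRoot η (n + 1) :=
    ⟨_, Complex.isPrimitiveRoot_exp (n + 1) n.succ_ne_zero⟩
  have hη1 := hη.norm'_eq_one n.succ_ne_zero
  obtain ⟨r, hr, hr1, hu⟩ := h.exists_tendstoUniformlyOn n hη1
  have hF : ∀ l : Signature (n + 1), AnalyticOnNhd ℂ (fun p => ((ρ l).toReal : ℂ) / schurReg l 1 *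
      schurSlice n η l p) (Metric.ball 0 r) :=
    fun l => analyticOnNhd_const.mul
      ((analyticOnNhd_schurSlice n hη1 l).mono (Metric.ball_subset_ball hr1))
  rw [← Complex.summable_ofReal]
  refine (summable_congr fun l => mul_ppMoment_eq le_rfl hη ρ l q (Or.inr rfl)).2 ?_
  refine summable_sum fun p _ => Summable.mul_left _ ?_
  refine (hasSum_fallingMoment q (n + 1) p (H := fun j => PowerSeries.mk fun m =>
    ∑' l : Signature (n + 1), diagCoeff j m fun p => ((ρ l).toReal : ℂ) / schurReg l 1 *
      schurSlice n η l p) fun j m => ?_).summable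
  rw [PowerSeries.coeff_mk]
  exact (summable_diagCoeff hr hF (hu r le_rfl) j m).hasSum

/-- The formula for a single signature is linear in the Taylor coefficients of the Schur function,
and extracting these commutes with the uniformly convergent series. -/
theorem SchurGenConverges.integral_pow_meanPP {q : ℝ} (hq : q ∈ Set.Icc (-1 : ℝ) 1) {n : ℕ}
    {ρ : PMF (Signature (n + 1))} (h : SchurGenConverges ρ) {K : ℕ} (hK : K ≤ n) {η : ℂ}
    (hη : IsPrimitiveRoot η (K + 1)) {r : ℝ} (hr : 0 < r)
    (hS : AnalyticOnNhd ℂ (fun p => schurGen ρ (rootPoint K (n + 1) η p)) (Metric.ball 0 r))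
    {k : ℕ} (hk : k ≤ K) :
    ((∫ t, t ^ k ∂(meanPP q ρ) : ℝ) : ℂ) = ((n + 1 : ℕ) : ℂ)⁻¹ ^ (k + 1) *
      ∑ p ∈ Finset.range (k + 1), (k.stirlingSecond p : ℂ) * fallingMoment q (n + 1) p
        (fun j => taylorSeries (diagDeriv j fun p => schurGen ρ (rootPoint K (n + 1) η p))) := by
  have hη1 := hη.norm'_eq_one K.succ_ne_zero
  obtain ⟨s, hs, hs1, hu⟩ := h.exists_tendstoUniformlyOn K hη1
  have hrs : 0 < min r s := lt_min hr hs
  have hF : ∀ l : Signature (n + 1), AnalyticOnNhd ℂ (fun p => ((ρ l).toReal : ℂ) / schurReg l 1 *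
      schurSlice K η l p) (Metric.ball 0 (min r s)) :=
    fun l => analyticOnNhd_const.mul
      ((analyticOnNhd_schurSlice K hη1 l).mono
        (Metric.ball_subset_ball ((min_le_right _ _).trans hs1)))
  have h1 := hasSum_integral_pow_meanPP hq (fun k => h.summable_ppMoment q k) k
  have h2 : HasSum (fun l => ((((ρ l).toReal * ppMoment q l k : ℝ)) : ℂ))
      (∑ p ∈ Finset.range (k + 1), (k.stirlingSecond p : ℂ) * fallingMoment q (n + 1) p
        (fun j => taylorSeries (diagDeriv j fun p => schurGen ρ (rootPoint K (n + 1) η p)))) := by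
    simp only [fun l => mul_ppMoment_eq hK hη ρ l q (Or.inl hk)]
    refine hasSum_sum fun p _ => HasSum.mul_left _ ?_
    refine hasSum_fallingMoment q (n + 1) p fun j m => ?_
    exact hasSum_diagCoeff hrs hF (hS.mono (Metric.ball_subset_ball (min_le_left _ _)))
      (hu _ (min_le_right _ _)) j m
  have h3 := h2.mul_left (((n + 1 : ℕ) : ℂ)⁻¹ ^ (k + 1))
  have h4 := Complex.hasSum_ofReal.2 h1
  refine h4.unique ?_
  refine h3.congr_fun fun l => ?_
  push_cast
  ring

/-! ### Asymptotic expansion of the moments -/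

/-- Each normalized Schur function equals 1 on the diagonal up to degree K, and the probabilities
sum to 1. This is the initial condition of the recursion for the derivatives. -/
theorem SchurGenConverges.diagCoeff_zero {n : ℕ} {ρ : PMF (Signature (n + 1))}
    (h : SchurGenConverges ρ) {K : ℕ} (hK : K ≤ n) {η : ℂ} (hη : IsPrimitiveRoot η (K + 1))
    {r : ℝ} (hr : 0 < r)
    (hS : AnalyticOnNhd ℂ (fun p => schurGen ρ (rootPoint K (n + 1) η p)) (Metric.ball 0 r))
    {m : ℕ} (hm : m ≤ K) :
    diagCoeff 0 m (fun p => schurGen ρ (rootPoint K (n + 1) η p)) =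
      PowerSeries.coeff m (1 : PowerSeries ℂ) := by
  have hη1 := hη.norm'_eq_one K.succ_ne_zero
  obtain ⟨s, hs, hs1, hu⟩ := h.exists_tendstoUniformlyOn K hη1
  have hrs : 0 < min r s := lt_min hr hs
  have hG : ∀ l : Signature (n + 1), AnalyticOnNhd ℂ (schurSlice K η l) (Metric.ball 0 (min r s)) :=
    fun l => (analyticOnNhd_schurSlice K hη1 l).mono
      (Metric.ball_subset_ball ((min_le_right _ _).trans hs1))
  have hF : ∀ l : Signature (n + 1), AnalyticOnNhd ℂ (fun p => ((ρ l).toReal : ℂ) / schurReg l 1 *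
      schurSlice K η l p) (Metric.ball 0 (min r s)) := fun l => analyticOnNhd_const.mul (hG l)
  have h1 := hasSum_diagCoeff hrs hF (hS.mono (Metric.ball_subset_ball (min_le_left _ _)))
      (hu _ (min_le_right _ _)) 0 m
  have h2 : ∀ l : Signature (n + 1), ((ρ l).toReal : ℂ) * PowerSeries.coeff m (1 : PowerSeries ℂ) =
      diagCoeff 0 m (fun p => ((ρ l).toReal : ℂ) / schurReg l 1 * schurSlice K η l p) := by
    intro l
    rw [diagCoeff_const_mul _ hrs (hG l), diagCoeff_zero_schurSlice hK hη l hm]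
    have := schurReg_one_ne_zero l
    field_simp
  have h3 : HasSum (fun l => (ρ l).toReal) 1 := by
    have h4 := ENNReal.hasSum_toReal (f := ρ) (by rw [ρ.tsum_coe]; exact ENNReal.one_ne_top)
    rw [← ENNReal.tsum_toReal_eq fun l => ρ.apply_ne_top l, ρ.tsum_coe] at h4
    simpa using h4
  have h5 := (Complex.hasSum_ofReal.2 h3).mul_right (PowerSeries.coeff m (1 : PowerSeries ℂ))
  rw [Complex.ofReal_one, one_mul] at h5
  exact h1.unique (h5.congr_fun fun l => (h2 l).symm)

theorem padOnes_rootPoint {K N : ℕ} (η : ℂ) (p : ℂ × ℂ) :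
    padOnes N (rootPoint K (K + 1) η p) = rootPoint K N η p := by
  funext i
  unfold padOnes rootPoint
  by_cases h : (i : ℕ) < K + 1
  · rw [dif_pos h]
  · rw [dif_neg h, if_neg (by omega), if_neg (by omega)]

/-- Only the coordinate of index 0 depends on Y, so a single term of the sum survives
differentiation. -/
theorem diagDeriv_sum_rootPoint (K : ℕ) (η : ℂ) (f : ℂ → ℂ) (i : ℕ) :
    diagDeriv (i + 1) (fun p => ∑ j, f (rootPoint K (K + 1) η p j)) =
      fun z => iteratedDeriv (i + 1) f (1 + z) := by
  rw [← diagDeriv_shift_add f fun z => ∑ j : Fin K, f (1 + η ^ ((j : ℕ) + 1) * z)]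
  congr 1
  funext p
  rw [Fin.sum_univ_succ]
  congr 1
  refine Finset.sum_congr rfl fun j _ => ?_
  unfold rootPoint
  rw [if_neg (by simp), if_pos (by simp)]
  simp

theorem analyticOnNhd_sum_rootPoint (K : ℕ) {η : ℂ} (hη : ‖η‖ = 1) {f : ℂ → ℂ} {r : ℝ}
    (hf : ∀ u ∈ Metric.ball (1 : ℂ) r, AnalyticAt ℂ f u) :
    AnalyticOnNhd ℂ (fun p => ∑ j, f (rootPoint K (K + 1) η p j)) (Metric.ball 0 r) := by
  intro p hp
  refine Finset.analyticAt_fun_sum _ fun j _ => ?_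
  refine (hf (rootPoint K (K + 1) η p j) ?_).comp
    (f := fun p => rootPoint K (K + 1) η p j) (analyticAt_pi_iff.1 (analyticAt_rootPoint K (K + 1) η p) j)
  rw [Metric.mem_ball, dist_zero_right] at hp
  rw [Metric.mem_ball, dist_eq_norm]
  exact (norm_rootPoint_sub_one_le K hη p j).trans_lt hp

theorem taylorSeries_iteratedDeriv_two (Ψ : ℂ → ℂ) :
    taylorSeries (fun z => iteratedDeriv 2 Ψ (1 + z)) =
      PowerSeries.derivative ℂ (taylorSeries fun z => iteratedDeriv 1 Ψ (1 + z)) := by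
  rw [← taylorSeries_deriv]
  congr 1
  funext z
  rw [deriv_comp_const_add, iteratedDeriv_succ]

/-- The `1/N` expansion of the moments of the averaged Perelomov-Popov measures. -/
theorem hasExpansion_integral_pow_meanPP {ρ : ∀ N : ℕ, PMF (Signature N)} {Ψ Φ : ℂ → ℂ} {q : ℝ}
    (hq : q ∈ Set.Icc (-1 : ℝ) 1) (hconv : ∀ N : ℕ, SchurGenConverges (ρ N))
    (hΨ : AnalyticAt ℂ Ψ 1) (hΦ : AnalyticAt ℂ Φ 1) (hreg : CorrectionRegime ρ Ψ Φ) (k : ℕ) :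
    HasExpansion (fun N => ((∫ t, t ^ k ∂(meanPP q (ρ N)) : ℝ) : ℂ))
      (limMoment q (taylorSeries fun z => deriv Ψ (1 + z)) k)
      (corrMoment q (taylorSeries fun z => deriv Ψ (1 + z))
        (taylorSeries fun z => deriv Φ (1 + z)) k) := by
  -- The k-th moment uses k+1 variables: 1+Y and the k non-trivial roots of unity of order k+1.
  obtain ⟨ε, hε, L, hL, hlim⟩ := hreg (k + 1)
  obtain ⟨η, hη⟩ : ∃ η : ℂ, IsPrimitiveRoot η (k + 1) :=
    ⟨_, Complex.isPrimitiveRoot_exp (k + 1) k.succ_ne_zero⟩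
  have hη1 := hη.norm'_eq_one k.succ_ne_zero
  obtain ⟨δ, hδ, hδΨΦ⟩ := Metric.eventually_nhds_iff_ball.1
    (hΨ.eventually_analyticAt.and hΦ.eventually_analyticAt)
  set r := min ε δ with hr'
  have hr : 0 < r := lt_min hε hδ
  have hmap : ∀ p ∈ Metric.ball (0 : ℂ × ℂ) r, rootPoint k (k + 1) η p ∈ Metric.ball 1 ε :=
    fun p hp => Metric.ball_subset_ball (min_le_left _ _) (rootPoint_mem_ball k hη1 hr hp)
  have hP := analyticOnNhd_sum_rootPoint k hη1 (r := r) (f := Ψ) fun u hu =>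
    (hδΨΦ u (Metric.ball_subset_ball (min_le_right _ _) hu)).1
  have hQ := analyticOnNhd_sum_rootPoint k hη1 (r := r) (f := Φ) fun u hu =>
    (hδΨΦ u (Metric.ball_subset_ball (min_le_right _ _) hu)).2
  have hLa : ∀ᶠ N in atTop, AnalyticOnNhd ℂ (fun p => L N (rootPoint k (k + 1) η p))
      (Metric.ball 0 r) := hL.mono fun N hN p hp =>
    (hN.1 _ (hmap p hp)).comp (f := rootPoint k (k + 1) η) (analyticAt_rootPoint k (k + 1) η p)
  have hexp : ∀ᶠ N in atTop, ∀ p ∈ Metric.ball (0 : ℂ × ℂ) r,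
      Complex.exp (L N (rootPoint k (k + 1) η p)) = schurGen (ρ N) (rootPoint k N η p) :=
    hL.mono fun N hN p hp => by rw [hN.2.2 _ (hmap p hp), padOnes_rootPoint]
  have hSa : ∀ᶠ N in atTop, AnalyticOnNhd ℂ (fun p => schurGen (ρ N) (rootPoint k N η p))
      (Metric.ball 0 r) := by
    filter_upwards [hLa, hexp] with N h1 h2
    exact h1.cexp.congr Metric.isOpen_ball fun p hp => h2 p hp
  have hu : TendstoUniformlyOn (fun (N : ℕ) p => (N : ℂ) * (1 / (N : ℂ) *
      L N (rootPoint k (k + 1) η p) - ∑ j, Ψ (rootPoint k (k + 1) η p j)))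
      (fun p => ∑ j, Φ (rootPoint k (k + 1) η p j)) atTop (Metric.ball 0 r) :=
    (hlim.comp (rootPoint k (k + 1) η)).mono hmap
  have key := hasExpansion_moment (k := k) q
    (G := fun N j => taylorSeries (diagDeriv j fun p => schurGen (ρ N) (rootPoint k N η p)))
    (D := fun N i => taylorSeries (diagDeriv i fun p => L N (rootPoint k (k + 1) η p)))
    (a := fun i => taylorSeries fun z => iteratedDeriv i Ψ (1 + z))
    (b := fun i => taylorSeries fun z => iteratedDeriv i Φ (1 + z)) ?_ ?_ ?_
    (taylorSeries_iteratedDeriv_two Ψ)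
  · simp only [iteratedDeriv_one] at key
    refine key.congr' ?_
    filter_upwards [hSa, eventually_ge_atTop (k + 1)] with N hN hkN
    obtain ⟨n, rfl⟩ : ∃ n, N = n + 1 := ⟨N - 1, by omega⟩
    exact (SchurGenConverges.integral_pow_meanPP hq (hconv (n + 1)) (by omega) hη hr hN le_rfl).symm
  · filter_upwards [hSa, eventually_ge_atTop (k + 1)] with N hN hkN m hm
    obtain ⟨n, rfl⟩ : ∃ n, N = n + 1 := ⟨N - 1, by omega⟩
    exact SchurGenConverges.diagCoeff_zero (hconv (n + 1)) (by omega) hη hr hN hm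
  · filter_upwards [hLa, hexp] with N h1 h2 n
    exact taylorSeries_diagDeriv_exp hr h1 h2 n
  · intro i hi m hm
    obtain ⟨i, rfl⟩ : ∃ j, i = j + 1 := ⟨i - 1, by omega⟩
    have h1 := hasExpansion_diagCoeff hr hLa hP hQ hu (i + 1) m
    simp only [diagCoeff, diagDeriv_sum_rootPoint] at h1
    simpa only [PowerSeries.coeff_C_mul] using h1

/-- The case p = 0 of the moment formula, where only the term (N choose 1) is present. -/
theorem ppMoment_zero (q : ℝ) {n : ℕ} (l : Signature (n + 1)) :
    ppMoment q l 0 = ((n + 1 : ℕ) : ℝ) := by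
  obtain ⟨η, hη⟩ : ∃ η : ℂ, IsPrimitiveRoot η (n + 1) :=
    ⟨_, Complex.isPrimitiveRoot_exp (n + 1) n.succ_ne_zero⟩
  have h1 := sum_fallingFactorial_mul_ppWeight hη l q 0
  have h2 := diagCoeff_zero_schurSlice le_rfl hη l (Nat.zero_le n)
  rw [diagCoeff] at h2
  have h3 : fallingMoment q (n + 1) 0 (fun k => taylorSeries (diagDeriv k (schurSlice n η l))) =
      ((n + 1 : ℕ) : ℂ) * schurReg l 1 := by
    rw [fallingMoment]
    simp only [zero_add, Finset.range_one, Finset.sum_singleton, Nat.choose_self, Nat.factorial_zero,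
      Nat.choose_one_right, Nat.sub_zero]
    rw [PowerSeries.coeff_zero_eq_constantCoeff_apply] at h2 ⊢
    rw [map_mul, h2, constantCoeff_binomSeries]
    simp
  rw [h3] at h1
  have h4 := mul_right_cancel₀ (schurReg_one_ne_zero l) h1
  simp only [Finset.range_zero, Finset.prod_empty, one_mul] at h4
  rw [ppMoment]
  simp only [pow_zero, mul_one]
  exact_mod_cast h4

theorem SchurGenConverges.isProbabilityMeasure_meanPP {q : ℝ} (hq : q ∈ Set.Icc (-1 : ℝ) 1) {n : ℕ}
    {ρ : PMF (Signature (n + 1))} (h : SchurGenConverges ρ) :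
    IsProbabilityMeasure (meanPP q ρ) := by
  have h1 := hasSum_integral_pow_meanPP hq (fun k => h.summable_ppMoment q k) 0
  have hn : ((n + 1 : ℕ) : ℝ) ≠ 0 := by exact_mod_cast n.succ_ne_zero
  have h3 : HasSum (fun l => (ρ l).toReal) 1 := by
    have h4 := ENNReal.hasSum_toReal (f := ρ) (by rw [ρ.tsum_coe]; exact ENNReal.one_ne_top)
    rw [← ENNReal.tsum_toReal_eq fun l => ρ.apply_ne_top l, ρ.tsum_coe] at h4
    simpa using h4
  have h5 := (h1.congr_fun (g := fun l => (ρ l).toReal) fun l => by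
    rw [ppMoment_zero, zero_add, pow_one]
    field_simp).unique h3
  simp only [pow_zero, integral_const, smul_eq_mul, mul_one] at h5
  exact ⟨(ENNReal.toReal_eq_one_iff _).1 h5⟩

/-! ### The limiting measure -/

/-- Cauchy's estimate for f g^k on one fixed circle on which f and g are bounded. -/
theorem exists_norm_coeff_mul_pow_le {f g : ℂ → ℂ} (hf : AnalyticAt ℂ f 0) (hg : AnalyticAt ℂ g 0) :
    ∃ C R : ℝ, ∀ k : ℕ,
      ‖PowerSeries.coeff k (taylorSeries f * taylorSeries g ^ k)‖ ≤ C * R ^ k := by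
  set M := max (‖f 0‖ + 1) (‖g 0‖ + 1) with hM
  have hM0 : 0 < M := lt_of_lt_of_le (by positivity) (le_max_left _ _)
  have hfM : ∀ᶠ z in 𝓝 0, ‖f z‖ < M :=
    hf.continuousAt.norm.eventually_lt_const (lt_of_lt_of_le (lt_add_one _) (le_max_left _ _))
  have hgM : ∀ᶠ z in 𝓝 0, ‖g z‖ < M :=
    hg.continuousAt.norm.eventually_lt_const (lt_of_lt_of_le (lt_add_one _) (le_max_right _ _))
  obtain ⟨r, hr, h⟩ := Metric.eventually_nhds_iff_ball.1
    ((hf.eventually_analyticAt.and hg.eventually_analyticAt).and (hfM.and hgM))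
  have hs0 : 0 < r / 2 := by positivity
  have hsub : ∀ z ∈ Metric.closedBall (0 : ℂ) (r / 2), z ∈ Metric.ball (0 : ℂ) r := fun z hz =>
    Metric.closedBall_subset_ball (by linarith) hz
  refine ⟨M, M / (r / 2), fun k => ?_⟩
  rw [← taylorSeries_pow hg, ← taylorSeries_mul hf (hg.fun_pow k), coeff_taylorSeries, norm_div,
    Complex.norm_natCast, div_le_iff₀ (by exact_mod_cast k.factorial_pos)]
  have := Complex.norm_iteratedDeriv_le_of_forall_mem_sphere_norm_le (c := 0)
    (f := fun z => f z * g z ^ k) (C := M * M ^ k) k hs0 ?_ ?_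
  · calc _ ≤ k.factorial * (M * M ^ k) / (r / 2) ^ k := this
      _ = _ := by rw [div_pow M]; ring
  · refine DifferentiableOn.diffContOnCl ?_
    rw [closure_ball 0 hs0.ne']
    intro z hz
    have hz' := h z (hsub z hz)
    exact (hz'.1.1.fun_mul (hz'.1.2.fun_pow k)).differentiableAt.differentiableWithinAt
  · intro z hz
    have hz' := h z (hsub z (Metric.sphere_subset_closedBall hz))
    rw [norm_mul, norm_pow]
    exact mul_le_mul hz'.2.1.le (pow_le_pow_left₀ (norm_nonneg _) hz'.2.2.le k) (by positivity)
      hM0.le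

theorem binomSeries_add_natCast (s : ℂ) (k : ℕ) :
    binomSeries (k + s) = binomSeries s * (1 + PowerSeries.X) ^ k := by
  induction k with
  | zero => simp
  | succ k ih =>
    rw [Nat.cast_add_one, show (k : ℂ) + 1 + s = k + s + 1 by ring, binomSeries_add_one, ih]
    ring

/-- With U = 1 + zψ, the k-th moment times k+1 is the coefficient of degree k of (1+z)^(-q) U ·
((1+z) U)^k, a fixed function times a k-th power. -/
theorem exists_norm_limMoment_le (q : ℝ) {ψ : ℂ → ℂ} (hψ : AnalyticAt ℂ ψ 0) :
    ∃ C R : ℝ, ∀ k : ℕ, ‖limMoment q (taylorSeries ψ) k‖ ≤ C * R ^ k := by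
  have hz : AnalyticAt ℂ (fun z : ℂ => z) 0 := analyticAt_id
  have hU : AnalyticAt ℂ (fun z => 1 + z * ψ z) 0 :=
    analyticAt_const.fun_add (hz.fun_mul hψ)
  have h1z : AnalyticAt ℂ (fun z : ℂ => 1 + z) 0 := by fun_prop
  obtain ⟨C, R, h⟩ := exists_norm_coeff_mul_pow_le
    ((analyticAt_one_add_cpow (-q)).fun_mul hU) (h1z.fun_mul hU)
  refine ⟨C, R, fun k => ?_⟩
  have e : taylorSeries (fun z => 1 + z * ψ z) = 1 + PowerSeries.X * taylorSeries ψ := by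
    rw [taylorSeries_add analyticAt_const (hz.fun_mul hψ), taylorSeries_const,
      taylorSeries_mul hz hψ, map_one, taylorSeries_id]
  have e2 : taylorSeries (fun z : ℂ => 1 + z) = 1 + PowerSeries.X := by
    rw [taylorSeries_add analyticAt_const hz, taylorSeries_const, map_one, taylorSeries_id]
  have h2 := h k
  rw [taylorSeries_mul (analyticAt_one_add_cpow _) hU, taylorSeries_mul h1z hU, e, e2] at h2
  have h3 := limMoment_eq q (taylorSeries ψ) k
  rw [sub_eq_add_neg, binomSeries_add_natCast] at h3
  have e3 : binomSeries (-q) * (1 + PowerSeries.X) ^ k *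
      (1 + PowerSeries.X * taylorSeries ψ) ^ (k + 1) =
      (taylorSeries fun z => (1 + z) ^ (-(q : ℂ))) * (1 + PowerSeries.X * taylorSeries ψ) *
        ((1 + PowerSeries.X) * (1 + PowerSeries.X * taylorSeries ψ)) ^ k := by
    rw [binomSeries, mul_pow]; ring
  rw [← e3, ← h3, norm_mul] at h2
  refine le_trans ?_ h2
  have h4 : ‖(k : ℂ) + 1‖ = (k : ℝ) + 1 := by
    have := Complex.norm_natCast (k + 1)
    push_cast at this
    exact this
  rw [h4]
  have := norm_nonneg (limMoment q (taylorSeries ψ) k)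
  nlinarith [(Nat.cast_nonneg k : (0 : ℝ) ≤ k)]

/-- Clamping to [-S, S] changes only the points with |t| > S, where (|t|/S)^(2n) ≥ 1 and |t|^k ≤
|t|^(2k). -/
theorem abs_projIcc_pow_sub_pow_le {S : ℝ} (hS : 1 ≤ S) (t : ℝ) (k n : ℕ) :
    |(Set.projIcc (-S) S (by linarith) t : ℝ) ^ k - t ^ k| ≤
      2 / S ^ (2 * n) * t ^ (2 * k + 2 * n) := by
  have hS0 : 0 < S := by linarith
  have hpos : 0 ≤ t ^ (2 * k + 2 * n) := by
    rw [← mul_add]; exact (even_two_mul _).pow_nonneg t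
  rcases le_or_gt |t| S with h | h
  · rw [Set.projIcc_of_mem _ (abs_le.1 h), sub_self, abs_zero]
    positivity
  · have h1 : |(Set.projIcc (-S) S (by linarith) t : ℝ)| ≤ |t| :=
      (abs_le.2 (Set.projIcc (-S) S (by linarith) t).2).trans h.le
    have ht1 : 1 ≤ |t| := hS.trans h.le
    calc _ ≤ |(Set.projIcc (-S) S (by linarith) t : ℝ)| ^ k + |t| ^ k := by
          rw [← abs_pow, ← abs_pow]; exact abs_sub _ _
      _ ≤ |t| ^ k + |t| ^ k := by gcongr
      _ = 2 * |t| ^ k := by ring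
      _ ≤ 2 * |t| ^ (2 * k) := by
          gcongr 2 * ?_
          exact pow_le_pow_right₀ ht1 (by omega)
      _ = 2 / S ^ (2 * n) * (|t| ^ (2 * k) * S ^ (2 * n)) := by field_simp
      _ ≤ 2 / S ^ (2 * n) * (|t| ^ (2 * k) * |t| ^ (2 * n)) := by gcongr
      _ = _ := by
          rw [← pow_add, ← mul_add, (even_two_mul _).pow_abs]

/-- A sequence of probability measures whose moments converge to limits of at most geometric
growth has a compactly supported limit. -/
theorem exists_measure_of_tendsto_moments {ν : ℕ → Measure ℝ} [∀ N, IsProbabilityMeasure (ν N)]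
    (hint : ∀ N k, Integrable (fun t : ℝ => t ^ k) (ν N)) {m : ℕ → ℝ}
    (hlim : ∀ k, Tendsto (fun N => ∫ t, t ^ k ∂(ν N)) atTop (𝓝 (m k))) {C R : ℝ}
    (hm : ∀ k, |m k| ≤ C * R ^ k) :
    ∃ μ : Measure ℝ, IsProbabilityMeasure μ ∧ (∃ R : ℝ, μ (Set.Icc (-R) R)ᶜ = 0) ∧
      ∀ k, ∫ t, t ^ k ∂μ = m k := by
  have hC : 0 ≤ C := by simpa using (abs_nonneg _).trans (hm 0)
  -- Twice the growth rate of the moments, so that the tail bound decays like (1/4)^n.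
  set S := 2 * max |R| 1 with hSdef
  have hR1 : 1 ≤ max |R| 1 := le_max_right _ _
  have hS : 1 ≤ S := by linarith
  have hSS : -S ≤ S := by linarith
  set c : ℝ → Set.Icc (-S) S := Set.projIcc (-S) S hSS with hc
  have hcc : Continuous c := continuous_projIcc
  have hck : ∀ k N, Integrable (fun t => (c t : ℝ) ^ k) (ν N) := fun k N => by
    refine Integrable.of_bound (C := S ^ k)
      ((continuous_subtype_val.comp hcc).pow k).aestronglyMeasurable (Eventually.of_forall fun t => ?_)
    rw [norm_pow, Real.norm_eq_abs]
    exact pow_le_pow_left₀ (abs_nonneg _) (abs_le.2 (c t).2) k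
  have hdiff : ∀ k, Tendsto (fun N => ∫ t, (c t : ℝ) ^ k ∂(ν N) - ∫ t, t ^ k ∂(ν N)) atTop
      (𝓝 0) := by
    intro k
    have hb : ∀ n N, |∫ t, (c t : ℝ) ^ k ∂(ν N) - ∫ t, t ^ k ∂(ν N)| ≤
        2 / S ^ (2 * n) * ∫ t, t ^ (2 * k + 2 * n) ∂(ν N) := by
      intro n N
      rw [← integral_sub (hck k N) (hint N k), ← integral_const_mul]
      refine (abs_integral_le_integral_abs).trans (integral_mono ((hck k N).sub (hint N k)).abs
        ((hint N _).const_mul _) fun t => abs_projIcc_pow_sub_pow_le hS t k n)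
    rw [Metric.tendsto_nhds]
    intro ε hε
    obtain ⟨n, hn⟩ := exists_pow_lt_of_lt_one (show 0 < ε / (2 * C * max |R| 1 ^ (2 * k) + 1) by
      positivity) (show (1 / 4 : ℝ) < 1 by norm_num)
    have h1 : 2 / S ^ (2 * n) * m (2 * k + 2 * n) < ε := by
      have h2 : m (2 * k + 2 * n) ≤ C * max |R| 1 ^ (2 * k + 2 * n) := by
        refine (le_abs_self _).trans ((hm _).trans ?_)
        refine mul_le_mul_of_nonneg_left ?_ hC
        rw [← mul_add, pow_mul, pow_mul, ← sq_abs]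
        gcongr
        exact le_max_left _ _
      calc _ ≤ 2 / S ^ (2 * n) * (C * max |R| 1 ^ (2 * k + 2 * n)) := by gcongr
        _ = 2 * C * max |R| 1 ^ (2 * k) * (1 / 4) ^ n := by
            rw [hSdef, mul_pow, pow_add, pow_mul 2 2 n, one_div, inv_pow]
            have : max |R| 1 ^ (2 * n) ≠ 0 := by positivity
            norm_num
            field_simp
        _ ≤ (2 * C * max |R| 1 ^ (2 * k) + 1) * (1 / 4) ^ n := by
            gcongr
            linarith
        _ < _ := by
            rw [lt_div_iff₀ (by positivity)] at hn
            linarith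
    filter_upwards [((hlim (2 * k + 2 * n)).const_mul (2 / S ^ (2 * n))).eventually_lt_const h1]
      with N hN
    rw [Real.dist_eq, sub_zero]
    exact (hb n N).trans_lt hN
  have hlim' : ∀ k, Tendsto (fun N => ∫ t, (c t : ℝ) ^ k ∂(ν N)) atTop (𝓝 (m k)) := fun k => by
    simpa using (hdiff k).add (hlim k)
  set P : ℕ → ProbabilityMeasure (Set.Icc (-S) S) := fun N =>
    ⟨(ν N).map c, Measure.isProbabilityMeasure_map hcc.aemeasurable⟩ with hP
  -- The clamped measures live in the compact space of probability measures on [-S, S]; a limit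
  -- along an ultrafilter suffices because all moments converge.
  set U := Ultrafilter.of (atTop : Filter ℕ) with hU
  have hPlim : Tendsto P U (𝓝 (U.map P).lim) := (U.map P).le_nhds_lim
  set μ' := (U.map P).lim
  rw [ProbabilityMeasure.tendsto_iff_forall_integral_tendsto] at hPlim
  have hmom : ∀ k, ∫ x, (x : ℝ) ^ k ∂(μ' : Measure (Set.Icc (-S) S)) = m k := by
    intro k
    have h1 := hPlim (BoundedContinuousFunction.mkOfCompact
      ⟨fun x : Set.Icc (-S) S => (x : ℝ) ^ k, by fun_prop⟩)
    refine tendsto_nhds_unique h1 ((hlim' k).mono_left (Ultrafilter.of_le _) |>.congr fun N => ?_)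
    have h2 : Continuous fun x : Set.Icc (-S) S => (x : ℝ) ^ k := by fun_prop
    exact (integral_map hcc.aemeasurable h2.aestronglyMeasurable).symm
  refine ⟨(μ' : Measure (Set.Icc (-S) S)).map Subtype.val,
    Measure.isProbabilityMeasure_map measurable_subtype_coe.aemeasurable, ⟨S, ?_⟩, fun k => ?_⟩
  · rw [Measure.map_apply measurable_subtype_coe measurableSet_Icc.compl]
    simp
  · rw [integral_map measurable_subtype_coe.aemeasurable
      (Continuous.aestronglyMeasurable (by fun_prop)), hmom]

/-! ### From moments to polynomials, cumulants and the theorem. -/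

theorem tendsto_re_of_tendsto_ofReal {x : ℕ → ℝ} {a : ℂ}
    (h : Tendsto (fun N => (x N : ℂ)) atTop (𝓝 a)) :
    Tendsto x atTop (𝓝 a.re) ∧ (a.re : ℂ) = a := by
  have h1 := (Complex.continuous_re.tendsto a).comp h
  have h2 := (Complex.continuous_im.tendsto a).comp h
  have h3 : a.im = 0 := tendsto_nhds_unique h2 (by
    simp only [Function.comp_def, Complex.ofReal_im]
    exact tendsto_const_nhds)
  exact ⟨h1, Complex.ext rfl (by simp [h3])⟩

theorem integral_polynomial_eval {ν : Measure ℝ}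
    (hν : ∀ k : ℕ, Integrable (fun t : ℝ => t ^ k) ν) (P : Polynomial ℝ) :
    ∫ t, P.eval t ∂ν = P.sum fun k a => a * ∫ t, t ^ k ∂ν := by
  simp only [Polynomial.eval_eq_sum, Polynomial.sum_def]
  rw [integral_finsetSum _ fun k _ => (hν k).const_mul _]
  simp only [integral_const_mul]

/-- The linear functional on polynomials with prescribed values on the monomials. -/
noncomputable def momentFunctional (m : ℕ → ℝ) : Polynomial ℝ →ₗ[ℝ] ℝ :=
  Polynomial.lsum fun k => m k • LinearMap.id

theorem momentFunctional_apply (m : ℕ → ℝ) (P : Polynomial ℝ) :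
    momentFunctional m P = P.sum fun k a => a * m k := by
  simp [momentFunctional, Polynomial.lsum_apply, mul_comm]

theorem momentFunctional_X_pow (m : ℕ → ℝ) (k : ℕ) :
    momentFunctional m (Polynomial.X ^ k) = m k := by
  rw [momentFunctional_apply, Polynomial.X_pow_eq_monomial, Polynomial.sum_monomial_index] <;> simp

theorem integrable_pow_of_measure_compl_Icc_eq_zero {μ : Measure ℝ} [IsFiniteMeasure μ] {R : ℝ}
    (h : μ (Set.Icc (-R) R)ᶜ = 0) (k : ℕ) : Integrable (fun t : ℝ => t ^ k) μ := by
  refine Integrable.of_bound (C := R ^ k) (by fun_prop) ?_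
  have h1 : ∀ᵐ t ∂μ, t ∈ Set.Icc (-R) R := mem_ae_iff.2 h
  filter_upwards [h1] with t ht
  rw [norm_pow, Real.norm_eq_abs]
  exact pow_le_pow_left₀ (abs_nonneg _) (abs_le.2 ht) k

theorem coeff_X_mul_taylorSeries (f : ℂ → ℂ) {n : ℕ} (hn : 1 ≤ n) :
    PowerSeries.coeff n (PowerSeries.X * taylorSeries f) =
      1 / ((n - 1).factorial : ℂ) * iteratedDeriv (n - 1) f 0 := by
  obtain ⟨n, rfl⟩ : ∃ j, n = j + 1 := ⟨n - 1, by omega⟩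
  rw [PowerSeries.coeff_succ_X_mul, coeff_taylorSeries, Nat.add_sub_cancel]
  ring

theorem limMoment_eq_coeff_pow (q : ℝ) {ψ : ℂ → ℂ} (hψ : AnalyticAt ℂ ψ 1) (k : ℕ) :
    ((k : ℂ) + 1) * limMoment q (taylorSeries fun z => ψ (1 + z)) k =
      PowerSeries.coeff k ((betaSeries q +
        PowerSeries.X * taylorSeries fun u => expQ q u * ψ (expQ q u)) ^ (k + 1)) := by
  have h := coeff_binomSeries_mul_pow q hψ (γ := fun _ => 1) analyticAt_const k
  rw [taylorSeries_const, map_one, mul_one, mul_one] at h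
  rw [limMoment_eq, h]

/-- The substitution 1+z = e_q(u) with γ(x) = x χ(x) + (q-1)/2, in degree k-1; the missing degree is
the factor X of the infinitesimal cumulant series. -/
theorem corrMoment_eq_coeff_pow_mul (q : ℝ) {ψ χ : ℂ → ℂ} (hψ : AnalyticAt ℂ ψ 1)
    (hχ : AnalyticAt ℂ χ 1) {k : ℕ} (hk : 1 ≤ k) :
    corrMoment q (taylorSeries fun z => ψ (1 + z)) (taylorSeries fun z => χ (1 + z)) k =
      PowerSeries.coeff k ((betaSeries q +
        PowerSeries.X * taylorSeries fun u => expQ q u * ψ (expQ q u)) ^ k *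
        (PowerSeries.X * taylorSeries fun u => expQ q u * χ (expQ q u) + ((q : ℂ) - 1) / 2)) := by
  obtain ⟨j, rfl⟩ : ∃ j, k = j + 1 := ⟨k - 1, by omega⟩
  have hγ : AnalyticAt ℂ (fun u => u * χ u + ((q : ℂ) - 1) / 2) 1 :=
    (analyticAt_id.fun_mul hχ).fun_add analyticAt_const
  have h := coeff_binomSeries_mul_pow q hψ hγ j
  have h1z : AnalyticAt ℂ (fun z : ℂ => 1 + z) 0 := by fun_prop
  have hz : AnalyticAt ℂ (fun z : ℂ => z) 0 := analyticAt_id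
  have hχ' : AnalyticAt ℂ (fun z => χ (1 + z)) 0 :=
    AnalyticAt.comp (g := χ) (f := fun z : ℂ => 1 + z) (by simpa using hχ) h1z
  have e : (taylorSeries fun z => (1 + z) * χ (1 + z) + ((q : ℂ) - 1) / 2) =
      (1 + PowerSeries.X) * (taylorSeries fun z => χ (1 + z)) +
        PowerSeries.C (((q : ℂ) - 1) / 2) := by
    rw [taylorSeries_add (h1z.fun_mul hχ') analyticAt_const, taylorSeries_mul h1z hχ',
      taylorSeries_add analyticAt_const hz, taylorSeries_const, taylorSeries_const, map_one,
      taylorSeries_id]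
  rw [e] at h
  rw [corrMoment_succ, h, mul_left_comm, PowerSeries.coeff_succ_X_mul]

theorem coeff_X_mul_taylorSeries_add_const (f : ℂ → ℂ) (hf : AnalyticAt ℂ f 0) (c : ℝ) {n : ℕ}
    (hn : 1 ≤ n) : PowerSeries.coeff n (PowerSeries.X * taylorSeries fun u => f u + (c : ℂ)) =
      1 / ((n - 1).factorial : ℂ) * iteratedDeriv (n - 1) f 0 +
        (freeCumulant (momentSeq (Measure.dirac c)) n : ℂ) := by
  rw [taylorSeries_add hf analyticAt_const, mul_add, map_add, coeff_X_mul_taylorSeries f hn,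
    freeCumulant_dirac c n hn, taylorSeries_const]
  obtain ⟨n, rfl⟩ : ∃ j, n = j + 1 := ⟨n - 1, by omega⟩
  rw [PowerSeries.coeff_succ_X_mul, PowerSeries.coeff_C]
  by_cases h : n = 0 <;> simp [h]

theorem mainTheorem4 (ρ : ∀ N : ℕ, PMF (Signature N)) (Ψ Φ : ℂ → ℂ) (q : ℝ)
    (hq : q ∈ Set.Icc (-1 : ℝ) 1)
    (hconv : ∀ N : ℕ, SchurGenConverges (ρ N))
    (hΨ : AnalyticAt ℂ Ψ 1) (hΦ : AnalyticAt ℂ Φ 1)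
    (hreg : CorrectionRegime ρ Ψ Φ) :
    (∀ N k : ℕ, Integrable (fun t : ℝ => t ^ k) (meanPP q (ρ N))) ∧
    ∃ μ : Measure ℝ, IsProbabilityMeasure μ ∧ (∃ R : ℝ, μ (Set.Icc (-R) R)ᶜ = 0) ∧
      (∀ P : Polynomial ℝ,
        Tendsto (fun N : ℕ => ∫ t, P.eval t ∂(meanPP q (ρ N))) atTop (𝓝 (∫ t, P.eval t ∂μ))) ∧
      ∃ φ' : Polynomial ℝ →ₗ[ℝ] ℝ, φ' 1 = 0 ∧
        (∀ P : Polynomial ℝ,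
          Tendsto (fun N : ℕ => (N : ℝ) * (∫ t, P.eval t ∂(meanPP q (ρ N)) - ∫ t, P.eval t ∂μ))
            atTop (𝓝 (φ' P))) ∧
        ∀ n : ℕ, 1 ≤ n →
          (freeCumulant (momentSeq μ) n : ℂ) =
            1 / ((n - 1).factorial : ℂ) *
                iteratedDeriv (n - 1) (fun u : ℂ => expQ q u * deriv Ψ (expQ q u)) 0
              + (freeCumulant (momentSeq (betaPP q)) n : ℂ) ∧
          (infFreeCumulant (momentSeq μ) (fun k => φ' (Polynomial.X ^ k)) n : ℂ) =
            1 / ((n - 1).factorial : ℂ) *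
                iteratedDeriv (n - 1) (fun u : ℂ => expQ q u * deriv Φ (expQ q u)) 0
              + (freeCumulant (momentSeq (Measure.dirac ((q - 1) / 2))) n : ℂ) := by
  have hint : ∀ N k : ℕ, Integrable (fun t : ℝ => t ^ k) (meanPP q (ρ N)) := by
    intro N k
    rcases N with _ | n
    -- For N = 0 the sum of point masses is empty.
    · have h0 : meanPP q (ρ 0) = 0 := by
        ext s
        simp [meanPP, ppMeasure]
      rw [h0]
      exact integrable_zero_measure
    · exact integrable_pow_meanPP hq (fun k => (hconv (n + 1)).summable_ppMoment q k) k
  refine ⟨hint, ?_⟩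
  set A := taylorSeries fun z => deriv Ψ (1 + z) with hA
  set B := taylorSeries fun z => deriv Φ (1 + z) with hB
  have hexp := hasExpansion_integral_pow_meanPP hq hconv hΨ hΦ hreg
  have hlim := fun k => tendsto_re_of_tendsto_ofReal (hexp k).tendsto
  have hcorr : ∀ k, Tendsto (fun N : ℕ => (N : ℝ) *
      (∫ t, t ^ k ∂(meanPP q (ρ N)) - (limMoment q A k).re)) atTop
      (𝓝 (corrMoment q A B k).re) ∧ ((corrMoment q A B k).re : ℂ) = corrMoment q A B k := by
    intro k
    refine tendsto_re_of_tendsto_ofReal ((hexp k).congr fun N => ?_)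
    rw [Complex.ofReal_mul, Complex.ofReal_sub, (hlim k).2, Complex.ofReal_natCast]
  have hΨ' : AnalyticAt ℂ (fun z => deriv Ψ (1 + z)) 0 :=
    AnalyticAt.comp (g := deriv Ψ) (f := fun z : ℂ => 1 + z) (by simpa using hΨ.deriv) (by fun_prop)
  obtain ⟨C, R, hCR⟩ := exists_norm_limMoment_le q hΨ'
  have hprob : ∀ N, IsProbabilityMeasure (meanPP q (ρ (N + 1))) := fun N =>
    (hconv (N + 1)).isProbabilityMeasure_meanPP hq
  -- The index is shifted by one because the measure for N = 0 is zero, not a probability measure.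
  obtain ⟨μ, hμ, ⟨R', hR'⟩, hμm⟩ := exists_measure_of_tendsto_moments
    (ν := fun N => meanPP q (ρ (N + 1))) (fun N => hint (N + 1))
    (fun k => (hlim k).1.comp (tendsto_add_atTop_nat 1))
    fun k => (Complex.abs_re_le_norm _).trans (hCR k)
  have hμint := integrable_pow_of_measure_compl_Icc_eq_zero hR'
  refine ⟨μ, hμ, ⟨R', hR'⟩, fun P => ?_, momentFunctional fun k => (corrMoment q A B k).re, ?_,
    fun P => ?_, fun n hn => ?_⟩
  · simp only [integral_polynomial_eval (hint _), integral_polynomial_eval hμint, hμm,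
      Polynomial.sum_def]
    exact tendsto_finsetSum _ fun k _ => (hlim k).1.const_mul _
  · rw [← pow_zero Polynomial.X, momentFunctional_X_pow, corrMoment_zero, Complex.zero_re]
  · simp only [integral_polynomial_eval (hint _), integral_polynomial_eval hμint, hμm,
      momentFunctional_apply, Polynomial.sum_def, ← Finset.sum_sub_distrib, Finset.mul_sum]
    refine tendsto_finsetSum _ fun k _ => ((hcorr k).1.const_mul (P.coeff k)).congr fun N => ?_
    ring
  · have he := analyticAt_expQ q
    have hΨe : AnalyticAt ℂ (fun u => expQ q u * deriv Φ (expQ q u)) 0 :=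
      he.fun_mul (AnalyticAt.comp (g := deriv Φ) (by rw [expQ_zero]; exact hΦ.deriv) he)
    have h0 : PowerSeries.constantCoeff (betaSeries q + PowerSeries.X *
        taylorSeries fun u => expQ q u * deriv Ψ (expQ q u)) = 1 := by
      rw [map_add, constantCoeff_betaSeries]
      simp
    -- From here the cumulants are the coefficients of u e_q/(e_q - 1) + u e_q Ψ'(e_q), whose two
    -- summands are the two terms of the claim.
    have h1 : ∀ k : ℕ, 1 ≤ k → ((k : ℂ) + 1) * (momentSeq μ k : ℂ) =
        PowerSeries.coeff k ((betaSeries q + PowerSeries.X *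
          taylorSeries fun u => expQ q u * deriv Ψ (expQ q u)) ^ (k + 1)) := by
      intro k _
      rw [momentSeq, hμm, (hlim k).2, limMoment_eq_coeff_pow q hΨ.deriv]
    constructor
    · rw [freeCumulant_eq_coeff _ _ h0 h1 n hn, map_add, coeff_X_mul_taylorSeries _ hn,
        freeCumulant_betaPP hq n hn, add_comm]
    · simp only [momentFunctional_X_pow]
      rw [infFreeCumulant_eq_coeff _ _ _ (PowerSeries.X *
        taylorSeries fun u => expQ q u * deriv Φ (expQ q u) + (((q - 1) / 2 : ℝ) : ℂ)) h0 (by simp)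
        h1 (fun k hk => ?_) n hn, coeff_X_mul_taylorSeries_add_const _ hΨe _ hn]
      rw [(hcorr k).2, corrMoment_eq_coeff_pow_mul q hΨ.deriv hΦ.deriv hk]
      push_cast
      rfl
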